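/- Let $\mathbb{N}=\{0,1,2,\dots\}$. A strictly increasing sequence of integers $G=(G_j)_{j\ge 0}$ is called a linear recurrence base with coefficients $a_1,\dots,a_d\in\mathbb{N}$, where $d\ge 1$ and $a_d>0$, if 1. $G_0=1$ and $a_1G_{k-1}+\cdots+a_kG_0<G_k$ for $1\le k<d$; 2. $G_{n+d}=a_1G_{n+d-1}+\cdots+a_dG_n$ for all $n\ge 0$; 3. $(a_k,\dots,a_d)\preceq(a_1,\dots,a_{d-k+1})$ in the lexicographic order for $1<k\le d$. Every integer $\nu\ge 1$ has a unique greedy expansion $\nu=\varepsilon_0(\nu)G_0+\cdots+\varepsilon_\ell(\nu)G_\ell$, where $G_\ell\le\nu<G_{\ell+1}$ and $0\le \nu-\varepsilon_\ell(\nu)G_\ell-\cdots-\varepsilon_j(\nu)G_j<G_j$ for $0\le j\le \ell$. Put $s_G(\nu)=\varepsilon_0(\nu)+\cdots+\varepsilon_\ell(\nu)$ and $s_G(0)=0$. Let $\alpha$ be the dominant root of $X^d-a_1X^{d-1}-\cdots-a_d$; this is a real number $>1$. For $1\le j\le d$ with $a_j\ne 0$ put $$m_G(j)=\frac1{a_1}\sum_{b=0}^{a_1-1}\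 \sup_{b/a_1<y<(b+1)/a_1}\left|\frac{\sin(\pi a_jy)}{\sin(\pi y)}\right|,$$ let $m_G=\max\{m_G(j):1\le j\le d,\ a_j\ne 0\}$, and let $$\vartheta(G)=\max\left\{\tfrac12,\ 1-\log_\alpha(m_G+3)\right\}.$$ **Theorem.** (i) Let $G$ be a linear recurrence base with coefficients $a_1,\dots,a_d$ and write $\vartheta=\vartheta(G)$. Then $\vartheta\ge\frac12$. Let $s\ge 1$ be an integer with $\gcd(a_1+\cdots+a_d-1,s)=1$, and let $A,\varepsilon>0$ be real. Then there is a constant $C$, depending only on $G$ (with its coefficients), $s$, $A$ and $\varepsilon$, such that for all $r\in\mathbb{N}$ and all real $x\ge 1$ $$\sum_{1\le q<x^{\vartheta-\varepsilon}}\ \max_{z<x}\ \max_{1\le h\le q}\ \left|\sum_{\substack{0\le k<z\\ s_G(k)\equiv r \bmod s\\ k\equiv h\bmod q}}1-\frac1q\sum_{\substack{0\le k<z\\ s_G(k)\equiv r\bmod s}}1\right|\le C\,x\,(\log 2x)^{-A},$$ where $q,h,k$ denote integers and $z$ denotes a real number. (ii) $\vartheta(G)\to1$ as $a_1\to\infty$,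 uniformly in $d$, $a_2,\dots,a_d$ and $G$: for every $\delta>0$ there is $K$ such that $|\vartheta(G)-1|<\delta$ for every linear recurrence base $G$ with $a_1\ge K$. -/

import Mathlib

open scoped BigOperators

/-- `G` is a linear recurrence base with coefficients `a₁, …, a_d` (only the values `a 1, …, a d`
of `a : ℕ → ℕ` matter); the coefficients are nonnegative integers and `a_d > 0`. -/
structure IsLinearRecurrenceBase (G : ℕ → ℕ) (d : ℕ) (a : ℕ → ℕ) : Prop where
  strictMono : StrictMono G
  one_le_d : 1 ≤ d
  last_pos : 0 < a d
  zero : G 0 = 1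
  initial : ∀ k, 1 ≤ k → k < d → ∑ i ∈ Finset.Icc 1 k, a i * G (k - i) < G k
  recurrence : ∀ n, G (n + d) = ∑ i ∈ Finset.Icc 1 d, a i * G (n + d - i)
  /-- `(a_k, …, a_d) ≼ (a_1, …, a_{d-k+1})` in the lexicographic order, for `1 < k ≤ d`. -/
  lex : ∀ k, 1 < k → k ≤ d →
    toLex (fun i : Fin (d - k + 1) => a (k + i)) ≤ toLex (fun i : Fin (d - k + 1) => a (1 + i))

/-- Sum of the greedy digits of `n` at the positions `j - 1, …, 0`: the digit at the highest
position is the quotient by `G (j - 1)`, and the expansion is continued with the remainder. -/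
def greedyDigitSumBelow (G : ℕ → ℕ) : ℕ → ℕ → ℕ
  | 0, _ => 0
  | j + 1, n => n / G j + greedyDigitSumBelow G j (n % G j)

/-- The sum-of-digits function `s_G`. For a strictly increasing `G` with `G 0 = 1` every position
`j` with `G j ≤ n` satisfies `j < n`, so that starting at position `n - 1` loses no digit (see
`sumOfDigits_eq_of_isGreedyExpansion`). -/
def sumOfDigits (G : ℕ → ℕ) (n : ℕ) : ℕ := greedyDigitSumBelow G n n

/-- `e 0, …, e l` are the digits of the greedy expansion of the positive integer `n`:
`G l ≤ n < G (l + 1)` and `0 ≤ n - e_l G_l - ⋯ - e_j G_j < G_j` for `0 ≤ j ≤ l`. -/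
def IsGreedyExpansion (G : ℕ → ℕ) (n l : ℕ) (e : ℕ → ℕ) : Prop :=
  G l ≤ n ∧ n < G (l + 1) ∧
    ∀ j ≤ l, 0 ≤ (n : ℤ) - ∑ i ∈ Finset.Icc j l, (e i : ℤ) * G i ∧
      (n : ℤ) - ∑ i ∈ Finset.Icc j l, (e i : ℤ) * G i < G j

/-- The characteristic polynomial `X^d - a₁ X^(d-1) - ⋯ - a_d`. -/
noncomputable def charPolynomial (d : ℕ) (a : ℕ → ℕ) : Polynomial ℤ :=
  Polynomial.X ^ d -
    ∑ i ∈ Finset.Icc 1 d, Polynomial.C (a i : ℤ) * Polynomial.X ^ (d - i)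

/-- `α` is the dominant root of the characteristic polynomial: it is a root, and it is larger than
the modulus of every other complex root. -/
def IsDominantRoot (d : ℕ) (a : ℕ → ℕ) (α : ℝ) : Prop :=
  Polynomial.aeval α (charPolynomial d a) = 0 ∧
    ∀ z : ℂ, Polynomial.aeval z (charPolynomial d a) = 0 → z ≠ (α : ℂ) → ‖z‖ < α

open Classical in
/-- The dominant root `α`. It exists, is unique and exceeds `1` for every linear recurrence base
(see `IsLinearRecurrenceBase.isDominantRoot_dominantRoot`); the default value `0` is then unused. -/
noncomputable def dominantRoot (d : ℕ) (a : ℕ → ℕ) : ℝ :=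
  if h : ∃ α : ℝ, IsDominantRoot d a α then h.choose else 0

/-- `m_G(j, b)`, the supremum of `|sin(π a_j y) / sin(π y)|` over `b / a₁ < y < (b + 1) / a₁`. -/
noncomputable def mGjb (a : ℕ → ℕ) (j b : ℕ) : ℝ :=
  ⨆ y : Set.Ioo ((b : ℝ) / a 1) (((b : ℝ) + 1) / a 1),
    |Real.sin (Real.pi * a j * (y : ℝ)) / Real.sin (Real.pi * (y : ℝ))|

/-- `m_G(j)`, the mean of `m_G(j, b)` over `0 ≤ b < a₁`. -/
noncomputable def mGj (a : ℕ → ℕ) (j : ℕ) : ℝ :=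
  (1 / (a 1 : ℝ)) * ∑ b ∈ Finset.range (a 1), mGjb a j b

/-- The maximum `m_G` of the finitely many `m_G(j)` with `1 ≤ j ≤ d` and `a_j ≠ 0`. -/
noncomputable def mG (d : ℕ) (a : ℕ → ℕ) : ℝ :=
  ⨆ j : {j : ℕ // 1 ≤ j ∧ j ≤ d ∧ a j ≠ 0}, mGj a j

/-- `ϑ(G) = max {1/2, 1 - log_α (m_G + 3)}`. -/
noncomputable def levelExponent (d : ℕ) (a : ℕ → ℕ) : ℝ :=
  max (1 / 2) (1 - Real.logb (dominantRoot d a) (mG d a + 3))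

/-- The absolute value of
`#{k < z : s_G(k) ≡ r mod s, k ≡ h mod q} - (1/q) #{k < z : s_G(k) ≡ r mod s}`
(for `k : ℕ`, `k < ⌈z⌉₊` is equivalent to `(k : ℝ) < z`). -/
noncomputable def discrepancy (G : ℕ → ℕ) (r s q h : ℕ) (z : ℝ) : ℝ :=
  |(((Finset.range ⌈z⌉₊).filter
        (fun k => sumOfDigits G k ≡ r [MOD s] ∧ k ≡ h [MOD q])).card : ℝ) -
    (1 / (q : ℝ)) *
      (((Finset.range ⌈z⌉₊).filter (fun k => sumOfDigits G k ≡ r [MOD s])).card : ℝ)|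

/-- The values of the discrepancy modulo `q` for real `z < x` and `1 ≤ h ≤ q`. -/
def discrepancyValues (G : ℕ → ℕ) (r s q : ℕ) (x : ℝ) : Set ℝ :=
  {D | ∃ z : ℝ, z < x ∧ ∃ h : ℕ, 1 ≤ h ∧ h ≤ q ∧ D = discrepancy G r s q h z}

/-- `max_{z < x} max_{1 ≤ h ≤ q}` of the discrepancy; for `q ≥ 1` the maximum is attained
(see `isGreatest_maxDiscrepancy`). -/
noncomputable def maxDiscrepancy (G : ℕ → ℕ) (r s q : ℕ) (x : ℝ) : ℝ :=
  sSup (discrepancyValues G r s q x)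

theorem isGreatest_maxDiscrepancy (G : ℕ → ℕ) (r s q : ℕ) (hq : 1 ≤ q) (x : ℝ) :
    IsGreatest (discrepancyValues G r s q x) (maxDiscrepancy G r s q x) := by
  have hfin : (discrepancyValues G r s q x).Finite := by
    apply Set.Finite.subset
      (((Set.finite_Iic ⌈x⌉₊).prod (Set.finite_Iic q)).image
        (fun p : ℕ × ℕ => discrepancy G r s q p.2 (p.1 : ℝ)))
    rintro D ⟨z, hz, h, _, h2, rfl⟩
    refine ⟨(⌈z⌉₊, h), ⟨Nat.ceil_mono hz.le, h2⟩, ?_⟩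
    simp [discrepancy]
  have hne : (discrepancyValues G r s q x).Nonempty :=
    ⟨_, x - 1, by linarith, 1, le_refl 1, hq, rfl⟩
  exact ⟨hne.csSup_mem hfin, fun D hD => le_csSup hfin.bddAbove hD⟩

theorem greedyDigitSumBelow_eq_of_lt (G : ℕ → ℕ) (hG : Monotone G) (l n : ℕ) (h : n < G l) :
    ∀ j, l ≤ j → greedyDigitSumBelow G j n = greedyDigitSumBelow G l n := by
  intro j hj
  induction j, hj using Nat.le_induction with
  | base => rfl
  | succ j hj ih =>
    have h1 : n < G j := lt_of_lt_of_le h (hG hj)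
    rw [greedyDigitSumBelow, Nat.div_eq_of_lt h1, Nat.mod_eq_of_lt h1, ih, zero_add]

/-- `sumOfDigits G n` is the sum of the digits of the greedy expansion of `n`. -/
theorem sumOfDigits_eq_of_isGreedyExpansion (G : ℕ → ℕ) (hG : StrictMono G) (h0 : G 0 = 1)
    (n l : ℕ) (e : ℕ → ℕ) (h : IsGreedyExpansion G n l e) :
    sumOfDigits G n = ∑ i ∈ Finset.range (l + 1), e i := by
  obtain ⟨h1, h2, h3⟩ := h
  have key : ∀ j m : ℕ, (∀ i < j, 0 ≤ (m : ℤ) - ∑ t ∈ Finset.Ico i j, (e t : ℤ) * G t ∧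
      (m : ℤ) - ∑ t ∈ Finset.Ico i j, (e t : ℤ) * G t < G i) →
      greedyDigitSumBelow G j m = ∑ i ∈ Finset.range j, e i := by
    intro j
    induction j with
    | zero => intro m _; simp [greedyDigitSumBelow]
    | succ j ih =>
      intro m hm
      have hj := hm j (Nat.lt_succ_self j)
      simp only [Nat.Ico_succ_singleton, Finset.sum_singleton] at hj
      have hle : e j * G j ≤ m := by
        have := hj.1
        zify
        linarith
      have hlt : m - e j * G j < G j := by
        have := hj.2
        zify [hle]
        linarith
      have hm' : m = (m - e j * G j) + e j * G j := by omega
      have hpos : 0 < G j := by omega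
      have hdiv : m / G j = e j := by
        rw [hm', Nat.add_mul_div_right _ _ hpos, Nat.div_eq_of_lt hlt, zero_add]
      have hmod : m % G j = m - e j * G j := by
        conv_lhs => rw [hm']
        rw [Nat.add_mul_mod_self_right, Nat.mod_eq_of_lt hlt]
      rw [greedyDigitSumBelow, hdiv, hmod, Finset.sum_range_succ, ih, add_comm]
      intro i hi
      have := hm i (Nat.lt_succ_of_lt hi)
      rw [Finset.sum_Ico_succ_top hi.le] at this
      push_cast [hle]
      constructor
      · linarith [this.1]
      · linarith [this.2]
  have hl : l + 1 ≤ n := by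
    have : ∀ j, j + 1 ≤ G j := by
      intro j
      induction j with
      | zero => omega
      | succ j ih => have := hG (Nat.lt_succ_self j); simp only [Nat.succ_eq_add_one] at this; omega
    exact (this l).trans h1
  rw [sumOfDigits, greedyDigitSumBelow_eq_of_lt G hG.monotone (l + 1) n h2 n hl]
  apply key
  intro i hi
  have := h3 i (Nat.lt_succ_iff.mp hi)
  have e1 : Finset.Ico i (l + 1) = Finset.Icc i l := by ext; simp
  rw [e1]
  exact this

theorem IsLinearRecurrenceBase.first_pos {G : ℕ → ℕ} {d : ℕ} {a : ℕ → ℕ}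
    (h : IsLinearRecurrenceBase G d a) : 0 < a 1 := by
  have hd := h.last_pos
  rcases h.one_le_d.eq_or_lt with h1 | h1
  · rwa [← h1] at hd
  · by_contra h0
    have h0 : a 1 = 0 := by omega
    have := h.lex d h1 le_rfl
    rw [← not_lt] at this
    apply this
    refine ⟨⟨0, by omega⟩, ?_, ?_⟩
    · intro j hj
      exact absurd hj (by simp)
    · simp [h0, hd]

theorem IsLinearRecurrenceBase.two_le_sum {G : ℕ → ℕ} {d : ℕ} {a : ℕ → ℕ}
    (h : IsLinearRecurrenceBase G d a) : 2 ≤ ∑ i ∈ Finset.Icc 1 d, a i := by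
  have hf := h.first_pos
  have hl := h.last_pos
  rcases h.one_le_d.eq_or_lt with h1 | h1
  · subst h1
    have h2 := h.recurrence 0
    have h3 := h.strictMono (show 0 < 1 by norm_num)
    have h4 := h.zero
    simp at h2
    simp
    rw [h2, h4] at h3
    omega
  · have : ∑ i ∈ ({1, d} : Finset ℕ), a i ≤ ∑ i ∈ Finset.Icc 1 d, a i := by
      apply Finset.sum_le_sum_of_subset
      intro i hi
      simp at hi ⊢
      omega
    rw [Finset.sum_pair (by omega)] at this
    omega

/-- Every linear recurrence base has a dominant root, and it exceeds `1`. -/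
theorem IsLinearRecurrenceBase.exists_isDominantRoot {G : ℕ → ℕ} {d : ℕ} {a : ℕ → ℕ}
    (h : IsLinearRecurrenceBase G d a) : ∃ α : ℝ, 1 < α ∧ IsDominantRoot d a α := by
  -- passing to reciprocals: the root equation is `∑ a_i w^i = 1` with `w = 1 / z`
  have rec_real : ∀ z : ℝ, z ≠ 0 → (Polynomial.aeval z (charPolynomial d a) = 0 ↔
      ∑ i ∈ Finset.Icc 1 d, (a i : ℝ) * z⁻¹ ^ i = 1) := by
    intro z hz
    have : Polynomial.aeval z (charPolynomial d a)
        = z ^ d * (1 - ∑ i ∈ Finset.Icc 1 d, (a i : ℝ) * z⁻¹ ^ i) := by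
      simp only [charPolynomial, map_sub, map_pow, Polynomial.aeval_X, map_sum, map_mul,
        Polynomial.aeval_C, mul_sub, mul_one, Finset.mul_sum]
      congr 1
      apply Finset.sum_congr rfl
      intro i hi
      rw [pow_sub₀ z hz (Finset.mem_Icc.mp hi).2]
      simp
      ring
    rw [this, mul_eq_zero, sub_eq_zero]
    simp [hz, eq_comm]
  have rec_complex : ∀ z : ℂ, z ≠ 0 → (Polynomial.aeval z (charPolynomial d a) = 0 ↔
      ∑ i ∈ Finset.Icc 1 d, (a i : ℂ) * z⁻¹ ^ i = 1) := by
    intro z hz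
    have : Polynomial.aeval z (charPolynomial d a)
        = z ^ d * (1 - ∑ i ∈ Finset.Icc 1 d, (a i : ℂ) * z⁻¹ ^ i) := by
      simp only [charPolynomial, map_sub, map_pow, Polynomial.aeval_X, map_sum, map_mul,
        Polynomial.aeval_C, mul_sub, mul_one, Finset.mul_sum]
      congr 1
      apply Finset.sum_congr rfl
      intro i hi
      rw [pow_sub₀ z hz (Finset.mem_Icc.mp hi).2]
      simp
      ring
    rw [this, mul_eq_zero, sub_eq_zero]
    simp [hz, eq_comm]
  have hf : (0 : ℝ) < a 1 := by exact_mod_cast h.first_pos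
  have h1d : 1 ∈ Finset.Icc 1 d := by simp [h.one_le_d]
  have hS : (2 : ℝ) ≤ ∑ i ∈ Finset.Icc 1 d, (a i : ℝ) := by exact_mod_cast h.two_le_sum
  -- the value of `w` at which the sum is `1`
  obtain ⟨w, hw, hw1⟩ : ∃ w ∈ Set.Icc (0 : ℝ) 1,
      ∑ i ∈ Finset.Icc 1 d, (a i : ℝ) * w ^ i = 1 := by
    have hc : ContinuousOn (fun w : ℝ => ∑ i ∈ Finset.Icc 1 d, (a i : ℝ) * w ^ i)
        (Set.Icc 0 1) := by fun_prop
    have h0 : ∑ i ∈ Finset.Icc 1 d, (a i : ℝ) * (0 : ℝ) ^ i = 0 := by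
      apply Finset.sum_eq_zero
      intro i hi
      have := (Finset.mem_Icc.mp hi).1
      rw [zero_pow (by omega), mul_zero]
    apply intermediate_value_Icc zero_le_one hc
    simp only [h0, one_pow, mul_one]
    exact ⟨by norm_num, by linarith⟩
  have hw0 : 0 < w := by
    rcases hw.1.eq_or_lt with h0 | h0
    · exfalso
      rw [← h0, Finset.sum_eq_zero] at hw1
      · norm_num at hw1
      · intro i hi
        have := (Finset.mem_Icc.mp hi).1
        rw [zero_pow (by omega), mul_zero]
    · exact h0
  have hwlt : w < 1 := by
    rcases hw.2.eq_or_lt with h0 | h0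
    · rw [h0] at hw1
      simp only [one_pow, mul_one] at hw1
      linarith
    · exact h0
  refine ⟨w⁻¹, (one_lt_inv₀ hw0).mpr hwlt, ?_, ?_⟩
  · rw [rec_real _ (inv_ne_zero hw0.ne'), inv_inv]
    exact hw1
  · intro z hz hne
    by_cases hz0 : z = 0
    · rw [hz0, norm_zero]
      positivity
    rw [rec_complex z hz0] at hz
    set v := z⁻¹ with hv
    have hvn : ‖v‖ = ‖z‖⁻¹ := by rw [hv, norm_inv]
    have hzpos : 0 < ‖z‖ := norm_pos_iff.mpr hz0
    by_contra hge
    push Not at hge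
    have hvw : ‖v‖ ≤ w := by
      rw [hvn]
      exact inv_le_of_inv_le₀ hw0 hge
    have hterm : ∀ i ∈ Finset.Icc 1 d, 0 ≤ (a i : ℝ) * (w ^ i - (v ^ i).re) := by
      intro i _
      apply mul_nonneg (Nat.cast_nonneg _)
      have h1 : (v ^ i).re ≤ ‖v ^ i‖ := Complex.re_le_norm _
      rw [norm_pow] at h1
      have h2 : ‖v‖ ^ i ≤ w ^ i := pow_le_pow_left₀ (norm_nonneg _) hvw i
      linarith
    have hsum : ∑ i ∈ Finset.Icc 1 d, (a i : ℝ) * (w ^ i - (v ^ i).re) = 0 := by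
      have h2 := congrArg Complex.re hz
      rw [Complex.re_sum] at h2
      simp only [Complex.one_re, ← Complex.ofReal_natCast, Complex.re_ofReal_mul] at h2
      simp only [mul_sub, Finset.sum_sub_distrib]
      rw [hw1, h2, sub_self]
    have h3 := (Finset.sum_eq_zero_iff_of_nonneg hterm).mp hsum 1 h1d
    have h4 : v.re = w := by
      rcases mul_eq_zero.mp h3 with h5 | h5
      · linarith
      · simp only [pow_one] at h5
        linarith
    have h5 : v = (w : ℂ) := by
      have h6 : v.re ^ 2 + v.im ^ 2 = ‖v‖ ^ 2 := by
        rw [Complex.sq_norm, Complex.normSq_apply]; ring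
      have h7 : ‖v‖ ^ 2 ≤ w ^ 2 := pow_le_pow_left₀ (norm_nonneg _) hvw 2
      have h8 : v.im ^ 2 ≤ 0 := by rw [h4] at h6; linarith
      apply Complex.ext
      · simpa using h4
      · simpa using pow_eq_zero_iff (two_ne_zero) |>.mp (le_antisymm h8 (sq_nonneg _))
    apply hne
    rw [Complex.ofReal_inv, ← h5, hv, inv_inv]

theorem IsDominantRoot.unique {d : ℕ} {a : ℕ → ℕ} {α β : ℝ}
    (hα : IsDominantRoot d a α) (hβ : IsDominantRoot d a β) : α = β := by
  have toC : ∀ t : ℝ, Polynomial.aeval t (charPolynomial d a) = 0 →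
      Polynomial.aeval (t : ℂ) (charPolynomial d a) = 0 := by
    intro t ht
    have := Polynomial.aeval_algebraMap_apply ℂ t (charPolynomial d a)
    rw [ht, map_zero] at this
    exact this
  by_contra hne
  have h1 := hα.2 β (toC β hβ.1) (by exact_mod_cast Ne.symm hne)
  have h2 := hβ.2 α (toC α hα.1) (by exact_mod_cast hne)
  rw [Complex.norm_real, Real.norm_eq_abs] at h1 h2
  linarith [le_abs_self α, le_abs_self β]

theorem IsLinearRecurrenceBase.isDominantRoot_dominantRoot {G : ℕ → ℕ} {d : ℕ} {a : ℕ → ℕ}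
    (h : IsLinearRecurrenceBase G d a) :
    1 < dominantRoot d a ∧ IsDominantRoot d a (dominantRoot d a) := by
  obtain ⟨α, h1, hα⟩ := h.exists_isDominantRoot
  have hex : ∃ α : ℝ, IsDominantRoot d a α := ⟨α, hα⟩
  have hd : IsDominantRoot d a (dominantRoot d a) := by
    rw [dominantRoot, dif_pos hex]
    exact hex.choose_spec
  exact ⟨hd.unique hα ▸ h1, hd⟩

/-! Orthogonality of characters modulo s and q reduces (i) to the sums ∑_{k<z} e(θ s_G(k) + β k)
with θ = l/s and β = t/q (`discrepancy_le`), and the greedy expansion of z reduces these to T_n(β),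
the sum over k < G_n. Cutting [0, G_n) along the digits a_1, …, a_d of G_n yields
`expSum_recurrence`: T_n = ∑_j c_j T_{n-j}, where |c_j| is the modulus of a geometric sum of a_j
terms at the phase θ + β G_{n-j}. The lexicographic condition ensures that each piece is an
admissible interval. Two estimates follow from this recurrence.

Pointwise in β (`exists_power_saving`): replacing c_j by a_j gives the recurrence solved by α^n, so
a trivial bound T_n ≪ α^n propagates. The relation (a_1 + ⋯ + a_d - 1)θ = ∑ a_i (θ + β G_{n-i}) - (θ
+ β G_n) shows that the phases cannot all be close to integers when the left side is not an integer,
which is what the gcd condition says for θ = l/s, 0 < l < s. One bad phase in each run of d + 1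
levels costs a fixed proportion, uniformly in β, hence a power saving η.

On average over β (`SpacedBound`): over 1/D-separated points, D ≥ G_n, the sum of |T_n| is O(D
G_n^κ). The large sieve gives κ = 1/2. For a_1 ≥ 30 the recurrence gives κ = log_α(m_G + 3): the
factor |c_j| depends on β modulo 1/G_{n-j}, while |T_{n-j}| is controlled on perturbed lattices of
that mesh, so the two decouple (`jitter_decouple`) and the mean of |c_j| is at most about m_G + 2.
When log_α(m_G + 3) < 1/2, automatically a_1 ≥ 30, so κ = 1 - ϑ is always available.

Reduced fractions with denominators in [Q, 2Q) are 1/(4Q²)-separated. Up to the level with G_n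
comparable to Q² the average bound applies directly; above it, the pointwise saving is applied
relative to that level (`exists_block_bound`). For Q ≤ x^(ϑ-ε) this saves a power of x
(`block_arith`), and only three logarithms are lost in summing over common factors, dyadic ranges
and levels.

For (ii), comparison with harmonic sums gives m_G ≤ 2(1 + log a_1), while α ≥ a_1, so log_α(m_G + 3)
tends to 0 at a rate depending on a_1 only. -/

/-! ### Additive characters and geometric sums -/

/-- The additive character `x ↦ exp (2 π i x)`. -/
noncomputable def unitExp (x : ℝ) : ℂ := Complex.exp (((2 * Real.pi * x : ℝ) : ℂ) * Complex.I)

theorem norm_unitExp (x : ℝ) : ‖unitExp x‖ = 1 := Complex.norm_exp_ofReal_mul_I _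

theorem unitExp_add (x y : ℝ) : unitExp (x + y) = unitExp x * unitExp y := by
  rw [unitExp, unitExp, unitExp, ← Complex.exp_add]
  congr 1
  push_cast
  ring

@[simp] theorem unitExp_zero : unitExp 0 = 1 := by simp [unitExp]

theorem unitExp_intCast (n : ℤ) : unitExp n = 1 := by
  rw [unitExp, Complex.exp_eq_one_iff]
  exact ⟨n, by push_cast; ring⟩

theorem unitExp_neg (x : ℝ) : unitExp (-x) = (starRingEnd ℂ) (unitExp x) := by
  rw [unitExp, unitExp, ← Complex.exp_conj]
  congr 1
  rw [map_mul, Complex.conj_ofReal, Complex.conj_I]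
  push_cast
  ring

theorem unitExp_nat_mul (n : ℕ) (x : ℝ) : unitExp (n * x) = unitExp x ^ n := by
  rw [unitExp, unitExp, ← Complex.exp_nat_mul]
  congr 1
  push_cast
  ring

theorem norm_unitExp_sub_one (x : ℝ) : ‖unitExp x - 1‖ = 2 * |Real.sin (Real.pi * x)| := by
  rw [unitExp, mul_comm _ Complex.I, Complex.norm_exp_I_mul_ofReal_sub_one, norm_mul,
    Real.norm_eq_abs, Real.norm_eq_abs]
  congr 1
  · norm_num
  · congr 2
    ring

theorem norm_unitExp_sub_one_le (x : ℝ) : ‖unitExp x - 1‖ ≤ 2 * Real.pi * |x| := by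
  rw [unitExp, mul_comm _ Complex.I]
  refine Real.norm_exp_I_mul_ofReal_sub_one_le.trans ?_
  rw [norm_mul, Real.norm_eq_abs, Real.norm_eq_abs, abs_of_pos (by positivity)]

theorem unitExp_eq_one_iff (x : ℝ) : unitExp x = 1 ↔ ∃ n : ℤ, x = n := by
  constructor
  · intro h
    rw [unitExp, Complex.exp_eq_one_iff] at h
    obtain ⟨n, hn⟩ := h
    refine ⟨n, ?_⟩
    have h2 : (2 * Real.pi * Complex.I : ℂ) ≠ 0 := Complex.two_pi_I_ne_zero
    have h3 : (2 * Real.pi * Complex.I : ℂ) * x = (2 * Real.pi * Complex.I : ℂ) * n := by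
      rw [mul_comm _ (n : ℂ), ← hn]
      push_cast
      ring
    exact_mod_cast mul_left_cancel₀ h2 h3
  · rintro ⟨n, rfl⟩
    exact unitExp_intCast n

/-- If `n / q` is not an integer, the points `n t / q` have vanishing exponential sum. -/
theorem sum_unitExp_mul_div (q : ℕ) (hq : 0 < q) (n : ℤ) :
    ∑ t ∈ Finset.range q, unitExp (t * (n / q)) = if (q : ℤ) ∣ n then (q : ℂ) else 0 := by
  have hq' : (q : ℝ) ≠ 0 := by positivity
  simp only [unitExp_nat_mul]
  split_ifs with h
  · obtain ⟨m, rfl⟩ := h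
    have : unitExp (((q * m : ℤ) : ℝ) / q) = 1 := by
      rw [unitExp_eq_one_iff]
      exact ⟨m, by push_cast; field_simp⟩
    rw [this]
    simp
  · have h1 : unitExp ((n : ℝ) / q) ≠ 1 := by
      rw [Ne, unitExp_eq_one_iff]
      rintro ⟨m, hm⟩
      apply h
      refine ⟨m, ?_⟩
      rw [div_eq_iff hq'] at hm
      have : (n : ℝ) = ((q * m : ℤ) : ℝ) := by push_cast; linarith
      exact_mod_cast this
    rw [geom_sum_eq h1, ← unitExp_nat_mul, mul_div_cancel₀ _ hq', unitExp_intCast]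
    simp

/-- `1 + e(y) + ⋯ + e((b - 1) y)`. -/
noncomputable def geomExp (b : ℕ) (y : ℝ) : ℂ := ∑ i ∈ Finset.range b, unitExp (i * y)

@[simp] theorem geomExp_zero (y : ℝ) : geomExp 0 y = 0 := by simp [geomExp]

theorem geomExp_one (y : ℝ) : geomExp 1 y = 1 := by simp [geomExp]

theorem geomExp_succ (b : ℕ) (y : ℝ) : geomExp (b + 1) y = geomExp b y + unitExp (b * y) := by
  simp [geomExp, Finset.sum_range_succ]

theorem norm_geomExp_le (b : ℕ) (y : ℝ) : ‖geomExp b y‖ ≤ b := by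
  refine (norm_sum_le _ _).trans ?_
  simp [norm_unitExp]

theorem norm_geomExp_mul_abs_sin (b : ℕ) (y : ℝ) :
    ‖geomExp b y‖ * |Real.sin (Real.pi * y)| = |Real.sin (Real.pi * b * y)| := by
  have h : geomExp b y * (unitExp y - 1) = unitExp (b * y) - 1 := by
    simp only [geomExp, unitExp_nat_mul]
    exact geom_sum_mul _ _
  have h2 := congrArg norm h
  rw [norm_mul, norm_unitExp_sub_one, norm_unitExp_sub_one, ← mul_assoc Real.pi] at h2
  linarith

theorem norm_geomExp_eq_div (b : ℕ) (y : ℝ) (h : Real.sin (Real.pi * y) ≠ 0) :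
    ‖geomExp b y‖ = |Real.sin (Real.pi * b * y) / Real.sin (Real.pi * y)| := by
  rw [abs_div, eq_div_iff (abs_ne_zero.mpr h), norm_geomExp_mul_abs_sin]

theorem norm_geomExp_le_inv_abs_sin (b : ℕ) (y : ℝ) (h : Real.sin (Real.pi * y) ≠ 0) :
    ‖geomExp b y‖ ≤ 1 / |Real.sin (Real.pi * y)| := by
  rw [norm_geomExp_eq_div b y h, abs_div]
  gcongr
  exact Real.abs_sin_le_one _

/-- If `y` has distance at least `u` from the integer `p`, and at most `1 - u`. -/
theorem norm_geomExp_le_of_dist (b : ℕ) (y : ℝ) (p : ℤ) (u : ℝ) (hu : 0 < u)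
    (h1 : u ≤ |y - p|) (h2 : |y - p| ≤ 1 - u) :
    ‖geomExp b y‖ ≤ 1 / Real.sin (Real.pi * u) := by
  have hπ := Real.pi_pos
  have habs : |Real.sin (Real.pi * y)| = Real.sin (Real.pi * |y - p|) := by
    have h3 : Real.pi * y = Real.pi * (y - p) + p * Real.pi := by ring
    rw [h3, Real.sin_add_int_mul_pi, abs_mul]
    have h4 : |((-1 : ℝ)) ^ p| = 1 := by rw [abs_zpow]; simp
    rw [h4, one_mul]
    rcases abs_cases (y - p) with ⟨h, _⟩ | ⟨h, _⟩
    · rw [h, abs_of_nonneg]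
      apply Real.sin_nonneg_of_nonneg_of_le_pi
      · rw [h] at h1; positivity
      · rw [h] at h2; nlinarith
    · rw [h, mul_neg, Real.sin_neg, abs_of_nonpos]
      have : 0 ≤ Real.sin (Real.pi * (-(y - p))) := by
        apply Real.sin_nonneg_of_nonneg_of_le_pi
        · rw [h] at h1; apply mul_nonneg hπ.le; linarith
        · rw [h] at h2; nlinarith
      rw [mul_neg, Real.sin_neg] at this
      linarith
  have hup : 0 < Real.sin (Real.pi * u) := by
    apply Real.sin_pos_of_pos_of_lt_pi
    · positivity
    · nlinarith
  have hmain : Real.sin (Real.pi * u) ≤ Real.sin (Real.pi * |y - p|) := by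
    rcases le_total |y - p| (1 / 2) with h | h
    · apply Real.sin_le_sin_of_le_of_le_pi_div_two <;> nlinarith
    · rw [← Real.sin_pi_sub (Real.pi * |y - p|)]
      apply Real.sin_le_sin_of_le_of_le_pi_div_two <;> nlinarith
  have hne : Real.sin (Real.pi * y) ≠ 0 := by
    rw [← abs_pos, habs]; linarith
  refine (norm_geomExp_le_inv_abs_sin b y hne).trans ?_
  rw [habs]
  gcongr


/-! ### Digit sums, exponential sums and their linear recurrence -/

/-- `∑_{k < z} e(θ s_G(k) + β k)`. -/
noncomputable def expSum (G : ℕ → ℕ) (θ β : ℝ) (z : ℕ) : ℂ :=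
  ∑ k ∈ Finset.range z, unitExp (θ * sumOfDigits G k + β * k)

theorem norm_expSum_le (G : ℕ → ℕ) (θ β : ℝ) (z : ℕ) : ‖expSum G θ β z‖ ≤ z := by
  refine (norm_sum_le _ _).trans ?_
  simp [norm_unitExp]

theorem succ_le_of_strictMono {G : ℕ → ℕ} (hG : StrictMono G) (h0 : G 0 = 1) (n : ℕ) :
    n + 1 ≤ G n := by
  induction n with
  | zero => omega
  | succ n ih => have := hG (Nat.lt_succ_self n); simp only [Nat.succ_eq_add_one] at this; omega

theorem sumOfDigits_eq_below {G : ℕ → ℕ} (hG : StrictMono G) (h0 : G 0 = 1) {n k : ℕ}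
    (hk : k < G n) : sumOfDigits G k = greedyDigitSumBelow G n k := by
  rw [sumOfDigits]
  have hself : k < G k := by have := succ_le_of_strictMono hG h0 k; omega
  rcases le_total n k with h | h
  · exact greedyDigitSumBelow_eq_of_lt G hG.monotone n k hk k h
  · exact (greedyDigitSumBelow_eq_of_lt G hG.monotone k k hself n h).symm

/-- The bound by `G (n + 1)` excludes digits above position n, and m < G_n makes b the greedy
quotient there and m the remainder. -/
theorem sumOfDigits_add {G : ℕ → ℕ} (hG : StrictMono G) (h0 : G 0 = 1) {n b m : ℕ}
    (hm : m < G n) (hk : b * G n + m < G (n + 1)) :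
    sumOfDigits G (b * G n + m) = b + sumOfDigits G m := by
  have hpos : 0 < G n := by omega
  rw [sumOfDigits_eq_below hG h0 hk, sumOfDigits_eq_below hG h0 hm, greedyDigitSumBelow,
    add_comm (b * G n) m, Nat.add_mul_div_right _ _ hpos, Nat.div_eq_of_lt hm, zero_add,
    Nat.add_mul_mod_self_right, Nat.mod_eq_of_lt hm]

/-- The leading digit of an interval `[0, b G_n + r)` splits its exponential sum. -/
theorem expSum_add {G : ℕ → ℕ} (hG : StrictMono G) (h0 : G 0 = 1) (θ β : ℝ) {n b r : ℕ}
    (hr : r ≤ G n) (hk : b * G n + r ≤ G (n + 1)) :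
    expSum G θ β (b * G n + r) = geomExp b (θ + β * G n) * expSum G θ β (G n)
      + unitExp (b * (θ + β * G n)) * expSum G θ β r := by
  have hblock : ∀ b r : ℕ, r ≤ G n → b * G n + r ≤ G (n + 1) →
      ∑ m ∈ Finset.range r, unitExp (θ * sumOfDigits G (b * G n + m) + β * (b * G n + m : ℕ))
        = unitExp (b * (θ + β * G n)) * expSum G θ β r := by
    intro b r hr hk
    rw [expSum, Finset.mul_sum]
    apply Finset.sum_congr rfl
    intro m hm
    have hm' := Finset.mem_range.mp hm
    rw [sumOfDigits_add hG h0 (by omega) (by omega), ← unitExp_add]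
    congr 1
    push_cast
    ring
  have hfull : ∀ b : ℕ, b * G n ≤ G (n + 1) →
      expSum G θ β (b * G n) = geomExp b (θ + β * G n) * expSum G θ β (G n) := by
    intro b
    induction b with
    | zero => intro _; simp [expSum]
    | succ b ih =>
      intro hb
      have hb' : b * G n + G n ≤ G (n + 1) := by rw [← Nat.succ_mul]; exact hb
      rw [Nat.succ_mul, expSum, Finset.sum_range_add, hblock b (G n) le_rfl hb', ← expSum,
        ih (by omega), geomExp_succ]
      ring
  conv_lhs => rw [expSum, Finset.sum_range_add]
  rw [hblock b r hr hk, ← expSum, hfull b (by omega)]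

namespace IsLinearRecurrenceBase

variable {G : ℕ → ℕ} {d : ℕ} {a : ℕ → ℕ}

theorem pos (h : IsLinearRecurrenceBase G d a) (n : ℕ) : 0 < G n := by
  have := succ_le_of_strictMono h.strictMono h.zero n
  omega

theorem partial_sum_le (h : IsLinearRecurrenceBase G d a) {l m : ℕ} (hl : l ≤ d) (hlm : l ≤ m) :
    ∑ i ∈ Finset.Icc 1 l, a i * G (m - i) ≤ G m := by
  rcases le_or_gt d m with hm | hm
  · have := h.recurrence (m - d)
    rw [Nat.sub_add_cancel hm] at this
    rw [this]
    exact Finset.sum_le_sum_of_subset (Finset.Icc_subset_Icc_right hl)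
  · rcases Nat.eq_zero_or_pos m with h0 | h0
    · have : l = 0 := by omega
      simp [this]
    · refine le_trans ?_ (h.initial m h0 hm).le
      exact Finset.sum_le_sum_of_subset (Finset.Icc_subset_Icc_right hlm)

theorem recurrence' (h : IsLinearRecurrenceBase G d a) {n : ℕ} (hn : d ≤ n) :
    G n = ∑ i ∈ Finset.Icc 1 d, a i * G (n - i) := by
  have := h.recurrence (n - d)
  rwa [Nat.sub_add_cancel hn] at this

/-- The value of the final segment `a_k, …, a_d` of the digits of `G n`. -/
def tail (G : ℕ → ℕ) (d : ℕ) (a : ℕ → ℕ) (n k : ℕ) : ℕ :=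
  ∑ i ∈ Finset.Icc k d, a i * G (n - i)

theorem tail_eq_add (G : ℕ → ℕ) (a : ℕ → ℕ) {n d k : ℕ} (hk : k ≤ d) :
    tail G d a n k = a k * G (n - k) + tail G d a n (k + 1) := by
  rw [tail, tail, ← Finset.add_sum_Ioc_eq_sum_Icc hk,
    Finset.Icc_add_one_left_eq_Ioc]

theorem tail_eq_sum_add (G : ℕ → ℕ) (a : ℕ → ℕ) {n d k i : ℕ} (hk : k + i ≤ d + 1) :
    tail G d a n k =
      ∑ t ∈ Finset.range i, a (k + t) * G (n - (k + t)) + tail G d a n (k + i) := by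
  induction i with
  | zero => simp
  | succ i ih =>
    rw [ih (by omega), tail_eq_add G a (show k + i ≤ d by omega), Finset.sum_range_succ]
    ring_nf

/-- This is where the lexicographic condition enters. At the first place where (a_k, …, a_d) falls
below (a_1, a_2, …) one unit of G_{n-(k+i)} is spare, and by induction on the number of remaining
digits it pays for everything after that place. What results is a partial sum ∑ a_i G_{m-i} with m =
n + 1 - k, hence at most G_m. If the two strings agree, the tail is such a partial sum already. -/
theorem tail_le (h : IsLinearRecurrenceBase G d a) {n : ℕ} (hn : d ≤ n) {k : ℕ} (hk : 1 < k) :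
    tail G d a n k ≤ G (n + 1 - k) := by
  have hpart : ∀ k l : ℕ, 1 < k → k + l ≤ d + 1 →
      ∑ t ∈ Finset.range l, a (1 + t) * G (n - (k + t)) ≤ G (n + 1 - k) := by
    intro k l hk hl
    refine le_trans (le_of_eq ?_) (h.partial_sum_le (l := l) (m := n + 1 - k) (by omega) (by omega))
    rw [← Finset.Ico_add_one_right_eq_Icc, Finset.sum_Ico_eq_sum_range]
    apply Finset.sum_congr (by simp)
    intro t _
    congr 2
    omega
  obtain ⟨c, hc⟩ : ∃ c, d + 1 - k = c := ⟨_, rfl⟩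
  induction c using Nat.strong_induction_on generalizing k with
  | _ c ih =>
    rcases lt_or_ge d k with hd | hd
    · rw [tail, Finset.Icc_eq_empty (by omega)]
      simp
    · rcases (h.lex k hk hd).eq_or_lt with h3 | h3
      · have heq : ∀ t < d - k + 1, a (k + t) = a (1 + t) := by
          intro t ht
          exact congrFun (toLex.injective h3) ⟨t, ht⟩
        rw [tail_eq_sum_add G a (show k + (d - k + 1) ≤ d + 1 by omega)]
        have h0 : tail G d a n (k + (d - k + 1)) = 0 := by
          rw [tail, Finset.Icc_eq_empty (by omega)]
          simp
        rw [h0, add_zero]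
        refine le_trans (le_of_eq ?_) (hpart k (d - k + 1) hk (by omega))
        apply Finset.sum_congr rfl
        intro t ht
        rw [heq t (Finset.mem_range.mp ht)]
      · obtain ⟨⟨i, hi⟩, hpre, hlt⟩ := h3
        have heq : ∀ t < i, a (k + t) = a (1 + t) := by
          intro t ht
          exact hpre ⟨t, by omega⟩ ht
        have hlt' : a (k + i) < a (1 + i) := hlt
        have hnext := ih (d + 1 - (k + i + 1)) (by omega) (k := k + i + 1) (by omega) rfl
        rw [show n + 1 - (k + i + 1) = n - (k + i) by omega] at hnext
        rw [tail_eq_sum_add G a (show k + i ≤ d + 1 by omega), tail_eq_add G a (by omega)]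
        have hp := hpart k (i + 1) hk (by omega)
        rw [Finset.sum_range_succ] at hp
        have hs : ∑ t ∈ Finset.range i, a (k + t) * G (n - (k + t)) =
            ∑ t ∈ Finset.range i, a (1 + t) * G (n - (k + t)) := by
          apply Finset.sum_congr rfl
          intro t ht
          rw [heq t (Finset.mem_range.mp ht)]
        rw [hs]
        have hm : (a (k + i) + 1) * G (n - (k + i)) ≤ a (1 + i) * G (n - (k + i)) :=
          Nat.mul_le_mul_right _ hlt'
        rw [add_mul, one_mul] at hm
        omega

/-- The bounds of `tail_le` for k and k + 1 are exactly what `expSum_add` needs to split off the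
leading digit a_k; for k = 1 the tail is G_n itself. -/
theorem expSum_tail (h : IsLinearRecurrenceBase G d a) (θ β : ℝ) {n : ℕ} (hn : d ≤ n) {k : ℕ}
    (hk : 1 ≤ k) (hkd : k ≤ d) :
    expSum G θ β (tail G d a n k) =
      geomExp (a k) (θ + β * G (n - k)) * expSum G θ β (G (n - k)) +
      unitExp (a k * (θ + β * G (n - k))) * expSum G θ β (tail G d a n (k + 1)) := by
  have e1 : n + 1 - k = (n - k) + 1 := by omega
  have h1 : tail G d a n k ≤ G (n - k + 1) := by
    rcases hk.eq_or_lt with h2 | h2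
    · subst h2
      rw [tail, ← h.recurrence' hn, Nat.sub_add_cancel (by omega)]
    · have := h.tail_le hn h2
      rwa [e1] at this
  have h2 : tail G d a n (k + 1) ≤ G (n - k) := by
    have := h.tail_le hn (show 1 < k + 1 by omega)
    rwa [show n + 1 - (k + 1) = n - k by omega] at this
  rw [tail_eq_add G a hkd] at h1 ⊢
  exact expSum_add h.strictMono h.zero θ β h2 h1

theorem coeff_le (h : IsLinearRecurrenceBase G d a) {k : ℕ} (hk : 1 ≤ k) (hkd : k ≤ d) :
    a k ≤ a 1 := by
  rcases hk.eq_or_lt with h2 | h2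
  · rw [h2]
  · have h1 := h.lex k h2 hkd
    rcases h1.eq_or_lt with h3 | h3
    · have := congrFun (toLex.injective h3) ⟨0, by omega⟩
      simp at this
      omega
    · obtain ⟨i, hi, hlt⟩ := h3
      rcases Nat.eq_zero_or_pos i.1 with h4 | h4
      · have e : i = ⟨0, by omega⟩ := Fin.ext h4
        rw [e] at hlt
        simp at hlt
        omega
      · have := hi ⟨0, by omega⟩ (show (0 : ℕ) < i.1 from h4)
        simp at this
        omega

/-- The coefficient of `T_{n-j}` in the expansion of `T_n`. -/
noncomputable def coef (G : ℕ → ℕ) (a : ℕ → ℕ) (θ β : ℝ) (n j : ℕ) : ℂ :=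
  unitExp (∑ i ∈ Finset.Ico 1 j, a i * (θ + β * G (n - i))) * geomExp (a j) (θ + β * G (n - j))

theorem expSum_recurrence (h : IsLinearRecurrenceBase G d a) (θ β : ℝ) {n : ℕ} (hn : d ≤ n) :
    expSum G θ β (G n) =
      ∑ j ∈ Finset.Icc 1 d, coef G a θ β n j * expSum G θ β (G (n - j)) := by
  have key : ∀ k, k ≤ d → expSum G θ β (G n) =
      ∑ j ∈ Finset.Icc 1 k, coef G a θ β n j * expSum G θ β (G (n - j)) +
      unitExp (∑ i ∈ Finset.Ico 1 (k + 1), a i * (θ + β * G (n - i))) *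
        expSum G θ β (tail G d a n (k + 1)) := by
    intro k
    induction k with
    | zero =>
      intro _
      simp only [zero_add, Finset.Ico_self, Finset.sum_empty, unitExp_zero, one_mul,
        Finset.Icc_eq_empty (show ¬ (1 ≤ 0) by omega)]
      rw [tail, ← h.recurrence' hn]
    | succ k ih =>
      intro hk
      rw [ih (by omega), h.expSum_tail θ β hn (by omega) hk, Finset.sum_Icc_succ_top (by omega),
        Finset.sum_Ico_succ_top (show 1 ≤ k + 1 by omega), unitExp_add, coef]
      ring
  rw [key d le_rfl]
  have h0 : tail G d a n (d + 1) = 0 := by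
    rw [tail, Finset.Icc_eq_empty (by omega)]
    simp
  rw [h0]
  simp [expSum]

theorem norm_coef (G : ℕ → ℕ) (a : ℕ → ℕ) (θ β : ℝ) (n j : ℕ) :
    ‖coef G a θ β n j‖ = ‖geomExp (a j) (θ + β * G (n - j))‖ := by
  rw [coef, norm_mul, norm_unitExp, one_mul]

theorem norm_coef_le (G : ℕ → ℕ) (a : ℕ → ℕ) (θ β : ℝ) (n j : ℕ) :
    ‖coef G a θ β n j‖ ≤ a j := by
  rw [norm_coef]
  exact norm_geomExp_le _ _

theorem succ_le_mul (h : IsLinearRecurrenceBase G d a) {n : ℕ} (hn : d ≤ n) :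
    G n ≤ (a 1 + 1) * G (n - 1) := by
  have h1 : G n = tail G d a n 1 := h.recurrence' hn
  rw [h1, tail_eq_add G a h.one_le_d]
  have := h.tail_le hn (show 1 < 1 + 1 by omega)
  rw [show n + 1 - (1 + 1) = n - 1 by omega] at this
  rw [add_mul, one_mul]
  omega

theorem mul_le_succ (h : IsLinearRecurrenceBase G d a) {n : ℕ} (hn : 1 ≤ n) :
    a 1 * G (n - 1) ≤ G n := by
  simpa using h.partial_sum_le (l := 1) (m := n) h.one_le_d hn

theorem exists_ratio (h : IsLinearRecurrenceBase G d a) :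
    ∃ R : ℕ, 1 ≤ R ∧ ∀ n, G (n + 1) ≤ R * G n := by
  -- The term a_1 + 1 serves all levels with n + 1 ≥ d; the finite sum covers the initial ones.
  refine ⟨a 1 + 1 + ∑ i ∈ Finset.range d, G (i + 1), by omega, fun n => ?_⟩
  rcases le_or_gt d (n + 1) with hn | hn
  · refine (h.succ_le_mul hn).trans ?_
    rw [Nat.add_sub_cancel]
    exact Nat.mul_le_mul_right _ (by omega)
  · have h1 : G (n + 1) ≤ ∑ i ∈ Finset.range d, G (i + 1) :=
      Finset.single_le_sum (f := fun i => G (i + 1)) (fun _ _ => Nat.zero_le _)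
        (Finset.mem_range.mpr (by omega))
    calc G (n + 1) ≤ (a 1 + 1 + ∑ i ∈ Finset.range d, G (i + 1)) * 1 := by omega
      _ ≤ _ := Nat.mul_le_mul_left _ (h.pos n)

/-- Every exponential sum is controlled by those over `[0, G_i)`. -/
theorem exists_norm_expSum_le_sum (h : IsLinearRecurrenceBase G d a) :
    ∃ R : ℕ, ∀ (θ β : ℝ) (l z : ℕ), z < G l →
      ‖expSum G θ β z‖ ≤ R * ∑ i ∈ Finset.range l, ‖expSum G θ β (G i)‖ := by
  obtain ⟨R, -, hR⟩ := h.exists_ratio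
  refine ⟨R, fun θ β l => ?_⟩
  induction l with
  | zero =>
    intro z hz
    rw [h.zero] at hz
    have : z = 0 := by omega
    simp [this, expSum]
  | succ n ih =>
    intro z hz
    have hpos := h.pos n
    have hz' : z / G n * G n + z % G n = z := Nat.div_add_mod' z (G n)
    have hmod : z % G n < G n := Nat.mod_lt _ hpos
    have hb : z / G n ≤ R := by
      apply Nat.div_le_of_le_mul
      rw [mul_comm]
      exact hz.le.trans (hR n)
    have key := expSum_add h.strictMono h.zero θ β (n := n) (b := z / G n) (r := z % G n)
      hmod.le (by omega)
    rw [hz'] at key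
    rw [key, Finset.sum_range_succ]
    refine (norm_add_le _ _).trans ?_
    rw [norm_mul, norm_mul, norm_unitExp, one_mul, add_comm, mul_add]
    refine add_le_add (ih _ hmod) ?_
    gcongr
    exact (norm_geomExp_le _ _).trans (by exact_mod_cast hb)

/-! ### Growth of the base and size of the dominant root -/

/-- The root equation of the dominant root. -/
theorem sum_inv_pow (h : IsLinearRecurrenceBase G d a) (n : ℕ) (hn : d ≤ n) :
    ∑ i ∈ Finset.Icc 1 d, (a i : ℝ) * dominantRoot d a ^ (n - i) = dominantRoot d a ^ n := by
  have h1 := h.isDominantRoot_dominantRoot.2.1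
  simp only [charPolynomial, map_sub, map_pow, Polynomial.aeval_X, map_sum, map_mul,
    Polynomial.aeval_C] at h1
  have h2 : dominantRoot d a ^ n = dominantRoot d a ^ (n - d) * dominantRoot d a ^ d := by
    rw [← pow_add]; congr 1; omega
  rw [h2, sub_eq_zero.mp h1, Finset.mul_sum]
  apply Finset.sum_congr rfl
  intro i hi
  have := (Finset.mem_Icc.mp hi).2
  rw [show n - i = (n - d) + (d - i) by omega, pow_add]
  simp
  ring

/-- G_n and α^n satisfy the same recurrence with nonnegative coefficients, so inequalities between
them propagate from n < d, where α^(-d) and G_d are suitable constants. -/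
theorem exists_growth (h : IsLinearRecurrenceBase G d a) :
    ∃ c C : ℝ, 0 < c ∧ 0 < C ∧ ∀ n, c * dominantRoot d a ^ n ≤ G n ∧
      (G n : ℝ) ≤ C * dominantRoot d a ^ n := by
  have hα := h.isDominantRoot_dominantRoot.1
  have hα0 : 0 < dominantRoot d a := by linarith
  set α := dominantRoot d a
  have hG0 : ∀ n, (1 : ℝ) ≤ G n := fun n => by exact_mod_cast h.pos n
  refine ⟨(α ^ d)⁻¹, G d, by positivity, by linarith [hG0 d], fun n => ?_⟩
  induction n using Nat.strong_induction_on with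
  | _ n ih =>
    rcases le_or_gt d n with hn | hn
    · have hrec : (G n : ℝ) = ∑ i ∈ Finset.Icc 1 d, (a i : ℝ) * G (n - i) := by
        exact_mod_cast h.recurrence' hn
      rw [hrec, ← h.sum_inv_pow n hn, Finset.mul_sum, Finset.mul_sum]
      constructor <;> apply Finset.sum_le_sum <;> intro i hi <;>
        have hi' := Finset.mem_Icc.mp hi
      · rw [mul_left_comm]
        exact mul_le_mul_of_nonneg_left (ih (n - i) (by omega)).1 (Nat.cast_nonneg _)
      · rw [mul_left_comm]
        exact mul_le_mul_of_nonneg_left (ih (n - i) (by omega)).2 (Nat.cast_nonneg _)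
    · constructor
      · refine le_trans ?_ (hG0 n)
        rw [inv_mul_le_one₀ (by positivity)]
        exact pow_le_pow_right₀ hα.le hn.le
      · have h1 : (G n : ℝ) ≤ G d := by exact_mod_cast h.strictMono.monotone hn.le
        have h2 : (1 : ℝ) ≤ α ^ n := one_le_pow₀ hα.le
        nlinarith [hG0 d]

theorem coeff_le_dominantRoot (h : IsLinearRecurrenceBase G d a) :
    (a 1 : ℝ) ≤ dominantRoot d a := by
  have hα := h.isDominantRoot_dominantRoot.1
  have h1 := h.sum_inv_pow d le_rfl
  have h2 : (a 1 : ℝ) * dominantRoot d a ^ (d - 1) ≤ dominantRoot d a ^ d := by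
    rw [← h1]
    exact Finset.single_le_sum (f := fun i => (a i : ℝ) * dominantRoot d a ^ (d - i))
      (fun i _ => by positivity) (Finset.mem_Icc.mpr ⟨le_rfl, h.one_le_d⟩)
  have h3 : dominantRoot d a ^ d = dominantRoot d a * dominantRoot d a ^ (d - 1) := by
    rw [← pow_succ']; congr 1; have := h.one_le_d; omega
  rw [h3] at h2
  exact le_of_mul_le_mul_right h2 (by positivity)

/-- Every a_i is at most a_1, so the root equation gives (α - 1) α^d ≤ a_1 (α^d - 1). -/
theorem dominantRoot_le (h : IsLinearRecurrenceBase G d a) :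
    dominantRoot d a ≤ a 1 + 1 := by
  have hα := h.isDominantRoot_dominantRoot.1
  set α := dominantRoot d a
  have h1 := h.sum_inv_pow d le_rfl
  have h2 : α ^ d ≤ a 1 * ∑ i ∈ Finset.range d, α ^ i := by
    rw [← h1, Finset.mul_sum, ← Finset.sum_range_reflect (fun i => (a 1 : ℝ) * α ^ i),
      ← Finset.Ico_add_one_right_eq_Icc, Finset.sum_Ico_eq_sum_range]
    apply Finset.sum_le_sum
    intro i hi
    have hi' := Finset.mem_range.mp hi
    rw [show d - (1 + i) = d - 1 - i by omega]
    gcongr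
    exact_mod_cast h.coeff_le (by omega) (by omega)
  have h3 := mul_geom_sum α d
  have h4 : (α - 1) * α ^ d ≤ a 1 * α ^ d := by
    calc (α - 1) * α ^ d ≤ (α - 1) * (a 1 * ∑ i ∈ Finset.range d, α ^ i) := by
          gcongr
      _ = a 1 * (α ^ d - 1) := by rw [← h3]; ring
      _ ≤ _ := by gcongr; linarith
  have := le_of_mul_le_mul_right h4 (by positivity)
  linarith

end IsLinearRecurrenceBase


/-! ### Power saving uniform in β -/

theorem norm_unitExp_add_sub_one_le (x y : ℝ) :
    ‖unitExp (x + y) - 1‖ ≤ ‖unitExp x - 1‖ + ‖unitExp y - 1‖ := by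
  have : unitExp (x + y) - 1 = unitExp y * (unitExp x - 1) + (unitExp y - 1) := by
    rw [unitExp_add]; ring
  rw [this]
  refine (norm_add_le _ _).trans ?_
  rw [norm_mul, norm_unitExp, one_mul]

theorem norm_unitExp_neg_sub_one (x : ℝ) : ‖unitExp (-x) - 1‖ = ‖unitExp x - 1‖ := by
  rw [norm_unitExp_sub_one, norm_unitExp_sub_one, mul_neg, Real.sin_neg, abs_neg]

theorem norm_unitExp_nat_mul_sub_one_le (n : ℕ) (x : ℝ) :
    ‖unitExp (n * x) - 1‖ ≤ n * ‖unitExp x - 1‖ := by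
  induction n with
  | zero => simp
  | succ n ih =>
    have : ((n + 1 : ℕ) : ℝ) * x = n * x + x := by push_cast; ring
    rw [this]
    refine (norm_unitExp_add_sub_one_le _ _).trans ?_
    push_cast
    linarith

theorem norm_unitExp_sum_sub_one_le {ι : Type*} (s : Finset ι) (f : ι → ℝ) :
    ‖unitExp (∑ i ∈ s, f i) - 1‖ ≤ ∑ i ∈ s, ‖unitExp (f i) - 1‖ := by
  classical
  induction s using Finset.induction_on with
  | empty => simp
  | insert i s hi ih =>
    rw [Finset.sum_insert hi, Finset.sum_insert hi]
    exact (norm_unitExp_add_sub_one_le _ _).trans (by linarith)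

/-- With t = |e(x) - 1| the parallelogram law gives |1 + e(x)|² = 4 - t² ≤ (2 - t²/4)². -/
theorem norm_one_add_unitExp_le (x : ℝ) :
    ‖1 + unitExp x‖ ≤ 2 - ‖unitExp x - 1‖ ^ 2 / 4 := by
  have h1 := parallelogram_law_with_norm ℝ (unitExp x) 1
  rw [norm_unitExp, norm_one, add_comm (unitExp x)] at h1
  have h2 : ‖unitExp x - 1‖ ≤ 2 := by
    refine (norm_sub_le _ _).trans ?_
    rw [norm_unitExp, norm_one]
    norm_num
  have h3 := norm_nonneg (unitExp x - 1)
  apply le_of_abs_le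
  apply abs_le_of_sq_le_sq _ (by nlinarith)
  nlinarith [sq_nonneg (‖unitExp x - 1‖ ^ 2)]

theorem norm_geomExp_le_of_two_le {b : ℕ} (hb : 2 ≤ b) (y : ℝ) :
    ‖geomExp b y‖ ≤ b - ‖unitExp y - 1‖ ^ 2 / 4 := by
  induction b, hb using Nat.le_induction with
  | base =>
    have : geomExp 2 y = 1 + unitExp y := by simp [geomExp, Finset.sum_range_succ]
    rw [this]
    exact_mod_cast norm_one_add_unitExp_le y
  | succ b hb ih =>
    rw [geomExp_succ]
    refine (norm_add_le _ _).trans ?_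
    rw [norm_unitExp]
    push_cast
    linarith

namespace IsLinearRecurrenceBase

variable {G : ℕ → ℕ} {d : ℕ} {a : ℕ → ℕ}

/-- In ∑ a_i (θ + β G_{n-i}) - (θ + β G_n) the frequency β cancels by the recurrence and (A - 1)θ
remains, with A = ∑ a_i. This combination involves A + 1 phases counted with multiplicity, so one of
them is at least a 1/(A + 1) share away from 1, whatever β is. -/
theorem exists_phase (h : IsLinearRecurrenceBase G d a) (θ : ℝ)
    (hθ : unitExp ((∑ i ∈ Finset.Icc 1 d, (a i : ℝ) - 1) * θ) ≠ 1) :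
    ∃ δ : ℝ, 0 < δ ∧ ∀ (β : ℝ) (n : ℕ), d ≤ n → ∃ i, n - d ≤ i ∧ i ≤ n ∧
      δ ≤ ‖unitExp (θ + β * G i) - 1‖ := by
  set A : ℝ := ∑ i ∈ Finset.Icc 1 d, (a i : ℝ) with hA
  have hA0 : 0 ≤ A := Finset.sum_nonneg fun _ _ => Nat.cast_nonneg _
  have hpos : 0 < ‖unitExp ((A - 1) * θ) - 1‖ := norm_pos_iff.mpr (sub_ne_zero.mpr hθ)
  refine ⟨‖unitExp ((A - 1) * θ) - 1‖ / (A + 1), by positivity, fun β n hn => ?_⟩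
  by_contra hcon
  push Not at hcon
  set δ := ‖unitExp ((A - 1) * θ) - 1‖ / (A + 1) with hδ
  have hid : (A - 1) * θ =
      ∑ i ∈ Finset.Icc 1 d, (a i : ℝ) * (θ + β * G (n - i)) + -(θ + β * G n) := by
    have hrec : (G n : ℝ) = ∑ i ∈ Finset.Icc 1 d, (a i : ℝ) * G (n - i) := by
      exact_mod_cast h.recurrence' hn
    have : ∑ i ∈ Finset.Icc 1 d, (a i : ℝ) * (θ + β * G (n - i)) = A * θ + β * G n := by
      rw [hrec, hA, Finset.sum_mul, Finset.mul_sum, ← Finset.sum_add_distrib]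
      apply Finset.sum_congr rfl
      intros
      ring
    rw [this]
    ring
  have h1 : ‖unitExp ((A - 1) * θ) - 1‖ < (A + 1) * δ := by
    rw [hid]
    refine (norm_unitExp_add_sub_one_le _ _).trans_lt ?_
    rw [norm_unitExp_neg_sub_one, add_mul, one_mul]
    refine add_lt_add_of_le_of_lt ?_ (hcon n (by omega) le_rfl)
    refine (norm_unitExp_sum_sub_one_le _ _).trans ?_
    rw [hA, Finset.sum_mul]
    apply Finset.sum_le_sum
    intro i hi
    have hi' := Finset.mem_Icc.mp hi
    refine (norm_unitExp_nat_mul_sub_one_le _ _).trans ?_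
    gcongr
    exact (hcon (n - i) (by omega) (by omega)).le
  rw [hδ, mul_div_cancel₀ _ (by positivity)] at h1
  exact lt_irrefl _ h1

/-- The `d` values `T_m, …, T_{m-d+1}` are bounded by `K α^m, …, K α^{m-d+1}`. -/
def WindowBound (G : ℕ → ℕ) (d : ℕ) (a : ℕ → ℕ) (θ β : ℝ) (K : ℝ) (m : ℕ) : Prop :=
  ∀ n, n ≤ m → m < n + d → ‖expSum G θ β (G n)‖ ≤ K * dominantRoot d a ^ n

/-- Terms outside s are bounded trivially by |c_j| ≤ a_j, and the root equation adds up their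
majorants. The terms in s stay available for a sharper treatment. -/
theorem norm_sub_le_of_forall (h : IsLinearRecurrenceBase G d a) {θ β K : ℝ} {n : ℕ}
    (hn : d ≤ n) (hK : ∀ j, 1 ≤ j → j ≤ d →
      ‖expSum G θ β (G (n - j))‖ ≤ K * dominantRoot d a ^ (n - j))
    (s : Finset ℕ) (hs : s ⊆ Finset.Icc 1 d) :
    ‖expSum G θ β (G n) - ∑ j ∈ s, coef G a θ β n j * expSum G θ β (G (n - j))‖ ≤
      K * (dominantRoot d a ^ n - ∑ j ∈ s, (a j : ℝ) * dominantRoot d a ^ (n - j)) := by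
  rw [h.expSum_recurrence θ β hn, ← h.sum_inv_pow n hn, ← Finset.sum_sdiff hs,
    ← Finset.sum_sdiff hs, add_sub_cancel_right, add_sub_cancel_right, Finset.mul_sum]
  refine (norm_sum_le _ _).trans (Finset.sum_le_sum fun j hj => ?_)
  have hj' := Finset.mem_Icc.mp (Finset.mem_sdiff.mp hj).1
  rw [norm_mul, mul_left_comm]
  exact mul_le_mul (norm_coef_le _ _ _ _ _ _) (hK j hj'.1 hj'.2) (norm_nonneg _)
    (Nat.cast_nonneg _)

theorem WindowBound.norm_le (h : IsLinearRecurrenceBase G d a) {θ β K : ℝ} {m : ℕ}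
    (hm : d ≤ m) (hb : WindowBound G d a θ β K m) :
    ∀ n, m < n + d → ‖expSum G θ β (G n)‖ ≤ K * dominantRoot d a ^ n := by
  intro n
  induction n using Nat.strong_induction_on with
  | _ n ih =>
    intro hn
    rcases le_or_gt n m with h1 | h1
    · exact hb n h1 hn
    · have := h.norm_sub_le_of_forall (θ := θ) (β := β) (K := K) (n := n) (by omega)
        (fun j h1 h2 => ih (n - j) (by omega) (by omega)) ∅ (by simp)
      simpa using this

theorem coef_one (G : ℕ → ℕ) (a : ℕ → ℕ) (θ β : ℝ) (n : ℕ) :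
    coef G a θ β n 1 = geomExp (a 1) (θ + β * G (n - 1)) := by
  simp [coef]

/-- If a_1 ≥ 2, the phase at level i occurs between consecutive terms of the geometric sum c_1,
which loses δ²/4. If a_1 = 1, then c_1 = 1, and the phase w = e(θ + β G_i) appears in the next
nonzero coefficient, c_j = w. Then T_{i+1} is T_i + w T_{i+1-j} up to trivially bounded terms, and
T_i may itself be replaced by T_{i+1-j} at trivial cost; the loss comes from 1 + w. -/
theorem norm_le_of_phase (h : IsLinearRecurrenceBase G d a) {θ β K δ : ℝ} {m i : ℕ}
    (hK : 0 ≤ K) (hδ : 0 ≤ δ) (hm : d ≤ m) (hb : WindowBound G d a θ β K m) (hi : m + d ≤ i)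
    (hγ : δ ≤ ‖unitExp (θ + β * G i) - 1‖) :
    ‖expSum G θ β (G (i + 1))‖ ≤
      K * (dominantRoot d a ^ (i + 1) - δ ^ 2 / 4 * dominantRoot d a ^ (i + 1 - d)) := by
  have hd := h.one_le_d
  have hα := h.isDominantRoot_dominantRoot.1
  have hT := WindowBound.norm_le h hm hb
  set α := dominantRoot d a
  have hγ2 : δ ^ 2 / 4 ≤ ‖unitExp (θ + β * G i) - 1‖ ^ 2 / 4 := by gcongr
  have hstep := fun n (hn : m < n) (s : Finset ℕ) hs =>
    h.norm_sub_le_of_forall (θ := θ) (β := β) (K := K) (n := n) (by omega)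
      (fun j h1 h2 => hT (n - j) (by omega)) s hs
  rcases (show 2 ≤ a 1 ∨ a 1 = 1 by have := h.first_pos; omega) with ha | ha
  · have h1 := hstep (i + 1) (by omega) {1} (by simp [hd])
    simp only [Finset.sum_singleton, coef_one, Nat.add_sub_cancel] at h1
    have h2 := norm_geomExp_le_of_two_le ha (θ + β * G i)
    have h3 := hT i (by omega)
    have h4 : α ^ (i + 1 - d) ≤ α ^ i := pow_le_pow_right₀ hα.le (by omega)
    have h5 : ‖geomExp (a 1) (θ + β * G i) * expSum G θ β (G i)‖ ≤
        (a 1 - δ ^ 2 / 4) * (K * α ^ i) := by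
      rw [norm_mul]
      exact mul_le_mul (by linarith) h3 (norm_nonneg _)
        (by linarith [norm_nonneg (geomExp (a 1) (θ + β * G i))])
    have h6 := norm_le_norm_add_norm_sub' (expSum G θ β (G (i + 1)))
      (geomExp (a 1) (θ + β * G i) * expSum G θ β (G i))
    have h7 : K * (δ ^ 2 / 4 * α ^ (i + 1 - d)) ≤ K * (δ ^ 2 / 4 * α ^ i) := by gcongr
    linarith
  · have hd2 : 2 ≤ d := by
      by_contra hlt
      have h1 : d = 1 := by omega
      have := h.two_le_sum
      rw [h1] at this
      simp at this
      omega
    have hex : ∃ j, 2 ≤ j ∧ 0 < a j := ⟨d, hd2, h.last_pos⟩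
    classical
    obtain ⟨j, ⟨hj2, hjpos⟩, hjmin⟩ : ∃ j, (2 ≤ j ∧ 0 < a j) ∧ ∀ t < j, ¬ (2 ≤ t ∧ 0 < a t) :=
      ⟨Nat.find hex, Nat.find_spec hex, fun t => Nat.find_min hex⟩
    have hjd : j ≤ d := by
      by_contra hlt
      exact hjmin d (by omega) ⟨hd2, h.last_pos⟩
    have haj : a j = 1 := by
      have := h.coeff_le (show 1 ≤ j by omega) hjd
      omega
    have hc1 : ∀ n, coef G a θ β n 1 = 1 := by
      intro n
      rw [coef_one, ha, geomExp_one]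
    have hcj : coef G a θ β (i + 1) j = unitExp (θ + β * G i) := by
      rw [coef, haj, geomExp_one, mul_one]
      congr 1
      rw [Finset.sum_eq_single 1]
      · simp [ha]
      · intro t ht hne
        have ht' := Finset.mem_Ico.mp ht
        have : a t = 0 := by
          by_contra h0
          exact hjmin t ht'.2 ⟨by omega, by omega⟩
        simp [this]
      · intro h1
        exact absurd (Finset.mem_Ico.mpr ⟨le_rfl, by omega⟩) h1
    -- Since c_1 = 1 at every level, descending one level at a time gives majorants that telescope.
    have hdiff : ∀ r, r ≤ d → ‖expSum G θ β (G i) - expSum G θ β (G (i - r))‖ ≤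
        K * (α ^ i - α ^ (i - r)) := by
      intro r
      induction r with
      | zero => simp
      | succ r ih =>
        intro hr
        have h1 := hstep (i - r) (by omega) {1} (by simp [hd])
        simp only [Finset.sum_singleton, hc1, one_mul, ha, Nat.cast_one] at h1
        have e : i - r - 1 = i - (r + 1) := by omega
        rw [e] at h1
        have h2 := ih (by omega)
        have h3 := norm_sub_le_norm_sub_add_norm_sub (expSum G θ β (G i))
          (expSum G θ β (G (i - r))) (expSum G θ β (G (i - (r + 1))))
        linarith
    have h1 := hstep (i + 1) (by omega) {1, j} (by
      intro t ht
      simp at ht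
      simp
      omega)
    rw [Finset.sum_pair (by omega), Finset.sum_pair (by omega), hc1, hcj, ha, haj] at h1
    simp only [Nat.add_sub_cancel, one_mul, Nat.cast_one] at h1
    have h2 := hdiff (j - 1) (by omega)
    rw [show i - (j - 1) = i + 1 - j by omega] at h2
    set w := unitExp (θ + β * G i)
    set Y := expSum G θ β (G (i + 1 - j))
    have h3 : ‖(1 + w) * Y‖ ≤ (2 - δ ^ 2 / 4) * (K * α ^ (i + 1 - j)) := by
      have h5 := norm_one_add_unitExp_le (θ + β * G i)
      have h6 : ‖1 + w‖ ≤ 2 - δ ^ 2 / 4 := by linarith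
      rw [norm_mul]
      exact mul_le_mul h6 (hT _ (by omega)) (norm_nonneg _) ((norm_nonneg _).trans h6)
    have h4 : expSum G θ β (G (i + 1)) =
        (expSum G θ β (G (i + 1)) - (expSum G θ β (G i) + w * Y)) +
        (expSum G θ β (G i) - Y) + (1 + w) * Y := by ring
    have h5 : K * (δ ^ 2 / 4 * α ^ (i + 1 - d)) ≤ K * (δ ^ 2 / 4 * α ^ (i + 1 - j)) := by
      have : α ^ (i + 1 - d) ≤ α ^ (i + 1 - j) := pow_le_pow_right₀ hα.le (by omega)
      gcongr
    rw [h4]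
    have h6 := norm_add₃_le (a := expSum G θ β (G (i + 1)) - (expSum G θ β (G i) + w * Y))
      (b := expSum G θ β (G i) - Y) (c := (1 + w) * Y)
    linarith

/-- An absolute saving is never lost: T_n enters T_{n+1} with weight at most a_1 in the majorant,
and a_1 ≥ 1 carries the saving K ξ along. -/
theorem norm_le_sub_of_le (h : IsLinearRecurrenceBase G d a) {θ β K ξ : ℝ} {m i : ℕ}
    (hK : 0 ≤ K) (hξ : 0 ≤ ξ) (hm : d ≤ m) (hb : WindowBound G d a θ β K m) (hi : m ≤ i)
    (hsave : ‖expSum G θ β (G i)‖ ≤ K * (dominantRoot d a ^ i - ξ)) :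
    ∀ n, i ≤ n → ‖expSum G θ β (G n)‖ ≤ K * (dominantRoot d a ^ n - ξ) := by
  have hT := WindowBound.norm_le h hm hb
  intro n hn
  induction n, hn using Nat.le_induction with
  | base => exact hsave
  | succ n hn ih =>
    have h1 := h.norm_sub_le_of_forall (θ := θ) (β := β) (K := K) (n := n + 1) (by omega)
      (fun j h1 h2 => hT (n + 1 - j) (by omega)) {1} (by simp [h.one_le_d])
    simp only [Finset.sum_singleton, coef_one, Nat.add_sub_cancel] at h1
    have h2 : ‖geomExp (a 1) (θ + β * G n) * expSum G θ β (G n)‖ ≤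
        a 1 * (K * (dominantRoot d a ^ n - ξ)) := by
      rw [norm_mul]
      exact mul_le_mul (norm_geomExp_le _ _) ih (norm_nonneg _) (Nat.cast_nonneg _)
    have h3 := norm_le_norm_add_norm_sub' (expSum G θ β (G (n + 1)))
      (geomExp (a 1) (θ + β * G n) * expSum G θ β (G n))
    have h4 : (1 : ℝ) ≤ a 1 := by exact_mod_cast h.first_pos
    have h5 : 1 * (K * ξ) ≤ a 1 * (K * ξ) := by gcongr
    linarith

theorem exists_contraction (h : IsLinearRecurrenceBase G d a) (θ : ℝ)
    (hθ : unitExp ((∑ i ∈ Finset.Icc 1 d, (a i : ℝ) - 1) * θ) ≠ 1) :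
    ∃ κ : ℝ, 0 < κ ∧ κ < 1 ∧ ∀ (β K : ℝ) (m : ℕ), 0 ≤ K → d ≤ m →
      WindowBound G d a θ β K m → WindowBound G d a θ β (κ * K) (m + (3 * d + 1)) := by
  obtain ⟨δ, hδ, hphase⟩ := h.exists_phase θ hθ
  have hα := h.isDominantRoot_dominantRoot.1
  set α := dominantRoot d a
  have hα0 : 0 < α := by linarith
  -- The bad phase is sought in [m + d, m + 2d], where `norm_le_of_phase` applies; the next d levels
  -- then contain a full window to which the saving has been transported.
  set L := 3 * d + 1
  have hκ : 1 - δ ^ 2 / 4 * (α ^ L)⁻¹ < 1 := by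
    have : 0 < δ ^ 2 / 4 * (α ^ L)⁻¹ := by positivity
    linarith
  -- The saving δ²/4 · α^(i+1-d) is compared with α^n, at most L levels higher; the maximum with 1/2
  -- only keeps κ positive.
  refine ⟨max (1 / 2) (1 - δ ^ 2 / 4 * (α ^ L)⁻¹), lt_max_of_lt_left (by norm_num),
    max_lt (by norm_num) hκ, fun β K m hK hm hb n hn hnd => ?_⟩
  obtain ⟨i, hi1, hi2, hγ⟩ := hphase β (m + 2 * d) (by omega)
  have h1 := h.norm_le_of_phase hK hδ.le hm hb (by omega) hγ
  have h2 := h.norm_le_sub_of_le hK (by positivity) hm hb (by omega) h1 n (by omega)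
  refine h2.trans ?_
  have h3 : α ^ n ≤ α ^ (i + 1 - d) * α ^ L := by
    rw [← pow_add]
    exact pow_le_pow_right₀ hα.le (by omega)
  have h4 : (α ^ L)⁻¹ * α ^ n ≤ α ^ (i + 1 - d) := by
    rw [inv_mul_le_iff₀ (by positivity)]
    linarith
  have h5 : δ ^ 2 / 4 * ((α ^ L)⁻¹ * α ^ n) ≤ δ ^ 2 / 4 * α ^ (i + 1 - d) := by gcongr
  calc K * (α ^ n - δ ^ 2 / 4 * α ^ (i + 1 - d))
      ≤ K * ((1 - δ ^ 2 / 4 * (α ^ L)⁻¹) * α ^ n) := by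
        apply mul_le_mul_of_nonneg_left _ hK
        linarith
    _ ≤ K * (max (1 / 2) (1 - δ ^ 2 / 4 * (α ^ L)⁻¹) * α ^ n) := by
        gcongr
        exact le_max_right _ _
    _ = _ := by ring

/-- Power saving relative to the values at an intermediate level `m`. -/
theorem exists_power_saving (h : IsLinearRecurrenceBase G d a) (θ : ℝ)
    (hθ : unitExp ((∑ i ∈ Finset.Icc 1 d, (a i : ℝ) - 1) * θ) ≠ 1) :
    ∃ C η : ℝ, 0 < C ∧ 0 < η ∧ η ≤ 1 / 4 ∧ ∀ (β : ℝ) (m i : ℕ), d ≤ m → m ≤ i →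
      ‖expSum G θ β (G i)‖ ≤ C * dominantRoot d a ^ i *
        dominantRoot d a ^ (-(η * (i - m : ℝ))) *
        ∑ j ∈ Finset.range d,
          ‖expSum G θ β (G (m - j))‖ * (dominantRoot d a ^ (m - j))⁻¹ := by
  obtain ⟨κ, hκ0, hκ1, hcon⟩ := h.exists_contraction θ hθ
  have hα := h.isDominantRoot_dominantRoot.1
  set α := dominantRoot d a
  have hα0 : 0 < α := by linarith
  have hlogα : 0 < Real.log α := Real.log_pos hα
  have hlogκ : Real.log κ < 0 := Real.log_neg hκ0 hκ1
  set L := 3 * d + 1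
  have hL : (0 : ℝ) < L := by positivity
  -- Chosen so that κ ≤ α^(-ηL). The cap 1/4 is used in `block_arith`.
  set η := min (1 / 4) (-Real.log κ / (L * Real.log α)) with hη
  have hη0 : 0 < η := lt_min (by norm_num) (div_pos (by linarith) (by positivity))
  have hκη : κ ≤ α ^ (-(η * L)) := by
    rw [← Real.log_le_log_iff hκ0 (by positivity), Real.log_rpow hα0]
    have : η ≤ -Real.log κ / (L * Real.log α) := min_le_right _ _
    rw [le_div_iff₀ (by positivity)] at this
    linarith
  refine ⟨α ^ (η * L), η, by positivity, hη0, min_le_left _ _, fun β m i hm hi => ?_⟩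
  -- Taking the sum of the normalised values, rather than their maximum, makes the bound linear, so
  -- that it can later be summed over β.
  set K := ∑ j ∈ Finset.range d, ‖expSum G θ β (G (m - j))‖ * (α ^ (m - j))⁻¹ with hKdef
  have hK : 0 ≤ K := Finset.sum_nonneg fun _ _ => by positivity
  have hb : WindowBound G d a θ β K m := by
    intro n hn hnd
    have h1 := Finset.single_le_sum
      (f := fun j => ‖expSum G θ β (G (m - j))‖ * (α ^ (m - j))⁻¹) (fun _ _ => by positivity)
      (Finset.mem_range.mpr (show m - n < d by omega))
    rw [show m - (m - n) = n by omega] at h1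
    rwa [← div_eq_mul_inv, div_le_iff₀ (by positivity)] at h1
  have hiter : ∀ k, WindowBound G d a θ β (κ ^ k * K) (m + k * L) := by
    intro k
    induction k with
    | zero => simpa using hb
    | succ k ih =>
      have := hcon β (κ ^ k * K) (m + k * L) (by positivity) (by omega) ih
      rw [← mul_assoc, ← pow_succ'] at this
      rwa [show m + (k + 1) * L = m + k * L + L by ring]
  set k := (i - m) / L
  have hdiv : k * L + (i - m) % L = i - m := Nat.div_add_mod' _ _
  have hmod : (i - m) % L < L := Nat.mod_lt _ (by omega)
  have h1 := WindowBound.norm_le h (by omega) (hiter k) i (by have := h.one_le_d; omega)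
  have h2 : κ ^ k ≤ α ^ (η * L) * α ^ (-(η * (i - m : ℝ))) := by
    have h3 : κ ^ k ≤ (α ^ (-(η * L))) ^ k := pow_le_pow_left₀ hκ0.le hκη k
    refine h3.trans ?_
    rw [← Real.rpow_mul_natCast hα0.le, ← Real.rpow_add hα0]
    apply Real.rpow_le_rpow_of_exponent_le hα.le
    have h4 : (i : ℝ) - m < k * L + L := by
      have : i < m + (k * L + L) := by omega
      have : (i : ℝ) < m + (k * L + L) := by exact_mod_cast this
      linarith
    nlinarith
  calc _ ≤ κ ^ k * K * α ^ i := h1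
    _ ≤ (α ^ (η * L) * α ^ (-(η * (i - m : ℝ)))) * K * α ^ i := by gcongr
    _ = _ := by ring

end IsLinearRecurrenceBase


/-! ### Large sieve and the exponent 1/2 -/

/-- Discrete Parseval identity for trigonometric sums with at most `L` terms. -/
theorem sum_norm_sq_lattice (c : ℕ → ℂ) {K L : ℕ} (hL : 0 < L) (hK : K ≤ L) :
    ∑ m ∈ Finset.range L, ‖∑ k ∈ Finset.range K, c k * unitExp ((m / L : ℝ) * k)‖ ^ 2 =
      L * ∑ k ∈ Finset.range K, ‖c k‖ ^ 2 := by
  have hsq : ∀ z : ℂ, ((‖z‖ ^ 2 : ℝ) : ℂ) = z * (starRingEnd ℂ) z := by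
    intro z
    rw [Complex.mul_conj, Complex.normSq_eq_norm_sq]
  have key : ((∑ m ∈ Finset.range L,
      ‖∑ k ∈ Finset.range K, c k * unitExp ((m / L : ℝ) * k)‖ ^ 2 : ℝ) : ℂ) =
      ((L * ∑ k ∈ Finset.range K, ‖c k‖ ^ 2 : ℝ) : ℂ) := by
    rw [Complex.ofReal_sum, Complex.ofReal_mul, Complex.ofReal_sum]
    simp only [hsq, map_sum, map_mul, ← unitExp_neg, Finset.sum_mul_sum]
    rw [Finset.sum_comm, Finset.mul_sum]
    apply Finset.sum_congr rfl
    intro k hk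
    rw [Finset.sum_comm]
    have hterm : ∀ k' ∈ Finset.range K, ∑ m ∈ Finset.range L,
        c k * unitExp ((m / L : ℝ) * k) * ((starRingEnd ℂ) (c k') *
          unitExp (-((m / L : ℝ) * k'))) =
        if k' = k then (L : ℂ) * (c k * (starRingEnd ℂ) (c k)) else 0 := by
      intro k' hk'
      have h1 : ∀ m ∈ Finset.range L, c k * unitExp ((m / L : ℝ) * k) * ((starRingEnd ℂ) (c k') *
          unitExp (-((m / L : ℝ) * k'))) =
          c k * (starRingEnd ℂ) (c k') * unitExp (m * (((k : ℤ) - k' : ℤ) / L)) := by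
        intro m _
        have : (m : ℝ) * (((k : ℤ) - k' : ℤ) / L) = (m / L : ℝ) * k + -((m / L : ℝ) * k') := by
          push_cast
          ring
        rw [this, unitExp_add]
        ring
      rw [Finset.sum_congr rfl h1, ← Finset.mul_sum, sum_unitExp_mul_div L hL]
      have hk1 := Finset.mem_range.mp hk
      have hk2 := Finset.mem_range.mp hk'
      by_cases heq : k' = k
      · subst heq
        simp
        ring
      · rw [if_neg heq, if_neg, mul_zero]
        intro hdvd
        have := Int.eq_zero_of_abs_lt_dvd hdvd (by rw [abs_lt]; omega)
        omega
    rw [Finset.sum_congr rfl hterm, Finset.sum_ite_eq' (Finset.range K) k, if_pos hk,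
      Complex.ofReal_natCast]
  exact_mod_cast key

/-- Abel summation: the frequency is moved from x to x + η at the cost of the partial sums at x. -/
theorem sum_mul_unitExp_add (c : ℕ → ℂ) (x η : ℝ) (N : ℕ) :
    ∑ k ∈ Finset.range N, c k * unitExp ((x + η) * k) =
      unitExp (η * N) * ∑ k ∈ Finset.range N, c k * unitExp (x * k) -
      ∑ K ∈ Finset.range N, (unitExp (η * (K + 1 : ℕ)) - unitExp (η * K)) *
        ∑ k ∈ Finset.range (K + 1), c k * unitExp (x * k) := by
  induction N with
  | zero => simp
  | succ N ih =>
    rw [Finset.sum_range_succ, ih, Finset.sum_range_succ _ N,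
      Finset.sum_range_succ (fun K => (unitExp (η * (K + 1 : ℕ)) - unitExp (η * K)) *
        ∑ k ∈ Finset.range (K + 1), c k * unitExp (x * k)), Finset.sum_range_succ _ N,
      add_mul, unitExp_add]
    ring

theorem norm_sum_mul_unitExp_add_le (c : ℕ → ℂ) (x η : ℝ) (N : ℕ) :
    ‖∑ k ∈ Finset.range N, c k * unitExp ((x + η) * k)‖ ≤
      ‖∑ k ∈ Finset.range N, c k * unitExp (x * k)‖ + 2 * Real.pi * |η| *
      ∑ K ∈ Finset.range N, ‖∑ k ∈ Finset.range (K + 1), c k * unitExp (x * k)‖ := by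
  rw [sum_mul_unitExp_add]
  refine (norm_sub_le _ _).trans ?_
  rw [norm_mul, norm_unitExp, one_mul, Finset.mul_sum]
  gcongr
  refine (norm_sum_le _ _).trans (Finset.sum_le_sum fun K _ => ?_)
  rw [norm_mul]
  gcongr
  have : unitExp (η * (K + 1 : ℕ)) - unitExp (η * K) = unitExp (η * K) * (unitExp η - 1) := by
    have : η * ((K + 1 : ℕ) : ℝ) = η * K + η := by push_cast; ring
    rw [this, unitExp_add]
    ring
  rw [this, norm_mul, norm_unitExp, one_mul]
  exact norm_unitExp_sub_one_le η

/-- Large sieve for one sample point in each cell of a lattice. -/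
theorem large_sieve_cells (c : ℕ → ℂ) (hc : ∀ k, ‖c k‖ ≤ 1) {N L : ℕ} (hL : 0 < L) (hN : N ≤ L)
    (g : ℕ → ℝ) (hg : ∀ m < L, (m / L : ℝ) ≤ g m ∧ g m ≤ (m + 1) / L) :
    ∑ m ∈ Finset.range L, ‖∑ k ∈ Finset.range N, c k * unitExp (g m * k)‖ ^ 2 ≤
      (2 + 8 * Real.pi ^ 2) * (L * N) := by
  have hL' : (0 : ℝ) < L := by exact_mod_cast hL
  set F : ℕ → ℕ → ℝ := fun K m => ‖∑ k ∈ Finset.range K, c k * unitExp ((m / L : ℝ) * k)‖ with hF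
  have hpars : ∀ K ≤ N, ∑ m ∈ Finset.range L, F K m ^ 2 ≤ L * N := by
    intro K hK
    rw [hF, sum_norm_sq_lattice c hL (hK.trans hN)]
    gcongr
    calc ∑ k ∈ Finset.range K, ‖c k‖ ^ 2 ≤ ∑ k ∈ Finset.range K, (1 : ℝ) :=
          Finset.sum_le_sum fun k _ => pow_le_one₀ (norm_nonneg _) (hc k)
      _ = K := by simp
      _ ≤ N := by exact_mod_cast hK
  have hpt : ∀ m ∈ Finset.range L, ‖∑ k ∈ Finset.range N, c k * unitExp (g m * k)‖ ^ 2 ≤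
      2 * F N m ^ 2 + 8 * Real.pi ^ 2 / L ^ 2 * N * ∑ K ∈ Finset.range N, F (K + 1) m ^ 2 := by
    intro m hm
    -- The sample point is within 1/L of the lattice point m/L, and Parseval on the lattice is
    -- available for every partial sum as well; as N ≤ L, the correction has the same order as the
    -- main term.
    have h1 := norm_sum_mul_unitExp_add_le c (m / L) (g m - m / L) N
    rw [add_sub_cancel] at h1
    obtain ⟨g1, g2⟩ := hg m (Finset.mem_range.mp hm)
    have h2 : |g m - m / L| ≤ 1 / L := by
      rw [abs_of_nonneg (by linarith)]
      rw [add_div] at g2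
      linarith
    have h3 : ‖∑ k ∈ Finset.range N, c k * unitExp (g m * k)‖ ≤
        F N m + 2 * Real.pi * (1 / L) * ∑ K ∈ Finset.range N, F (K + 1) m := by
      refine h1.trans ?_
      gcongr
    have h4 : (∑ K ∈ Finset.range N, F (K + 1) m) ^ 2 ≤
        N * ∑ K ∈ Finset.range N, F (K + 1) m ^ 2 := by
      simpa using sq_sum_le_card_mul_sum_sq (s := Finset.range N) (f := fun K => F (K + 1) m)
    calc _ ≤ (F N m + 2 * Real.pi * (1 / L) * ∑ K ∈ Finset.range N, F (K + 1) m) ^ 2 := by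
          gcongr
      _ ≤ 2 * (F N m ^ 2 + (2 * Real.pi * (1 / L) * ∑ K ∈ Finset.range N, F (K + 1) m) ^ 2) :=
          add_sq_le
      _ = 2 * F N m ^ 2 + 8 * Real.pi ^ 2 / L ^ 2 * (∑ K ∈ Finset.range N, F (K + 1) m) ^ 2 := by
          ring
      _ ≤ 2 * F N m ^ 2 +
          8 * Real.pi ^ 2 / L ^ 2 * (N * ∑ K ∈ Finset.range N, F (K + 1) m ^ 2) := by gcongr
      _ = _ := by ring
  refine (Finset.sum_le_sum hpt).trans ?_
  rw [Finset.sum_add_distrib, ← Finset.mul_sum, ← Finset.mul_sum, Finset.sum_comm]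
  have h5 : ∑ K ∈ Finset.range N, ∑ m ∈ Finset.range L, F (K + 1) m ^ 2 ≤ N * (L * N) := by
    calc _ ≤ ∑ K ∈ Finset.range N, ((L : ℝ) * N) :=
          Finset.sum_le_sum fun K hK => hpars (K + 1) (Finset.mem_range.mp hK)
      _ = _ := by simp
  have hNL : (N : ℝ) ≤ L := by exact_mod_cast hN
  have h6 : (N : ℝ) * N / L ^ 2 ≤ 1 := by
    rw [div_le_one (by positivity), ← sq]
    gcongr
  calc _ ≤ 2 * ((L : ℝ) * N) + 8 * Real.pi ^ 2 / L ^ 2 * N * (N * (L * N)) := by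
        gcongr
        exact hpars N le_rfl
    _ = 2 * ((L : ℝ) * N) + 8 * Real.pi ^ 2 * (L * N) * (N * N / L ^ 2) := by ring
    _ ≤ 2 * ((L : ℝ) * N) + 8 * Real.pi ^ 2 * (L * N) * 1 := by gcongr
    _ = _ := by ring

/-- Points of `[0, 1)` more than `1 / L` apart lie in distinct cells of the lattice of mesh
`1 / L`. -/
theorem sum_le_of_cells (f : ℝ → ℝ) (hf : ∀ x, 0 ≤ f x) (B : ℝ) {L : ℕ} (hL : 0 < L)
    (hB : ∀ g : ℕ → ℝ, (∀ m < L, (m / L : ℝ) ≤ g m ∧ g m ≤ (m + 1) / L) →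
      ∑ m ∈ Finset.range L, f (g m) ≤ B)
    (P : Finset ℝ) (hP : ∀ β ∈ P, 0 ≤ β ∧ β < 1)
    (hsep : ∀ β ∈ P, ∀ β' ∈ P, β ≠ β' → 1 / (L : ℝ) < |β - β'|) :
    ∑ β ∈ P, f β ≤ B := by
  classical
  have hL' : (0 : ℝ) < L := by exact_mod_cast hL
  set cell : ℝ → ℕ := fun β => ⌊β * L⌋₊ with hcell
  have hcell1 : ∀ β ∈ P, (cell β / L : ℝ) ≤ β ∧ β < (cell β + 1) / L := by
    intro β hβ
    have h0 := hP β hβ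
    rw [div_le_iff₀ hL', lt_div_iff₀ hL']
    exact ⟨Nat.floor_le (by nlinarith), Nat.lt_floor_add_one _⟩
  have hcell2 : ∀ β ∈ P, cell β < L := by
    intro β hβ
    have h0 := hP β hβ
    rw [hcell]
    simp only
    rw [Nat.floor_lt (by nlinarith)]
    nlinarith
  have hinj : ∀ β ∈ P, ∀ β' ∈ P, cell β = cell β' → β = β' := by
    intro β hβ β' hβ' heq
    by_contra hne
    have h1 := hsep β hβ β' hβ' hne
    have h2 := hcell1 β hβ
    have h3 := hcell1 β' hβ'
    rw [← heq] at h3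
    rw [add_div] at h2 h3
    have : |β - β'| < 1 / L := by
      rw [abs_lt]
      constructor <;> linarith [h2.1, h2.2, h3.1, h3.2]
    linarith
  -- Empty cells are filled with their left endpoint, which is harmless because f is nonnegative.
  set g : ℕ → ℝ := fun m => if hm : ∃ β ∈ P, cell β = m then hm.choose else m / L with hg
  have hgP : ∀ β ∈ P, g (cell β) = β := by
    intro β hβ
    have hex : ∃ β' ∈ P, cell β' = cell β := ⟨β, hβ, rfl⟩
    rw [hg]
    simp only
    rw [dif_pos hex]
    exact hinj _ hex.choose_spec.1 β hβ hex.choose_spec.2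
  refine le_trans ?_ (hB g ?_)
  · calc ∑ β ∈ P, f β = ∑ β ∈ P, f (g (cell β)) :=
          Finset.sum_congr rfl fun β hβ => by rw [hgP β hβ]
      _ = ∑ m ∈ P.image cell, f (g m) := by
          rw [Finset.sum_image]
          exact fun β hβ β' hβ' => hinj β hβ β' hβ'
      _ ≤ _ := by
          apply Finset.sum_le_sum_of_subset_of_nonneg
          · intro m hm
            obtain ⟨β, hβ, rfl⟩ := Finset.mem_image.mp hm
            exact Finset.mem_range.mpr (hcell2 β hβ)
          · exact fun m _ _ => hf _
  · intro m _
    by_cases hex : ∃ β ∈ P, cell β = m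
    · obtain ⟨β, hβ, rfl⟩ := hex
      rw [hgP β hβ]
      exact ⟨(hcell1 β hβ).1, (hcell1 β hβ).2.le⟩
    · rw [hg]
      simp only
      rw [dif_neg hex, add_div]
      exact ⟨le_rfl, by linarith [show 0 < 1 / (L : ℝ) by positivity]⟩

/-- Sums of `|T_n|` over `1 / D`-separated points save the factor `G_n ^ (1 - κ)`, for
`D ≥ G_n`. -/
def SpacedBound (G : ℕ → ℕ) (θ κ : ℝ) : Prop :=
  ∃ C : ℝ, 0 < C ∧ ∀ (n : ℕ) (P : Finset ℝ) (D : ℝ), (G n : ℝ) ≤ D →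
    (∀ β ∈ P, 0 ≤ β ∧ β < 1) → (∀ β ∈ P, ∀ β' ∈ P, β ≠ β' → 1 / D ≤ |β - β'|) →
    ∑ β ∈ P, ‖expSum G θ β (G n)‖ ≤ C * D * (G n : ℝ) ^ κ

/-- Cauchy–Schwarz applied to the large sieve over L cells gives √(L · L G_n), with L ≤ 2D. -/
theorem spacedBound_half (G : ℕ → ℕ) (hG : ∀ n, 0 < G n) (θ : ℝ) : SpacedBound G θ (1 / 2) := by
  refine ⟨2 * Real.sqrt (2 + 8 * Real.pi ^ 2), by positivity, fun n P D hD hP hsep => ?_⟩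
  have hN : (1 : ℝ) ≤ G n := by exact_mod_cast hG n
  set N := G n
  set L := ⌊D⌋₊ + 1 with hLdef
  have hDL : D < L := by push_cast [hLdef]; exact Nat.lt_floor_add_one D
  have hL2 : (L : ℝ) ≤ 2 * D := by
    push_cast [hLdef]
    have := Nat.floor_le (show 0 ≤ D by linarith)
    linarith
  have hNL : N ≤ L := by
    have : (N : ℝ) < L := by linarith
    exact_mod_cast this.le
  have hL0 : 0 < L := by omega
  have hLr : (0 : ℝ) < L := by exact_mod_cast hL0
  refine (sum_le_of_cells (fun β => ‖expSum G θ β N‖) (fun _ => norm_nonneg _)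
    (Real.sqrt (2 + 8 * Real.pi ^ 2) * L * (N : ℝ) ^ (1 / 2 : ℝ)) hL0 ?_ P hP ?_).trans ?_
  · intro g hg
    have h1 := large_sieve_cells (fun k => unitExp (θ * sumOfDigits G k))
      (fun k => (norm_unitExp _).le) hL0 hNL g hg
    simp only [← unitExp_add] at h1
    have h2 := sq_sum_le_card_mul_sum_sq (s := Finset.range L)
      (f := fun m => ‖expSum G θ (g m) N‖)
    rw [Finset.card_range] at h2
    apply le_of_abs_le
    apply abs_le_of_sq_le_sq _ (by positivity)
    refine h2.trans ?_
    rw [← Real.sqrt_eq_rpow, mul_pow, mul_pow, Real.sq_sqrt (by positivity),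
      Real.sq_sqrt (by positivity)]
    calc (L : ℝ) * ∑ m ∈ Finset.range L, ‖expSum G θ (g m) N‖ ^ 2
        ≤ L * ((2 + 8 * Real.pi ^ 2) * (L * N)) := by
          gcongr
          exact h1
      _ = _ := by ring
  · intro β hβ β' hβ' hne
    refine lt_of_lt_of_le ?_ (hsep β hβ β' hβ' hne)
    exact one_div_lt_one_div_of_lt (by linarith) hDL
  · calc _ ≤ Real.sqrt (2 + 8 * Real.pi ^ 2) * (2 * D) * (N : ℝ) ^ (1 / 2 : ℝ) := by gcongr
      _ = _ := by ring


/-! ### Jittered lattices and decoupling -/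

theorem sum_range_mul_eq {M : Type*} [AddCommMonoid M] (f : ℕ → M) (E N : ℕ) :
    ∑ i ∈ Finset.range (N * E), f i =
      ∑ k ∈ Finset.range N, ∑ u ∈ Finset.range E, f (k * E + u) := by
  induction N with
  | zero => simp
  | succ N ih => rw [Nat.succ_mul, Finset.sum_range_add, ih, Finset.sum_range_succ]

/-- Bound of the sums of `f` over one point in each of `N` short intervals, which start at a
translate of the lattice of mesh `1 / N` and have length `ρ / N`. -/
def JitterBound (f : ℝ → ℝ) (ρ : ℝ) (N : ℕ) (B : ℝ) : Prop :=
  ∀ (t : ℝ) (g : ℕ → ℝ), (∀ k < N, t + k / N ≤ g k ∧ g k ≤ t + (k + ρ) / N) →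
    ∑ k ∈ Finset.range N, f (g k) ≤ B

/-- A product of a function of `θ + N β` and a function with a bound on the lattice of mesh `1 / N`,
summed over a finer jittered lattice. -/
theorem jitter_decouple (f w : ℝ → ℝ) (hf : ∀ x, 0 ≤ f x) {ρ θ B F σ : ℝ}
    {N N' J : ℕ} (W : ℤ → ℝ) (hN : 0 < N) (hN' : 0 < N') (hσ : σ = N / N') (hρ0 : 0 ≤ ρ)
    (hρ : (1 + ρ) * σ ≤ ρ) (hJ : 1 / 2 < J * σ) (hB : JitterBound f ρ N B) (hF : ∀ x, f x ≤ F)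
    (hW0 : ∀ i ∈ Finset.Ico (-(J : ℤ)) J, 0 ≤ W i)
    (hW : ∀ (i P : ℤ) (x y : ℝ), -(1 / 2) ≤ x - P → x - P ≤ 1 / 2 → i * σ ≤ x - P →
      x - P ≤ (i + 1) * σ → x ≤ y → y ≤ x + ρ * σ → w y ≤ W i)
    (t : ℝ) (g : ℕ → ℝ) (hg : ∀ k < N', t + k / N' ≤ g k ∧ g k ≤ t + (k + ρ) / N') :
    ∑ k ∈ Finset.range N', w (θ + g k * N) * f (g k) ≤
      (∑ i ∈ Finset.Ico (-(J : ℤ)) J, W i) * (B + F) := by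
  classical
  have hNr : (0 : ℝ) < N := by exact_mod_cast hN
  have hNr' : (0 : ℝ) < N' := by exact_mod_cast hN'
  have hσ0 : 0 < σ := by rw [hσ]; positivity
  have hNσ : (N' : ℝ) * σ = N := by rw [hσ]; field_simp
  -- The argument θ + N g(k) of w lies in [x k, x k + ρσ]. Below, P k is an integer nearest to x k,
  -- and m p is the least index k with x k ≥ p.
  set x : ℕ → ℝ := fun k => θ + t * N + k * σ with hx
  set P0 : ℤ := ⌊x 0 + 1 / 2⌋ with hP0
  set P : ℕ → ℤ := fun k => ⌊x k + 1 / 2⌋ with hP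
  set m : ℤ → ℤ := fun p => ⌈(p - (θ + t * N)) / σ⌉ with hm
  have hPk : ∀ k, -(1 / 2) ≤ x k - P k ∧ x k - P k ≤ 1 / 2 := by
    intro k
    have h1 := Int.floor_le (x k + 1 / 2)
    have h2 := Int.lt_floor_add_one (x k + 1 / 2)
    simp only [hP]
    constructor <;> linarith
  have hmP : ∀ p : ℤ, (p : ℝ) - (θ + t * N) ≤ m p * σ ∧ m p * σ ≤ (p : ℝ) - (θ + t * N) + σ := by
    intro p
    have h1 := Int.le_ceil ((p - (θ + t * N)) / σ)
    have h2 := Int.ceil_lt_add_one ((p - (θ + t * N)) / σ)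
    rw [div_le_iff₀ hσ0] at h1
    have h3 : (m p : ℝ) - 1 ≤ (p - (θ + t * N)) / σ := by simp only [hm]; linarith
    rw [le_div_iff₀ hσ0] at h3
    exact ⟨h1, by linarith⟩
  have hmono : ∀ k, P0 ≤ P k := by
    intro k
    apply Int.floor_le_floor
    simp only [hx]
    have : 0 ≤ (k : ℝ) * σ := by positivity
    push_cast
    linarith
  have hPN : ∀ k < N', P k ≤ P0 + N := by
    intro k hk
    have h1 : P0 + N = ⌊x 0 + 1 / 2 + (N : ℝ)⌋ := by
      rw [Int.floor_add_natCast]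
    rw [h1]
    apply Int.floor_le_floor
    simp only [hx]
    have : (k : ℝ) * σ ≤ N' * σ := by gcongr
    push_cast
    linarith
  -- The points are indexed by a position i relative to the nearest integer, which determines the
  -- weight, and by that integer. For fixed i, raising the integer by 1 shifts the point by 1/N up
  -- to jitter, so each i yields a perturbed lattice of mesh 1/N. Its jitter is (1 + ρ)σ ≤ ρ in
  -- units of 1/N: σ from rounding in `m` and ρσ from g.
  set idx : ℕ → ℤ × ℕ := fun k => (k - m (P k), (P k - P0).toNat) with hidx
  have hp : ∀ k, P0 + ((P k - P0).toNat : ℤ) = P k := by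
    intro k
    have := hmono k
    omega
  have hxi : ∀ k : ℕ, (((k : ℤ) - m (P k) : ℤ) : ℝ) * σ ≤ x k - P k ∧
      x k - P k ≤ (((k : ℤ) - m (P k) : ℤ) + 1 : ℝ) * σ := by
    intro k
    have := hmP (P k)
    push_cast
    simp only [hx]
    constructor <;> nlinarith
  set pt : ℤ → ℕ → ℝ := fun i p =>
    -- Index pairs not coming from any k receive the left end of their interval.
    if h : ∃ k < N', (k : ℤ) = m (P0 + p) + i ∧ P k = P0 + p then g h.choose
    else (P0 - θ + i * σ) / N + p / N with hpt
  have hptk : ∀ k < N', pt (k - m (P k)) (P k - P0).toNat = g k := by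
    intro k hk
    have hex : ∃ k' < N', (k' : ℤ) = m (P0 + ((P k - P0).toNat : ℤ)) + (k - m (P k)) ∧
        P k' = P0 + ((P k - P0).toNat : ℤ) := by
      rw [hp k]
      exact ⟨k, hk, by omega, rfl⟩
    have hspec := hex.choose_spec.2.1.trans
      (show m (P0 + ((P k - P0).toNat : ℤ)) + (k - m (P k)) = (k : ℤ) by rw [hp k]; ring)
    simp only [hpt]
    rw [dif_pos hex]
    congr 1
    exact_mod_cast hspec
  have hwin : ∀ (i : ℤ) (p : ℕ), (P0 - θ + i * σ) / N + p / N ≤ pt i p ∧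
      pt i p ≤ (P0 - θ + i * σ) / N + (p + ρ) / N := by
    intro i p
    by_cases hex : ∃ k < N', (k : ℤ) = m (P0 + p) + i ∧ P k = P0 + p
    · simp only [hpt]
      rw [dif_pos hex]
      obtain ⟨hk, hk2, hk3⟩ := hex.choose_spec
      set k := hex.choose
      have h1 := hxi k
      rw [hk3] at h1
      have h2 : ((k : ℤ) - m (P0 + p) : ℤ) = i := by omega
      rw [h2] at h1
      obtain ⟨g1, g2⟩ := hg k hk
      have e1 : (k : ℝ) / N' = k * σ / N := by rw [hσ]; field_simp
      have e2 : ((k : ℝ) + ρ) / N' = (k + ρ) * σ / N := by rw [hσ]; field_simp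
      rw [e1] at g1
      rw [e2] at g2
      simp only [hx] at h1
      push_cast at h1
      rw [← add_div, ← add_div]
      constructor
      · rw [div_le_iff₀ hNr]
        have : (t + k * σ / N) * N ≤ g k * N := by gcongr
        have e3 : (t + k * σ / N) * N = t * N + k * σ := by field_simp
        linarith [h1.1]
      · rw [le_div_iff₀ hNr]
        have : g k * N ≤ (t + (k + ρ) * σ / N) * N := by gcongr
        have e3 : (t + (k + ρ) * σ / N) * N = t * N + (k + ρ) * σ := by field_simp
        nlinarith [h1.2]
    · simp only [hpt]
      rw [dif_neg hex]
      refine ⟨le_rfl, ?_⟩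
      gcongr
      linarith
  -- The arguments sweep an interval of length about N, so N + 1 nearest integers can occur; the
  -- surplus one is responsible for F.
  have hrow : ∀ i : ℤ, ∑ p ∈ Finset.range (N + 1), f (pt i p) ≤ B + F := by
    intro i
    rw [Finset.sum_range_succ]
    exact add_le_add (hB _ _ fun k _ => hwin i k) (hF _)
  have hinj : Set.InjOn idx (Finset.range N') := by
    intro k hk k' hk' heq
    simp only [hidx, Prod.mk.injEq] at heq
    have h1 := hp k
    have h2 := hp k'
    rw [heq.2, h2] at h1
    have h3 := heq.1
    rw [h1] at h3
    omega
  calc ∑ k ∈ Finset.range N', w (θ + g k * N) * f (g k)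
      ≤ ∑ k ∈ Finset.range N', W (idx k).1 * f (pt (idx k).1 (idx k).2) := by
        apply Finset.sum_le_sum
        intro k hk
        have hk' := Finset.mem_range.mp hk
        simp only [hidx]
        rw [hptk k hk']
        gcongr
        · exact hf _
        · obtain ⟨g1, g2⟩ := hg k hk'
          apply hW _ (P k) (x k) _ (hPk k).1 (hPk k).2 (hxi k).1 (hxi k).2
          · simp only [hx]
            have : (t + (k : ℝ) / N') * N ≤ g k * N := by gcongr
            have e3 : (t + (k : ℝ) / N') * N = t * N + k * σ := by rw [hσ]; field_simp
            linarith
          · simp only [hx]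
            have : g k * N ≤ (t + ((k : ℝ) + ρ) / N') * N := by gcongr
            have e3 : (t + ((k : ℝ) + ρ) / N') * N = t * N + (k + ρ) * σ := by
              rw [hσ]; field_simp
            linarith
    _ = ∑ ip ∈ (Finset.range N').image idx, W ip.1 * f (pt ip.1 ip.2) := by
        rw [Finset.sum_image hinj]
    _ ≤ ∑ ip ∈ Finset.Ico (-(J : ℤ)) J ×ˢ Finset.range (N + 1), W ip.1 * f (pt ip.1 ip.2) := by
        apply Finset.sum_le_sum_of_subset_of_nonneg
        · intro ip hip
          obtain ⟨k, hk, rfl⟩ := Finset.mem_image.mp hip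
          have hk' := Finset.mem_range.mp hk
          have h1 := hxi k
          have h2 := hPk k
          simp only [hidx, Finset.mem_product, Finset.mem_Ico, Finset.mem_range]
          refine ⟨⟨?_, ?_⟩, ?_⟩
          · by_contra hlt
            push Not at hlt
            have h3 : (((k : ℤ) - m (P k) : ℤ) : ℝ) + 1 ≤ -J := by exact_mod_cast hlt
            nlinarith
          · by_contra hlt
            push Not at hlt
            have h3 : (J : ℝ) ≤ (((k : ℤ) - m (P k) : ℤ) : ℝ) := by exact_mod_cast hlt
            nlinarith
          · have := hPN k hk'
            omega
        · intro ip hip _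
          exact mul_nonneg (hW0 _ (Finset.mem_product.mp hip).1) (hf _)
    _ = ∑ i ∈ Finset.Ico (-(J : ℤ)) J, W i * ∑ p ∈ Finset.range (N + 1), f (pt i p) := by
        rw [Finset.sum_product]
        simp only [Finset.mul_sum]
    _ ≤ ∑ i ∈ Finset.Ico (-(J : ℤ)) J, W i * (B + F) := by
        apply Finset.sum_le_sum
        intro i hi
        exact mul_le_mul_of_nonneg_left (hrow i) (hW0 i hi)
    _ = _ := by rw [Finset.sum_mul]


/-! ### Lower bounds for m_G and comparison with the weights -/

theorem abs_sin_div_sin_le (n : ℕ) (y : ℝ) :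
    |Real.sin (Real.pi * n * y) / Real.sin (Real.pi * y)| ≤ n := by
  by_cases h : Real.sin (Real.pi * y) = 0
  · rw [h]; simp
  · rw [← norm_geomExp_eq_div n y h]
    exact norm_geomExp_le n y

theorem bddAbove_mGjb (a : ℕ → ℕ) (j b : ℕ) :
    BddAbove (Set.range fun y : Set.Ioo ((b : ℝ) / a 1) (((b : ℝ) + 1) / a 1) =>
      |Real.sin (Real.pi * a j * (y : ℝ)) / Real.sin (Real.pi * (y : ℝ))|) :=
  ⟨a j, by rintro _ ⟨y, rfl⟩; exact abs_sin_div_sin_le _ _⟩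

theorem le_mGjb (a : ℕ → ℕ) (j b : ℕ) (y : ℝ) (h1 : (b : ℝ) / a 1 < y)
    (h2 : y < ((b : ℝ) + 1) / a 1) :
    |Real.sin (Real.pi * a j * y) / Real.sin (Real.pi * y)| ≤ mGjb a j b :=
  le_ciSup (bddAbove_mGjb a j b) ⟨y, h1, h2⟩

theorem mGjb_nonneg (a : ℕ → ℕ) (j b : ℕ) : 0 ≤ mGjb a j b :=
  Real.iSup_nonneg fun _ => abs_nonneg _

theorem mGj_nonneg (a : ℕ → ℕ) (j : ℕ) : 0 ≤ mGj a j :=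
  mul_nonneg (by positivity) (Finset.sum_nonneg fun _ _ => mGjb_nonneg _ _ _)

theorem mG_nonneg (d : ℕ) (a : ℕ → ℕ) : 0 ≤ mG d a :=
  Real.iSup_nonneg fun _ => mGj_nonneg _ _

theorem mGjb_le (a : ℕ → ℕ) (j b : ℕ) (B : ℝ) (hB : 0 ≤ B)
    (h : ∀ y, (b : ℝ) / a 1 < y → y < ((b : ℝ) + 1) / a 1 →
      |Real.sin (Real.pi * a j * y) / Real.sin (Real.pi * y)| ≤ B) : mGjb a j b ≤ B :=
  Real.iSup_le (fun y => h y y.2.1 y.2.2) hB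

theorem mGj_one_le_mG (d : ℕ) (a : ℕ → ℕ) (hd : 1 ≤ d) (ha : 0 < a 1) : mGj a 1 ≤ mG d a := by
  have hfin : Finite {j : ℕ // 1 ≤ j ∧ j ≤ d ∧ a j ≠ 0} :=
    Set.Finite.to_subtype ((Set.finite_Iic d).subset fun j hj => hj.2.1)
  exact le_ciSup (f := fun j : {j : ℕ // 1 ≤ j ∧ j ≤ d ∧ a j ≠ 0} => mGj a j)
    (Set.finite_range _).bddAbove ⟨1, le_rfl, hd, ha.ne'⟩

/-- The reflected value of a lower bound for `mGjb`. -/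
theorem le_mGjb_reflect (a : ℕ → ℕ) (b : ℕ) (hb : b < a 1) (y : ℝ) (h1 : (b : ℝ) / a 1 < y)
    (h2 : y < ((b : ℝ) + 1) / a 1) :
    |Real.sin (Real.pi * a 1 * y) / Real.sin (Real.pi * y)| ≤ mGjb a 1 (a 1 - 1 - b) := by
  have ha : (0 : ℝ) < a 1 := by exact_mod_cast (by omega : 0 < a 1)
  have hcast : ((a 1 - 1 - b : ℕ) : ℝ) = a 1 - 1 - b := by
    rw [Nat.cast_sub (by omega), Nat.cast_sub (by omega)]
    simp
  have key := le_mGjb a 1 (a 1 - 1 - b) (1 - y) (by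
    rw [hcast, div_lt_iff₀ ha]; rw [lt_div_iff₀ ha] at h2; nlinarith) (by
    rw [hcast, lt_div_iff₀ ha]; rw [div_lt_iff₀ ha] at h1; nlinarith)
  have e1 : Real.pi * (1 - y) = Real.pi - Real.pi * y := by ring
  have e2 : Real.pi * a 1 * (1 - y) = (a 1 : ℕ) * Real.pi - Real.pi * a 1 * y := by ring
  rw [e1, e2, Real.sin_pi_sub, Real.sin_nat_mul_pi_sub, abs_div, abs_neg, abs_mul, abs_pow,
    abs_neg, abs_one, one_pow, one_mul, ← abs_div] at key
  exact key

/-- Lower bound for the contribution of `0 ≤ b < a₁ / 2` to `m_G(1)`. -/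
noncomputable def mGLower (a : ℕ) : ℝ :=
  0.95 * a + ∑ b ∈ Finset.range (a / 2 - 1), 1 / Real.sin (Real.pi * ((b + 3 / 2) / a))

/-- For b ≥ 1 the supremum is tested at the midpoint of its interval, where |sin(π a_1 y)| = 1, and
for b = 0 at a point near 0. The symmetry y ↦ 1 - y supplies the second half. -/
theorem two_mul_mGLower_le (a : ℕ → ℕ) (ha : 2 ≤ a 1) :
    2 * mGLower (a 1) ≤ a 1 * mGj a 1 := by
  have ha0 : (0 : ℝ) < a 1 := by exact_mod_cast (by omega : 0 < a 1)
  have hπ := Real.pi_pos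
  have hpi2 : Real.pi < 3.15 := Real.pi_lt_d2
  rw [mGj, ← mul_assoc, mul_one_div_cancel ha0.ne', one_mul]
  set n := a 1 with hn
  set h := n / 2
  have hhn : 2 * h ≤ n := Nat.mul_div_le n 2
  have hh : 1 ≤ h := by omega
  -- points at which the ratio of sines is evaluated
  have hpt : ∀ b, b < h → ∃ y : ℝ, (b : ℝ) / n < y ∧ y < ((b : ℝ) + 1) / n ∧
      (if b = 0 then 0.95 * (n : ℝ) else 1 / Real.sin (Real.pi * ((b + 1 / 2) / n))) ≤
      |Real.sin (Real.pi * n * y) / Real.sin (Real.pi * y)| := by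
    intro b hb
    split_ifs with hb0
    · subst hb0
      -- Here the numerator is sin(π/6) = 1/2, so the ratio is at least 3n/π, and 3/π > 0.95.
      refine ⟨1 / (6 * n), by simp; omega, ?_, ?_⟩
      · rw [div_lt_div_iff₀ (by positivity) (by positivity)]
        push_cast
        linarith
      · have e1 : Real.pi * n * (1 / (6 * n)) = Real.pi / 6 := by field_simp
        have e2 : Real.pi * (1 / (6 * n)) = Real.pi / (6 * n) := by ring
        have hn1 : (1 : ℝ) ≤ n := by exact_mod_cast (by omega : 1 ≤ n)
        have hpos : 0 < Real.pi / (6 * n) := by positivity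
        have hlt : Real.pi / (6 * n) < Real.pi := by
          apply div_lt_self hπ
          linarith
        have hs : 0 < Real.sin (Real.pi / (6 * n)) := Real.sin_pos_of_pos_of_lt_pi hpos hlt
        rw [e1, e2, Real.sin_pi_div_six, abs_of_nonneg (by positivity), le_div_iff₀ hs]
        calc 0.95 * (n : ℝ) * Real.sin (Real.pi / (6 * n))
            ≤ 0.95 * (n : ℝ) * (Real.pi / (6 * n)) := by
              gcongr
              exact (Real.sin_lt hpos).le
          _ = 0.95 / 6 * Real.pi := by field_simp
          _ ≤ 1 / 2 := by linarith
    · refine ⟨(b + 1 / 2) / n, by gcongr; linarith, by gcongr; norm_num, ?_⟩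
      have e1 : Real.pi * n * ((b + 1 / 2) / n) = Real.pi / 2 + (b : ℕ) * Real.pi := by
        field_simp
        ring
      have hbn : ((b : ℝ) + 1 / 2) / n < 1 := by
        rw [div_lt_one ha0]
        have : (b : ℝ) + 1 ≤ n := by exact_mod_cast (by omega : b + 1 ≤ n)
        linarith
      have hs : 0 < Real.sin (Real.pi * ((b + 1 / 2) / n)) := by
        apply Real.sin_pos_of_pos_of_lt_pi (by positivity)
        nlinarith
      rw [e1, Real.sin_add_nat_mul_pi, Real.sin_pi_div_two, abs_div, abs_of_pos hs, mul_one,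
        abs_pow, abs_neg, abs_one, one_pow]
  set v : ℕ → ℝ := fun b =>
    if b = 0 then 0.95 * (n : ℝ) else 1 / Real.sin (Real.pi * ((b + 1 / 2) / n)) with hv
  have hlow : ∀ b ∈ Finset.range h, v b ≤ mGjb a 1 b := by
    intro b hb
    obtain ⟨y, h1, h2, h3⟩ := hpt b (Finset.mem_range.mp hb)
    exact h3.trans (le_mGjb a 1 b y h1 h2)
  have hlow' : ∀ b ∈ Finset.range h, v b ≤ mGjb a 1 (n - 1 - b) := by
    intro b hb
    have hb' := Finset.mem_range.mp hb
    obtain ⟨y, h1, h2, h3⟩ := hpt b hb'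
    exact h3.trans (le_mGjb_reflect a b (by omega) y h1 h2)
  have hvsum : ∑ b ∈ Finset.range h, v b = mGLower n := by
    rw [mGLower, show h = (n / 2 - 1) + 1 by omega, Finset.sum_range_succ', add_comm]
    congr 1
    apply Finset.sum_congr rfl
    intro b _
    simp only [hv]
    rw [if_neg (by omega)]
    push_cast
    ring_nf
  have hsplit : ∑ b ∈ Finset.range h, mGjb a 1 b +
      ∑ b ∈ Finset.range h, mGjb a 1 (n - 1 - b) ≤ ∑ b ∈ Finset.range n, mGjb a 1 b := by
    rw [← Finset.sum_range_reflect (fun b => mGjb a 1 (n - 1 - b)),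
      show ∑ j ∈ Finset.range h, mGjb a 1 (n - 1 - (h - 1 - j)) =
        ∑ j ∈ Finset.range h, mGjb a 1 (n - h + j) from by
        apply Finset.sum_congr rfl
        intro j hj
        have := Finset.mem_range.mp hj
        congr 1
        omega]
    -- For odd n the middle index belongs to neither half and is dropped.
    have hle : ∑ b ∈ Finset.range h, mGjb a 1 b ≤ ∑ b ∈ Finset.range (n - h), mGjb a 1 b :=
      Finset.sum_le_sum_of_subset_of_nonneg (Finset.range_mono (by omega))
        (fun _ _ _ => mGjb_nonneg _ _ _)
    have hadd := Finset.sum_range_add (fun b => mGjb a 1 b) (n - h) h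
    rw [show n - h + h = n by omega] at hadd
    linarith
  have h1 := Finset.sum_le_sum hlow
  have h2 := Finset.sum_le_sum hlow'
  rw [hvsum] at h1 h2
  linarith

theorem one_le_inv_sin {y : ℝ} (h1 : 0 < y) (h2 : y < 1) : 1 ≤ 1 / Real.sin (Real.pi * y) := by
  have hs : 0 < Real.sin (Real.pi * y) := by
    apply Real.sin_pos_of_pos_of_lt_pi
    · have := Real.pi_pos; positivity
    · nlinarith [Real.pi_pos]
  rw [le_div_iff₀ hs, one_mul]
  exact Real.sin_le_one _

theorem mGLower_ge (a : ℕ) (ha : 2 ≤ a) : 1.45 * (a : ℝ) - 3 / 2 ≤ mGLower a := by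
  have ha0 : (0 : ℝ) < a := by exact_mod_cast (by omega : 0 < a)
  have h1 : ((a / 2 - 1 : ℕ) : ℝ) ≤
      ∑ b ∈ Finset.range (a / 2 - 1), 1 / Real.sin (Real.pi * (((b : ℝ) + 3 / 2) / a)) := by
    have : ∑ b ∈ Finset.range (a / 2 - 1), (1 : ℝ) = ((a / 2 - 1 : ℕ) : ℝ) := by simp
    rw [← this]
    apply Finset.sum_le_sum
    intro b hb
    have hb' := Finset.mem_range.mp hb
    apply one_le_inv_sin (by positivity)
    rw [div_lt_one ha0]
    have : (b : ℝ) + 2 ≤ a := by exact_mod_cast (by omega : b + 2 ≤ a)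
    linarith
  have h2 : (a : ℝ) ≤ 2 * ((a / 2 - 1 : ℕ) : ℝ) + 3 := by
    exact_mod_cast (by omega : a ≤ 2 * (a / 2 - 1) + 3)
  rw [mGLower]
  linarith

/-- The weights of the sample points near an integer, on one side of it. -/
theorem sum_weights_le (a : ℕ) (ha : 30 ≤ a) (τ : ℝ) (hτ1 : 1 / (a + 2 : ℝ) ≤ τ)
    (J : ℕ) (hJ : ∀ I < J, I * τ ≤ 1 / 2) :
    ∑ I ∈ Finset.range J, (if I = 0 then (a : ℝ)
      else 1 / Real.sin (Real.pi * ((I - 2 / a) * τ))) ≤ a + mGLower a := by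
  have ha0 : (30 : ℝ) ≤ a := by exact_mod_cast ha
  have hapos : (0 : ℝ) < a := by linarith
  have hπ := Real.pi_pos
  have hτ0 : 0 < τ := lt_of_lt_of_le (by positivity) hτ1
  have hρ : 2 / (a : ℝ) ≤ 1 / 15 := by rw [div_le_div_iff₀ hapos (by norm_num)]; linarith
  have hρ0 : 0 < 2 / (a : ℝ) := by positivity
  -- Three ranges: the trivial bound at I = 0, Jordan's inequality for I = 1, 2, and for I ≥ 3 a
  -- comparison with the midpoints (I - 3/2)/a, which are the terms of `mGLower`.
  set U : ℕ → ℝ := fun I => if I = 0 then (a : ℝ) else if I < 3 then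
      (a + 2) / (2 * (I - 1 / 15)) else 1 / Real.sin (Real.pi * ((I - 3 / 2) / a)) with hU
  have hJ2 : J ≤ a / 2 - 1 + 3 := by
    by_contra hlt
    push Not at hlt
    have h1 := hJ (a / 2 - 1 + 3) hlt
    have h2 : ((a : ℝ) + 3) / 2 ≤ ((a / 2 - 1 + 3 : ℕ) : ℝ) := by
      rw [div_le_iff₀ (by norm_num)]
      exact_mod_cast (by omega : a + 3 ≤ (a / 2 - 1 + 3) * 2)
    have h3 : ((a : ℝ) + 3) / 2 * (1 / (a + 2)) ≤ ((a / 2 - 1 + 3 : ℕ) : ℝ) * τ := by gcongr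
    have h4 : (1 : ℝ) / 2 < (a + 3) / 2 * (1 / (a + 2)) := by
      rw [div_mul_div_comm, div_lt_div_iff₀ (by norm_num) (by positivity)]
      linarith
    linarith
  have hterm : ∀ I ∈ Finset.range J, (if I = 0 then (a : ℝ)
      else 1 / Real.sin (Real.pi * ((I - 2 / a) * τ))) ≤ U I := by
    intro I hI
    have hIJ := hJ I (Finset.mem_range.mp hI)
    simp only [hU]
    split_ifs with h0 h3
    · exact le_rfl
    · have hI1 : (1 : ℝ) ≤ I := by exact_mod_cast (by omega : 1 ≤ I)
      have hle : ((I : ℝ) - 2 / a) * τ ≤ 1 / 2 := by nlinarith [mul_pos hρ0 hτ0]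
      have hjor := Real.mul_le_sin (x := Real.pi * ((I - 2 / a) * τ))
        (mul_nonneg hπ.le (mul_nonneg (by linarith) hτ0.le)) (by nlinarith)
      have e : 2 / Real.pi * (Real.pi * ((I - 2 / a) * τ)) = 2 * ((I - 2 / a) * τ) := by
        field_simp
      rw [e] at hjor
      have hlow : 2 * (I - 1 / 15) / (a + 2) ≤ 2 * ((I - 2 / (a : ℝ)) * τ) := by
        have : ((I : ℝ) - 1 / 15) * (1 / (a + 2)) ≤ (I - 2 / (a : ℝ)) * τ := by
          apply mul_le_mul (by linarith) hτ1 (by positivity) (by linarith)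
        rw [mul_div_assoc, div_eq_mul_one_div ((I : ℝ) - 1 / 15)]
        linarith
      have hpos : 0 < 2 * ((I : ℝ) - 1 / 15) / (a + 2) := by
        apply div_pos <;> linarith
      have := one_div_le_one_div_of_le hpos (hlow.trans hjor)
      rwa [one_div_div] at this
    · have hI3 : (3 : ℝ) ≤ I := by exact_mod_cast (by omega : 3 ≤ I)
      have hIa : 2 * (I : ℝ) ≤ a + 2 := by
        have h5 : (I : ℝ) * (1 / (a + 2)) ≤ I * τ := by gcongr
        have h6 : (I : ℝ) * (1 / (a + 2)) ≤ 1 / 2 := h5.trans hIJ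
        rw [mul_one_div, div_le_div_iff₀ (by positivity) (by norm_num)] at h6
        linarith
      have h4 : ((I : ℝ) - 3 / 2) / a ≤ (I - 2 / a) * τ := by
        have h5 : ((I : ℝ) - 2 / a) * (1 / (a + 2)) ≤ (I - 2 / a) * τ := by
          apply mul_le_mul_of_nonneg_left hτ1
          linarith
        refine le_trans ?_ h5
        rw [mul_one_div, div_le_div_iff₀ hapos (by positivity)]
        have : ((I : ℝ) - 2 / a) * a = I * a - 2 := by field_simp
        rw [this]
        nlinarith
      have hpos : 0 < ((I : ℝ) - 3 / 2) / a := by apply div_pos <;> linarith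
      have hle : ((I : ℝ) - 2 / a) * τ ≤ 1 / 2 := by nlinarith
      apply one_div_le_one_div_of_le
      · apply Real.sin_pos_of_pos_of_lt_pi (by positivity)
        nlinarith
      · apply Real.sin_le_sin_of_le_of_le_pi_div_two
        · nlinarith
        · nlinarith
        · gcongr
  have hUnn : ∀ I ∈ Finset.range (a / 2 - 1 + 3), 0 ≤ U I := by
    intro I hI
    have hI' := Finset.mem_range.mp hI
    simp only [hU]
    split_ifs with h0 h3
    · linarith
    · have hI1 : (1 : ℝ) ≤ I := by exact_mod_cast (by omega : 1 ≤ I)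
      apply div_nonneg <;> linarith
    · have hI3 : (3 : ℝ) ≤ I := by exact_mod_cast (by omega : 3 ≤ I)
      apply le_trans zero_le_one
      apply one_le_inv_sin
      · apply div_pos <;> linarith
      · rw [div_lt_one hapos]
        have : (I : ℝ) < a / 2 - 1 + 3 := by
          have h5 : 2 * I ≤ a + 2 := by omega
          have h6 : 2 * (I : ℝ) ≤ a + 2 := by exact_mod_cast h5
          have h7 : 2 * I < a - 2 + 6 := by omega
          have h8 : 2 * I + 2 ≤ a + 4 := by omega
          have h9 : 2 * (I : ℝ) + 2 ≤ a + 4 := by exact_mod_cast h8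
          linarith
        linarith
  calc _ ≤ ∑ I ∈ Finset.range J, U I := Finset.sum_le_sum hterm
    _ ≤ ∑ I ∈ Finset.range (a / 2 - 1 + 3), U I :=
        Finset.sum_le_sum_of_subset_of_nonneg (Finset.range_mono hJ2)
          (fun I hI _ => hUnn I hI)
    _ = ∑ b ∈ Finset.range (a / 2 - 1), 1 / Real.sin (Real.pi * ((b + 3 / 2) / a)) +
          (a + 2) / (2 * (2 - 1 / 15)) + (a + 2) / (2 * (1 - 1 / 15)) + a := by
        rw [Finset.sum_range_succ', Finset.sum_range_succ', Finset.sum_range_succ']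
        simp only [hU]
        norm_num
        apply Finset.sum_congr rfl
        intro b _
        rw [if_neg (by omega)]
        ring_nf
    -- The terms I = 1, 2 total less than 0.8 (a + 2), which fits into the 0.95 a that `mGLower`
    -- reserves for b = 0.
    _ ≤ _ := by
        rw [mGLower]
        norm_num
        linarith


/-! ### The average bound with exponent log_α(m_G + 3) -/

theorem sum_Ico_neg_eq (W : ℤ → ℝ) (J : ℕ) :
    ∑ i ∈ Finset.Ico (-(J : ℤ)) J, W i = ∑ i ∈ Finset.range J, (W i + W (-1 - i)) := by
  induction J with
  | zero => simp
  | succ J ih =>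
    have h1 : Finset.Ico (-((J + 1 : ℕ) : ℤ)) ((J + 1 : ℕ) : ℤ) =
        insert (-1 - (J : ℤ)) (insert (J : ℤ) (Finset.Ico (-(J : ℤ)) J)) := by
      ext i
      simp only [Finset.mem_Ico, Finset.mem_insert]
      push_cast
      omega
    rw [h1, Finset.sum_insert (by simp), Finset.sum_insert (by simp), ih,
      Finset.sum_range_succ]
    ring

namespace IsLinearRecurrenceBase

variable {G : ℕ → ℕ} {d : ℕ} {a : ℕ → ℕ}

/-- One term of the recurrence under `jitter_decouple`. As a_j ≤ a_1, the same weights min(a_1,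
1/|sin|) serve every j and are compared with m_G(1). The summand 2 in m_G + 2 comes from the cells
on both sides of an integer, where only the bound a_1 is available; the 1 in l + 1 is the surplus
point of each row. -/
theorem jitter_step (h : IsLinearRecurrenceBase G d a) (θ : ℝ) (ha : 30 ≤ a 1) {n j : ℕ}
    (hn : d ≤ n) (hj1 : 1 ≤ j) (hjd : j ≤ d) {l : ℝ} (hl : 0 ≤ l + 1)
    (hB : JitterBound (fun β => ‖expSum G θ β (G (n - j))‖) (2 / a 1) (G (n - j))
      (G (n - j) * l))
    (t : ℝ) (g : ℕ → ℝ)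
    (hg : ∀ k < G n, t + k / G n ≤ g k ∧ g k ≤ t + (k + 2 / (a 1 : ℝ)) / G n) :
    ∑ k ∈ Finset.range (G n), ‖geomExp (a j) (θ + g k * G (n - j))‖ *
      ‖expSum G θ (g k) (G (n - j))‖ ≤ G n * ((mG d a + 2) * (l + 1)) := by
  have hNpos : 0 < G (n - j) := h.pos _
  have hN'pos : 0 < G n := h.pos _
  have ha30 : (30 : ℝ) ≤ a 1 := by exact_mod_cast ha
  have ha0 : (0 : ℝ) < a 1 := by linarith
  have hN0 : (0 : ℝ) < G (n - j) := by exact_mod_cast hNpos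
  have hN0' : (0 : ℝ) < G n := by exact_mod_cast hN'pos
  have hratio : (a 1 : ℝ) * G (n - j) ≤ G n := by
    have h1 := h.mul_le_succ (n := n) (by omega)
    have h2 : G (n - j) ≤ G (n - 1) := h.strictMono.monotone (by omega)
    exact_mod_cast (Nat.mul_le_mul_left _ h2).trans h1
  set σ : ℝ := (G (n - j) : ℝ) / G n with hσ
  have hσ0 : 0 < σ := by positivity
  have haσ : a 1 * σ ≤ 1 := by
    rw [hσ, ← mul_div_assoc, div_le_one hN0']
    exact hratio
  -- For j > 1 the step σ is much smaller than 1/a_1. Grouping q steps makes cells of length τ = qσ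
  -- close to 1/a_1, the scale of m_G, and q a_1 σ ≤ 1 normalises the final sum.
  set q : ℕ := ⌊1 / (a 1 * σ)⌋₊ with hq
  have hq1 : 1 ≤ q := by
    rw [hq, Nat.one_le_floor_iff, le_div_iff₀ (by positivity)]
    linarith
  have hqa : (q : ℝ) * (a 1 * σ) ≤ 1 := by
    have := Nat.floor_le (show 0 ≤ 1 / (a 1 * σ) by positivity)
    rwa [le_div_iff₀ (by positivity)] at this
  have hq2 : 1 < ((q : ℝ) + 1) * (a 1 * σ) := by
    have := Nat.lt_floor_add_one (1 / (a 1 * σ))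
    rwa [div_lt_iff₀ (by positivity)] at this
  have hq1' : (1 : ℝ) ≤ q := by exact_mod_cast hq1
  set τ : ℝ := q * σ with hτ
  have hστ : σ ≤ τ := by rw [hτ]; nlinarith
  have hτ0 : 0 < τ := by linarith
  have hτ1 : 1 / ((a 1 : ℝ) + 2) ≤ τ := by
    rw [div_le_iff₀ (by positivity)]
    -- For j = 1, q ≥ 1 and G_n ≤ (a_1 + 1) G_{n-1} suffice. For j ≥ 2, σ ≤ 1/a_1², so rounding down
    -- to q costs at most 1/a_1 in a_1 τ.
    rcases hj1.eq_or_lt with hj | hj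
    · have h1 := h.succ_le_mul hn
      subst hj
      have h2 : (G n : ℝ) ≤ (a 1 + 1) * G (n - 1) := by exact_mod_cast h1
      have h3 : 1 ≤ ((a 1 : ℝ) + 1) * σ := by
        rw [hσ, ← mul_div_assoc, le_div_iff₀ hN0', one_mul]
        exact h2
      nlinarith
    · have h1 := h.mul_le_succ (n := n) (by omega)
      have h2 := h.mul_le_succ (n := n - 1) (by omega)
      have h3 : G (n - j) ≤ G (n - 1 - 1) := h.strictMono.monotone (by omega)
      have h4 : a 1 * (a 1 * G (n - j)) ≤ G n :=
        (Nat.mul_le_mul_left _ ((Nat.mul_le_mul_left _ h3).trans h2)).trans h1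
      have h5 : (a 1 : ℝ) * (a 1 * G (n - j)) ≤ G n := by exact_mod_cast h4
      have h6 : (a 1 : ℝ) * (a 1 * σ) ≤ 1 := by
        rw [hσ, ← mul_div_assoc, ← mul_div_assoc, div_le_one hN0']
        exact h5
      have h7 : (1 : ℝ) - 1 / a 1 ≤ a 1 * τ := by
        have : (a 1 : ℝ) * σ ≤ 1 / a 1 := by
          rw [le_div_iff₀ ha0]; linarith
        rw [hτ]
        linarith
      have h8 : (1 - 1 / (a 1 : ℝ)) * (1 + 2 / a 1) ≤ τ * (a 1 + 2) := by
        have : τ * (a 1 + 2) = a 1 * τ * (1 + 2 / a 1) := by field_simp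
        rw [this]
        gcongr
      refine le_trans ?_ h8
      have h9 : 1 / (a 1 : ℝ) ≤ 1 / 2 := by
        rw [div_le_div_iff₀ ha0 (by norm_num)]; linarith
      have h10 : 0 < 1 / (a 1 : ℝ) := by positivity
      have h11 : 2 / (a 1 : ℝ) = 2 * (1 / a 1) := by ring
      rw [h11]
      nlinarith
  set J' : ℕ := ⌊1 / (2 * τ)⌋₊ + 1 with hJ'
  have hJ1 : 1 / 2 < J' * τ := by
    have := Nat.lt_floor_add_one (1 / (2 * τ))
    rw [div_lt_iff₀ (by positivity)] at this
    rw [hJ']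
    push_cast
    linarith
  have hJ2 : ∀ I < J', (I : ℝ) * τ ≤ 1 / 2 := by
    intro I hI
    have h1 : I ≤ ⌊1 / (2 * τ)⌋₊ := by omega
    have h2 : (I : ℝ) ≤ 1 / (2 * τ) :=
      (Nat.cast_le.mpr h1).trans (Nat.floor_le (by positivity))
    rw [le_div_iff₀ (by positivity)] at h2
    linarith
  have hρ : 2 / (a 1 : ℝ) ≤ 1 / 15 := by
    rw [div_le_div_iff₀ ha0 (by norm_num)]; linarith
  have hρ0 : 0 < 2 / (a 1 : ℝ) := by positivity
  set V : ℕ → ℝ := fun I => if I = 0 then (a 1 : ℝ)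
      else 1 / Real.sin (Real.pi * ((I - 2 / a 1) * τ)) with hV
  -- The step [iσ, (i + 1)σ] with i < 0 mirrors the one with index -1 - i. On the left of an integer
  -- the jitter moves points towards it, hence I - 2/a_1 in V.
  set W : ℤ → ℝ := fun i => if 0 ≤ i then V (i.toNat / q) else V ((-1 - i).toNat / q) with hW
  have hbj : (a j : ℝ) ≤ a 1 := by exact_mod_cast h.coeff_le hj1 hjd
  have hWbound : ∀ (I : ℕ) (P : ℤ) (y : ℝ), (1 ≤ I → (I - 2 / (a 1 : ℝ)) * τ ≤ |y - P| ∧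
      |y - P| ≤ 1 - (I - 2 / (a 1 : ℝ)) * τ) → ‖geomExp (a j) y‖ ≤ V I := by
    intro I P y hI
    simp only [hV]
    split_ifs with h0
    · exact (norm_geomExp_le _ _).trans hbj
    · have hI1 : (1 : ℝ) ≤ I := by exact_mod_cast (by omega : 1 ≤ I)
      obtain ⟨h1, h2⟩ := hI (by omega)
      exact norm_geomExp_le_of_dist _ y P _ (mul_pos (by linarith) hτ0) h1 h2
  have hVnn : ∀ I < J', 0 ≤ V I := by
    intro I hI
    simp only [hV]
    split_ifs with h0
    · exact ha0.le
    · have hI1 : (1 : ℝ) ≤ I := by exact_mod_cast (by omega : 1 ≤ I)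
      have := hJ2 I hI
      exact le_trans zero_le_one (one_le_inv_sin (mul_pos (by linarith) hτ0)
        (by nlinarith [mul_pos hρ0 hτ0]))
  have hdivq : ∀ i : ℕ, ((i / q : ℕ) : ℝ) * τ ≤ i * σ := by
    intro i
    have : ((i / q : ℕ) : ℝ) * q ≤ i := by exact_mod_cast Nat.div_mul_le_self i q
    rw [hτ, ← mul_assoc]
    gcongr
  have hW2 : ∀ (i P : ℤ) (x y : ℝ), -(1 / 2) ≤ x - P → x - P ≤ 1 / 2 → i * σ ≤ x - P →
      x - P ≤ (i + 1) * σ → x ≤ y → y ≤ x + 2 / a 1 * σ → ‖geomExp (a j) y‖ ≤ W i := by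
    intro i P x y h1 h2 h3 h4 h5 h6
    have hρτ : 2 / (a 1 : ℝ) * σ ≤ 2 / a 1 * τ := by gcongr
    simp only [hW]
    split_ifs with hi
    · apply hWbound _ P y
      intro hI
      have h7 := hdivq i.toNat
      have h8 : ((i.toNat : ℕ) : ℝ) = i := by exact_mod_cast Int.toNat_of_nonneg hi
      rw [h8] at h7
      have hI1 : (1 : ℝ) ≤ ((i.toNat / q : ℕ) : ℝ) := by exact_mod_cast hI
      set I : ℝ := ((i.toNat / q : ℕ) : ℝ)
      have h9 : 0 < I * τ := by positivity
      rw [abs_of_nonneg (by linarith), sub_mul]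
      have := mul_pos hρ0 hτ0
      constructor <;> linarith
    · apply hWbound _ P y
      intro hI
      have h7 := hdivq (-1 - i).toNat
      have h8 : (((-1 - i).toNat : ℕ) : ℝ) = -1 - i := by
        exact_mod_cast Int.toNat_of_nonneg (show 0 ≤ -1 - i by omega)
      rw [h8] at h7
      have hI1 : (1 : ℝ) ≤ (((-1 - i).toNat / q : ℕ) : ℝ) := by exact_mod_cast hI
      set I : ℝ := (((-1 - i).toNat / q : ℕ) : ℝ)
      have h9 : 1 * τ ≤ I * τ := by gcongr
      have h10 : 2 / (a 1 : ℝ) * τ ≤ 1 * τ := by gcongr; linarith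
      have := mul_pos hρ0 hτ0
      rw [abs_of_nonpos (by linarith), sub_mul]
      constructor <;> linarith
  have hWnn : ∀ i ∈ Finset.Ico (-((J' * q : ℕ) : ℤ)) ((J' * q : ℕ) : ℤ), 0 ≤ W i := by
    intro i hi
    rw [Finset.mem_Ico] at hi
    simp only [hW]
    split_ifs with h0
    · apply hVnn
      rw [Nat.div_lt_iff_lt_mul (by omega)]
      omega
    · apply hVnn
      rw [Nat.div_lt_iff_lt_mul (by omega)]
      omega
  have hmain := jitter_decouple (fun β => ‖expSum G θ β (G (n - j))‖)
    (fun y => ‖geomExp (a j) y‖) (fun _ => norm_nonneg _) (ρ := 2 / a 1) (θ := θ)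
    (F := G (n - j)) (σ := σ) (J := J' * q) W hNpos hN'pos hσ hρ0.le (by
      have h1 : σ ≤ 1 / a 1 := by rw [le_div_iff₀ ha0]; linarith
      calc (1 + 2 / (a 1 : ℝ)) * σ ≤ 2 * (1 / a 1) := by
            apply mul_le_mul (by linarith) h1 hσ0.le (by norm_num)
        _ = 2 / a 1 := by ring) (by push_cast; rw [mul_assoc]; exact hJ1) hB
    (fun β => norm_expSum_le G θ β _) hWnn hW2 t g hg
  refine hmain.trans ?_
  have hsumW : ∑ i ∈ Finset.Ico (-((J' * q : ℕ) : ℤ)) ((J' * q : ℕ) : ℤ), W i ≤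
      q * (a 1 * (mG d a + 2)) := by
    rw [sum_Ico_neg_eq]
    have h1 : ∀ i ∈ Finset.range (J' * q), W i + W (-1 - i) = 2 * V (i / q) := by
      intro i _
      simp only [hW]
      rw [if_pos (by omega), if_neg (by omega), show -1 - (-1 - (i : ℤ)) = i by ring]
      simp only [Int.toNat_natCast]
      ring
    rw [Finset.sum_congr rfl h1, ← Finset.mul_sum, sum_range_mul_eq]
    have h2 : ∀ k ∈ Finset.range J', ∑ u ∈ Finset.range q, V ((k * q + u) / q) = q * V k := by
      intro k _
      have : ∀ u ∈ Finset.range q, V ((k * q + u) / q) = V k := by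
        intro u hu
        rw [add_comm, Nat.add_mul_div_right _ _ (by omega),
          Nat.div_eq_of_lt (Finset.mem_range.mp hu), zero_add]
      rw [Finset.sum_congr rfl this]
      simp
    rw [Finset.sum_congr rfl h2, ← Finset.mul_sum]
    have h3 := sum_weights_le (a 1) ha τ hτ1 J' hJ2
    have h4 := two_mul_mGLower_le a (by omega)
    have h5 := mGj_one_le_mG d a h.one_le_d h.first_pos
    have h6 : (a 1 : ℝ) * mGj a 1 ≤ a 1 * mG d a := by gcongr
    have h7 : 2 * ∑ I ∈ Finset.range J', V I ≤ a 1 * (mG d a + 2) := by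
      simp only [hV]
      linarith
    calc 2 * ((q : ℝ) * ∑ I ∈ Finset.range J', V I) =
        q * (2 * ∑ I ∈ Finset.range J', V I) := by ring
      _ ≤ _ := by gcongr
  have hm := mG_nonneg d a
  have e1 : (G (n - j) : ℝ) = σ * G n := by rw [hσ]; field_simp
  calc _ ≤ q * (a 1 * (mG d a + 2)) * (G (n - j) * l + G (n - j)) := by
        gcongr
        have : 0 ≤ (G (n - j) : ℝ) * (l + 1) := by positivity
        linarith
    _ = q * (a 1 * σ) * (G n * ((mG d a + 2) * (l + 1))) := by rw [e1]; ring
    _ ≤ 1 * (G n * ((mG d a + 2) * (l + 1))) := by gcongr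
    _ = _ := one_mul _

/-- The normalised bounds l_n obey l_n ≤ (m_G + 2) ∑_j (l_{n-j} + 1). With M = m_G + 3 the geometric
series gives (M - 1) ∑_j M^(n-j) ≤ M^n, which explains the 3. The shift -2 absorbs the added units:
they turn it into -1 in each term, and (m_G + 2) d ≥ 2 restores it. -/
theorem exists_jitterBound (h : IsLinearRecurrenceBase G d a) (θ : ℝ) (ha : 30 ≤ a 1) :
    ∃ C : ℝ, 0 < C ∧ ∀ n, JitterBound (fun β => ‖expSum G θ β (G n)‖) (2 / a 1) (G n)
      (G n * (C * (mG d a + 3) ^ n - 2)) := by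
  have hm := mG_nonneg d a
  set M := mG d a + 3 with hM
  have hM1 : 1 ≤ M := by linarith
  have hMpow : ∀ n : ℕ, 1 ≤ M ^ n := fun n => one_le_pow₀ hM1
  refine ⟨G d + 2, by positivity, fun n => ?_⟩
  induction n using Nat.strong_induction_on with
  | _ n ih =>
    intro t g hg
    rcases lt_or_ge n d with hn | hn
    · have h1 : (G n : ℝ) ≤ G d := by exact_mod_cast h.strictMono.monotone hn.le
      calc ∑ k ∈ Finset.range (G n), ‖expSum G θ (g k) (G n)‖
          ≤ ∑ k ∈ Finset.range (G n), (G n : ℝ) :=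
            Finset.sum_le_sum fun k _ => norm_expSum_le _ _ _ _
        _ = G n * G n := by simp
        _ ≤ _ := by
          gcongr
          have := hMpow n
          nlinarith [(Nat.cast_nonneg (G d) : (0 : ℝ) ≤ G d)]
    · have hstep : ∀ j ∈ Finset.Icc 1 d, ∑ k ∈ Finset.range (G n),
          ‖geomExp (a j) (θ + g k * G (n - j))‖ * ‖expSum G θ (g k) (G (n - j))‖ ≤
          G n * ((mG d a + 2) * (((G d : ℝ) + 2) * M ^ (n - j) - 1)) := by
        intro j hj
        have hj' := Finset.mem_Icc.mp hj
        have hge : (1 : ℝ) ≤ ((G d : ℝ) + 2) * M ^ (n - j) := by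
          nlinarith [hMpow (n - j), (Nat.cast_nonneg (G d) : (0 : ℝ) ≤ G d)]
        have := h.jitter_step θ ha hn hj'.1 hj'.2 (l := ((G d : ℝ) + 2) * M ^ (n - j) - 2)
          (by linarith) (ih (n - j) (by omega)) t g hg
        refine this.trans (le_of_eq ?_)
        ring
      have hgeom : (mG d a + 2) * ∑ j ∈ Finset.Icc 1 d, M ^ (n - j) ≤ M ^ n := by
        have h1 : ∑ j ∈ Finset.Icc 1 d, M ^ (n - j) ≤ ∑ i ∈ Finset.range n, M ^ i := by
          rw [← Finset.sum_range_reflect, ← Finset.Ico_add_one_right_eq_Icc,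
            Finset.sum_Ico_eq_sum_range]
          refine le_trans (le_of_eq ?_) (Finset.sum_le_sum_of_subset_of_nonneg
            (Finset.range_mono (show d + 1 - 1 ≤ n by omega)) fun i _ _ => by positivity)
          apply Finset.sum_congr rfl
          intro i _
          congr 1
          omega
        have h2 := mul_geom_sum M n
        calc _ ≤ (mG d a + 2) * ∑ i ∈ Finset.range n, M ^ i := by gcongr
          _ = M ^ n - 1 := by rw [← h2, hM]; ring
          _ ≤ _ := by linarith
      calc ∑ k ∈ Finset.range (G n), ‖expSum G θ (g k) (G n)‖
          ≤ ∑ k ∈ Finset.range (G n), ∑ j ∈ Finset.Icc 1 d,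
            ‖geomExp (a j) (θ + g k * G (n - j))‖ * ‖expSum G θ (g k) (G (n - j))‖ := by
            apply Finset.sum_le_sum
            intro k _
            rw [h.expSum_recurrence θ (g k) hn]
            refine (norm_sum_le _ _).trans (Finset.sum_le_sum fun j _ => ?_)
            rw [norm_mul, norm_coef]
        _ = ∑ j ∈ Finset.Icc 1 d, ∑ k ∈ Finset.range (G n),
            ‖geomExp (a j) (θ + g k * G (n - j))‖ * ‖expSum G θ (g k) (G (n - j))‖ :=
            Finset.sum_comm
        _ ≤ ∑ j ∈ Finset.Icc 1 d,
            G n * ((mG d a + 2) * (((G d : ℝ) + 2) * M ^ (n - j) - 1)) :=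
            Finset.sum_le_sum hstep
        _ = G n * (((G d : ℝ) + 2) * ((mG d a + 2) * ∑ j ∈ Finset.Icc 1 d, M ^ (n - j)) -
            (mG d a + 2) * d) := by
            rw [← Finset.mul_sum, ← Finset.mul_sum, Finset.sum_sub_distrib, ← Finset.mul_sum,
              Finset.sum_const, Nat.card_Icc, Nat.add_sub_cancel, nsmul_eq_mul]
            ring
        _ ≤ _ := by
            have hd : (1 : ℝ) ≤ d := by exact_mod_cast h.one_le_d
            gcongr
            nlinarith

/-- Separated points occupy distinct cells of mesh 1/(G_n E); the cells in one residue class modulo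
E form a jittered lattice of mesh 1/G_n. Finally M^n = (α^n)^κ is O(G_n^κ). -/
theorem spacedBound_logb (h : IsLinearRecurrenceBase G d a) (θ : ℝ) (ha : 30 ≤ a 1) :
    SpacedBound G θ (Real.logb (dominantRoot d a) (mG d a + 3)) := by
  obtain ⟨C, hC, hjit⟩ := h.exists_jitterBound θ ha
  obtain ⟨c, C', hc, hC', hgrow⟩ := h.exists_growth
  have hα := h.isDominantRoot_dominantRoot.1
  set α := dominantRoot d a
  have hα0 : 0 < α := by linarith
  have hm := mG_nonneg d a
  set M := mG d a + 3 with hM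
  set κ := Real.logb α M with hκ
  have hκ0 : 0 ≤ κ := Real.logb_nonneg hα (by linarith)
  have ha30 : (30 : ℝ) ≤ a 1 := by exact_mod_cast ha
  refine ⟨(a 1 + 2) * C * (c ^ κ)⁻¹, by positivity, fun n P D hD hP hsep => ?_⟩
  have hN : (1 : ℝ) ≤ G n := by exact_mod_cast h.pos n
  have hN0 : (0 : ℝ) < G n := by linarith
  -- Large enough that cells are shorter than 1/D and than the jitter (2/a_1)/G_n, while G_n E =
  -- O(D).
  set E : ℕ := ⌊D / G n⌋₊ + a 1 + 1 with hE
  have hE1 : D < G n * E := by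
    have := Nat.lt_floor_add_one (D / G n)
    rw [div_lt_iff₀ hN0] at this
    rw [hE]
    push_cast
    nlinarith
  have hE2 : (E : ℝ) * G n ≤ (a 1 + 2) * D := by
    have h1 : (E : ℝ) ≤ D / G n + a 1 + 1 := by
      rw [hE]
      push_cast
      have := Nat.floor_le (show 0 ≤ D / G n by apply div_nonneg <;> linarith)
      linarith
    calc (E : ℝ) * G n ≤ (D / G n + a 1 + 1) * G n := by gcongr
      _ = D + (a 1 + 1) * G n := by field_simp; ring
      _ ≤ D + (a 1 + 1) * D := by gcongr
      _ = _ := by ring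
  have hD0 : 0 < D := by linarith
  have hE0 : 0 < E := by omega
  have hE0' : (0 : ℝ) < E := by exact_mod_cast hE0
  have hL0 : 0 < G n * E := Nat.mul_pos (h.pos n) hE0
  have hEa : (a 1 : ℝ) ≤ E := by exact_mod_cast (by omega : a 1 ≤ E)
  have hMn : M ^ n ≤ (c ^ κ)⁻¹ * (G n : ℝ) ^ κ := by
    have h1 : M = α ^ κ := (Real.rpow_logb hα0 hα.ne' (by linarith)).symm
    have h2 := (hgrow n).1
    rw [inv_mul_eq_div, le_div_iff₀ (by positivity), h1, ← Real.rpow_mul_natCast hα0.le,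
      mul_comm κ, Real.rpow_natCast_mul hα0.le, mul_comm, ← Real.mul_rpow hc.le (by positivity)]
    gcongr
  refine (sum_le_of_cells (fun β => ‖expSum G θ β (G n)‖) (fun _ => norm_nonneg _)
    (E * (G n * (C * M ^ n - 2))) hL0 ?_ P hP ?_).trans ?_
  · intro g hg
    rw [sum_range_mul_eq, Finset.sum_comm]
    calc _ ≤ ∑ u ∈ Finset.range E, G n * (C * M ^ n - 2) := by
          apply Finset.sum_le_sum
          intro u hu
          apply hjit n (u / (G n * E : ℕ)) (fun k => g (k * E + u))
          intro k hk
          have hu' := Finset.mem_range.mp hu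
          have hlt : k * E + u < G n * E := by
            calc k * E + u < k * E + E := by omega
              _ = (k + 1) * E := by ring
              _ ≤ _ := Nat.mul_le_mul_right _ hk
          obtain ⟨g1, g2⟩ := hg (k * E + u) hlt
          have e1 : ((k * E + u : ℕ) : ℝ) / (G n * E : ℕ) =
              u / (G n * E : ℕ) + k / G n := by
            push_cast
            field_simp
            ring
          rw [add_div, e1] at g2
          rw [e1] at g1
          refine ⟨g1, g2.trans ?_⟩
          have h5 : 1 / ((G n * E : ℕ) : ℝ) ≤ 2 / (a 1 : ℝ) / G n := by
            push_cast
            rw [div_div, div_le_div_iff₀ (by positivity) (by positivity)]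
            nlinarith
          rw [add_div]
          linarith
      _ = _ := by simp
  · intro β hβ β' hβ' hne
    refine lt_of_lt_of_le ?_ (hsep β hβ β' hβ' hne)
    apply one_div_lt_one_div_of_lt (by linarith)
    push_cast
    exact hE1
  · calc (E : ℝ) * (G n * (C * M ^ n - 2)) = E * G n * (C * M ^ n - 2) := by ring
      _ ≤ E * G n * (C * M ^ n) := by gcongr; linarith
      _ ≤ (a 1 + 2) * D * (C * ((c ^ κ)⁻¹ * (G n : ℝ) ^ κ)) := by gcongr
      _ = _ := by ring

/-- The assumption says (m_G + 3)² < α ≤ a_1 + 1. With m_G ≥ 0 this gives a_1 ≥ 9; then m_G ≥ 2.56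
by the lower bounds above, and 5.56² > 30 gives a_1 > 29. -/
theorem thirty_le_of_logb_lt (h : IsLinearRecurrenceBase G d a)
    (hlt : Real.logb (dominantRoot d a) (mG d a + 3) < 1 / 2) : 30 ≤ a 1 := by
  have hα := h.isDominantRoot_dominantRoot.1
  have hle := h.dominantRoot_le
  set α := dominantRoot d a
  have hm := mG_nonneg d a
  rw [Real.logb_lt_iff_lt_rpow hα (by linarith), ← Real.sqrt_eq_rpow,
    Real.lt_sqrt (by linarith)] at hlt
  have h9 : (8 : ℝ) < a 1 := by nlinarith
  have h9' : 9 ≤ a 1 := by exact_mod_cast h9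
  have h9r : (9 : ℝ) ≤ a 1 := by exact_mod_cast h9'
  have h1 := two_mul_mGLower_le a (by omega)
  have h2 := mGLower_ge (a 1) (by omega)
  have h3 := mGj_one_le_mG d a h.one_le_d h.first_pos
  have h4 : (2.56 : ℝ) ≤ mG d a := by
    have h5 : (a 1 : ℝ) * 2.56 ≤ a 1 * mGj a 1 := by linarith
    have := le_of_mul_le_mul_left h5 (by linarith)
    linarith
  have h6 : (29 : ℝ) < a 1 := by nlinarith
  exact_mod_cast h6

theorem spacedBound_levelExponent (h : IsLinearRecurrenceBase G d a) (θ : ℝ) :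
    SpacedBound G θ (1 - levelExponent d a) := by
  rcases lt_or_ge (Real.logb (dominantRoot d a) (mG d a + 3)) (1 / 2) with hlt | hge
  · have := h.spacedBound_logb θ (h.thirty_le_of_logb_lt hlt)
    rw [levelExponent, max_eq_right (by linarith)]
    convert this using 1
    ring
  · rw [levelExponent, max_eq_left (by linarith)]
    convert spacedBound_half G h.pos θ using 1
    norm_num

theorem levelExponent_le_one (h : IsLinearRecurrenceBase G d a) : levelExponent d a ≤ 1 := by
  have hα := h.isDominantRoot_dominantRoot.1
  have hm := mG_nonneg d a
  have := Real.logb_nonneg hα (show 1 ≤ mG d a + 3 by linarith)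
  exact max_le (by norm_num) (by linarith)

end IsLinearRecurrenceBase


/-! ### The limit ϑ → 1 -/

theorem inv_sin_le_of_le_half {y : ℝ} (h1 : 0 < y) (h2 : y ≤ 1 / 2) :
    1 / Real.sin (Real.pi * y) ≤ 1 / (2 * y) := by
  have hπ := Real.pi_pos
  have hjor := Real.mul_le_sin (x := Real.pi * y) (by positivity) (by nlinarith)
  have e : 2 / Real.pi * (Real.pi * y) = 2 * y := by field_simp
  rw [e] at hjor
  exact one_div_le_one_div_of_le (by positivity) hjor

/-- For y ≤ 1/2 in the b-th interval with b ≥ 1, 1/sin(πy) ≤ 1/(2y) ≤ a_1/(2b) ≤ a_1/(b + 1); for b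
= 0 the bound a_1 is trivial. Reflection treats y ≥ 1/2, and the sum of both bounds avoids a case
distinction. -/
theorem mGjb_le_add (a : ℕ → ℕ) (j b : ℕ) (hj : a j ≤ a 1) (hb : b < a 1) :
    mGjb a j b ≤ a 1 * (1 / ((b : ℝ) + 1) + 1 / ((a 1 : ℝ) - b)) := by
  have ha : (0 : ℝ) < a 1 := by exact_mod_cast (by omega : 0 < a 1)
  have hbr : (b : ℝ) + 1 ≤ a 1 := by exact_mod_cast hb
  have hjr : (a j : ℝ) ≤ a 1 := by exact_mod_cast hj
  have hpos1 : 0 < 1 / ((b : ℝ) + 1) := by positivity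
  have hpos2 : 0 < 1 / ((a 1 : ℝ) - b) := by apply one_div_pos.mpr; linarith
  apply mGjb_le _ _ _ _ (by positivity)
  intro y hy1 hy2
  rw [div_lt_iff₀ ha] at hy1
  rw [lt_div_iff₀ ha] at hy2
  have hb0 : (0 : ℝ) ≤ b := Nat.cast_nonneg b
  have hy0 : 0 < y := by
    by_contra hle
    nlinarith
  have hy1' : y < 1 := by
    by_contra hle
    nlinarith
  have hs : 0 < Real.sin (Real.pi * y) := by
    apply Real.sin_pos_of_pos_of_lt_pi
    · have := Real.pi_pos; positivity
    · nlinarith [Real.pi_pos]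
  have h1 : |Real.sin (Real.pi * a j * y) / Real.sin (Real.pi * y)| ≤
      1 / Real.sin (Real.pi * y) := by
    rw [abs_div, abs_of_pos hs]
    gcongr
    exact Real.abs_sin_le_one _
  have h2 := (abs_sin_div_sin_le (a j) y).trans hjr
  have hcase : ∀ (m : ℕ) (z : ℝ), (m : ℝ) < z * a 1 → 0 < z → z ≤ 1 / 2 →
      Real.sin (Real.pi * z) = Real.sin (Real.pi * y) →
      |Real.sin (Real.pi * a j * y) / Real.sin (Real.pi * y)| ≤ a 1 * (1 / ((m : ℝ) + 1)) := by
    intro m z hm hz0 hz hzs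
    rcases Nat.eq_zero_or_pos m with h0 | h0
    · subst h0
      simpa using h2
    · have hm1 : (1 : ℝ) ≤ m := by exact_mod_cast h0
      have h3 := inv_sin_le_of_le_half hz0 hz
      rw [hzs] at h3
      refine h1.trans (h3.trans ?_)
      rw [mul_one_div, div_le_div_iff₀ (by positivity) (by positivity)]
      nlinarith
  rcases le_total y (1 / 2) with hy | hy
  · refine (hcase b y hy1 hy0 hy rfl).trans ?_
    gcongr
    linarith
  · have hc : ((a 1 - 1 - b : ℕ) : ℝ) = a 1 - 1 - b := by
      rw [Nat.cast_sub (by omega), Nat.cast_sub (by omega)]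
      simp
    have := hcase (a 1 - 1 - b) (1 - y) (by rw [hc]; nlinarith) (by linarith) (by linarith) (by
      rw [mul_sub, mul_one, Real.sin_pi_sub])
    refine this.trans ?_
    rw [hc, show (a 1 : ℝ) - 1 - b + 1 = a 1 - b by ring]
    gcongr
    linarith

theorem sum_one_div_le (n : ℕ) :
    ∑ b ∈ Finset.range n, 1 / ((b : ℝ) + 1) ≤ 1 + Real.log n := by
  have h := harmonic_le_one_add_log n
  refine le_trans (le_of_eq ?_) h
  rw [harmonic]
  push_cast
  apply Finset.sum_congr rfl
  intros
  rw [one_div]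

theorem mGj_le (a : ℕ → ℕ) (j : ℕ) (hj : a j ≤ a 1) (ha : 0 < a 1) :
    mGj a j ≤ 2 * (1 + Real.log (a 1)) := by
  have ha0 : (0 : ℝ) < a 1 := by exact_mod_cast ha
  have h1 : ∑ b ∈ Finset.range (a 1), mGjb a j b ≤
      ∑ b ∈ Finset.range (a 1), a 1 * (1 / ((b : ℝ) + 1) + 1 / ((a 1 : ℝ) - b)) :=
    Finset.sum_le_sum fun b hb => mGjb_le_add a j b hj (Finset.mem_range.mp hb)
  have h2 : ∑ b ∈ Finset.range (a 1), 1 / ((a 1 : ℝ) - b) =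
      ∑ b ∈ Finset.range (a 1), 1 / ((b : ℝ) + 1) := by
    rw [← Finset.sum_range_reflect]
    apply Finset.sum_congr rfl
    intro b hb
    have hb' := Finset.mem_range.mp hb
    rw [Nat.cast_sub (by omega), Nat.cast_sub (by omega)]
    congr 1
    push_cast
    ring
  rw [← Finset.mul_sum, Finset.sum_add_distrib, h2] at h1
  have h3 := sum_one_div_le (a 1)
  rw [mGj, one_div, inv_mul_le_iff₀ ha0]
  refine h1.trans ?_
  gcongr
  linarith

namespace IsLinearRecurrenceBase

variable {G : ℕ → ℕ} {d : ℕ} {a : ℕ → ℕ}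

theorem mG_le (h : IsLinearRecurrenceBase G d a) : mG d a ≤ 2 * (1 + Real.log (a 1)) := by
  have h1 : (1 : ℝ) ≤ a 1 := by exact_mod_cast h.first_pos
  apply Real.iSup_le
  · rintro ⟨j, h1, h2, _⟩
    exact mGj_le a j (h.coeff_le h1 h2) h.first_pos
  · have := Real.log_nonneg h1
    positivity

theorem one_sub_levelExponent_le (h : IsLinearRecurrenceBase G d a) (ha : 2 ≤ a 1) :
    1 - levelExponent d a ≤ Real.log (5 + 2 * Real.log (a 1)) / Real.log (a 1) := by
  have ha1 : (1 : ℝ) < a 1 := by exact_mod_cast (by omega : 1 < a 1)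
  have hlog := Real.log_pos ha1
  have hm := mG_nonneg d a
  have h1 : 1 - levelExponent d a ≤ Real.logb (dominantRoot d a) (mG d a + 3) := by
    have : 1 - Real.logb (dominantRoot d a) (mG d a + 3) ≤ levelExponent d a := le_max_right _ _
    linarith
  refine h1.trans ?_
  rw [Real.logb]
  apply div_le_div₀
  · exact Real.log_nonneg (by linarith)
  · apply Real.log_le_log (by linarith)
    linarith [h.mG_le]
  · exact hlog
  · exact Real.log_le_log (by linarith) h.coeff_le_dominantRoot

end IsLinearRecurrenceBase

theorem tendsto_log_affine_div :
    Filter.Tendsto (fun L : ℝ => Real.log (5 + 2 * L) / L) Filter.atTop (nhds 0) := by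
  have h1 : Filter.Tendsto (fun L : ℝ => Real.log 7 / L + Real.log L / L) Filter.atTop
      (nhds 0) := by
    have h2 : Filter.Tendsto (fun L : ℝ => Real.log 7 / L) Filter.atTop (nhds 0) :=
      Filter.Tendsto.div_atTop tendsto_const_nhds Filter.tendsto_id
    have h3 : Filter.Tendsto (fun L : ℝ => Real.log L / L) Filter.atTop (nhds 0) :=
      Real.isLittleO_log_id_atTop.tendsto_div_nhds_zero
    simpa using h2.add h3
  apply squeeze_zero' _ _ h1
  · filter_upwards [Filter.eventually_ge_atTop 1] with L hL
    apply div_nonneg _ (by linarith)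
    exact Real.log_nonneg (by linarith)
  · filter_upwards [Filter.eventually_ge_atTop 1] with L hL
    rw [← add_div, ← Real.log_mul (by norm_num) (by linarith)]
    gcongr
    linarith

theorem levelExponent_tendsto (δ : ℝ) (hδ : 0 < δ) :
    ∃ K : ℕ, ∀ (G : ℕ → ℕ) (d : ℕ) (a : ℕ → ℕ),
      IsLinearRecurrenceBase G d a → K ≤ a 1 → |levelExponent d a - 1| < δ := by
  have h1 : Filter.Tendsto (fun n : ℕ => Real.log (5 + 2 * Real.log n) / Real.log n)
      Filter.atTop (nhds 0) :=
    tendsto_log_affine_div.comp (Real.tendsto_log_atTop.comp tendsto_natCast_atTop_atTop)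
  have h2 := h1.eventually (gt_mem_nhds hδ)
  obtain ⟨K, hK⟩ := Filter.eventually_atTop.mp h2
  refine ⟨max K 2, fun G d a h ha => ?_⟩
  have h3 := hK (a 1) (le_trans (le_max_left _ _) ha)
  have h4 := h.one_sub_levelExponent_le (le_trans (le_max_right _ _) ha)
  rw [abs_sub_comm, abs_of_nonneg (by linarith [h.levelExponent_le_one])]
  linarith


/-! ### From discrepancies to exponential sums at fractions -/

/-- The exponential sum over the residue class `h` modulo `q`, compared with its mean value. -/
theorem sum_residue_sub_mean (G : ℕ → ℕ) (θ : ℝ) (q h Z : ℕ) (hq : 0 < q) :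
    ∑ k ∈ Finset.range Z, unitExp (θ * sumOfDigits G k) *
        ((if k ≡ h [MOD q] then (1 : ℂ) else 0) - 1 / q) =
      1 / q * ∑ t ∈ Finset.Ico 1 q, unitExp (-(t * (h / q : ℝ))) * expSum G θ (t / q) Z := by
  have hqc : (q : ℂ) ≠ 0 := by exact_mod_cast hq.ne'
  have hind : ∀ k : ℕ, (if k ≡ h [MOD q] then (1 : ℂ) else 0) - 1 / q =
      1 / q * ∑ t ∈ Finset.Ico 1 q, unitExp (-(t * (h / q : ℝ)) + (t / q : ℝ) * k) := by
    intro k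
    have h1 := sum_unitExp_mul_div q hq ((k : ℤ) - h)
    rw [Finset.range_eq_Ico, Finset.sum_eq_sum_Ico_succ_bot hq] at h1
    have h2 : ∑ t ∈ Finset.Ico 1 q, unitExp (-(t * (h / q : ℝ)) + (t / q : ℝ) * k) =
        (if (q : ℤ) ∣ (k : ℤ) - h then (q : ℂ) else 0) - 1 := by
      rw [← h1]
      simp only [Nat.cast_zero, zero_mul, unitExp_zero, zero_add, add_sub_cancel_left]
      apply Finset.sum_congr rfl
      intro t _
      congr 1
      push_cast
      ring
    rw [h2]
    have h3 : k ≡ h [MOD q] ↔ (q : ℤ) ∣ (k : ℤ) - h := by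
      rw [Nat.ModEq.comm, Nat.modEq_iff_dvd]
    by_cases hm : k ≡ h [MOD q]
    · rw [if_pos hm, if_pos (h3.mp hm)]
      field_simp
    · rw [if_neg hm, if_neg (fun hd => hm (h3.mpr hd))]
      ring
  simp only [hind, expSum]
  simp only [Finset.mul_sum]
  rw [Finset.sum_comm]
  apply Finset.sum_congr rfl
  intro t _
  apply Finset.sum_congr rfl
  intro k _
  rw [unitExp_add, unitExp_add]
  ring

theorem abs_card_residue_sub_le (q h Z : ℕ) (hq : 0 < q) :
    |∑ k ∈ Finset.range Z, ((if k ≡ h [MOD q] then (1 : ℝ) else 0) - 1 / q)| ≤ 1 := by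
  have hqr : (0 : ℝ) < q := by exact_mod_cast hq
  have h1 : ∑ k ∈ Finset.range Z, (if k ≡ h [MOD q] then (1 : ℝ) else 0) =
      (Z.count (· ≡ h [MOD q]) : ℝ) := by
    rw [Nat.count_eq_card_filter_range, Finset.sum_boole]
  rw [Finset.sum_sub_distrib, h1, Nat.count_modEq_card _ hq]
  have h2 : (Z : ℝ) = q * (Z / q : ℕ) + (Z % q : ℕ) := by exact_mod_cast (Nat.div_add_mod Z q).symm
  have h3 : ((Z % q : ℕ) : ℝ) < q := by exact_mod_cast Nat.mod_lt Z hq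
  have h4 : (0 : ℝ) ≤ ((Z % q : ℕ) : ℝ) := Nat.cast_nonneg _
  have h5 : ∑ k ∈ Finset.range Z, 1 / (q : ℝ) = (Z / q : ℕ) + (Z % q : ℕ) / (q : ℝ) := by
    simp only [Finset.sum_const, Finset.card_range, nsmul_eq_mul]
    conv_lhs => rw [h2]
    field_simp
  rw [h5]
  have h6 : ((Z % q : ℕ) : ℝ) / q ≤ 1 := by rw [div_le_one hqr]; exact h3.le
  have h7 : 0 ≤ ((Z % q : ℕ) : ℝ) / q := by positivity
  rw [abs_le]
  split_ifs <;> push_cast <;> constructor <;> linarith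

/-- Characters modulo s detect the digit sum and characters modulo q the residue class. The trivial
character modulo s only counts integers in a residue class, with error at most 1. Subtracting the
mean removes t = 0; it is readmitted on the right, where all terms are nonnegative. -/
theorem discrepancy_le (G : ℕ → ℕ) (r s q h : ℕ) (z : ℝ) (hs : 0 < s) (hq : 0 < q) :
    discrepancy G r s q h z ≤ 1 + ∑ l ∈ Finset.Ico 1 s,
      1 / (q : ℝ) * ∑ t ∈ Finset.range q, ‖expSum G (l / s) (t / q) ⌈z⌉₊‖ := by
  set Z := ⌈z⌉₊
  have hsc : (s : ℂ) ≠ 0 := by exact_mod_cast hs.ne'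
  have hsr : (1 : ℝ) ≤ s := by exact_mod_cast hs
  set E : ℕ → ℂ := fun l => ∑ k ∈ Finset.range Z, unitExp ((l / s : ℝ) * sumOfDigits G k) *
        ((if k ≡ h [MOD q] then (1 : ℂ) else 0) - 1 / q) with hE
  have hD : ((((Finset.range Z).filter
        (fun k => sumOfDigits G k ≡ r [MOD s] ∧ k ≡ h [MOD q])).card : ℝ) -
      (1 / (q : ℝ)) *
        (((Finset.range Z).filter (fun k => sumOfDigits G k ≡ r [MOD s])).card : ℝ) : ℝ) =
      (1 / s * ∑ l ∈ Finset.range s, unitExp (-(l * (r / s : ℝ))) * E l : ℂ) := by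
    have hind : ∀ k : ℕ, (if sumOfDigits G k ≡ r [MOD s] then (1 : ℂ) else 0) =
        1 / s * ∑ l ∈ Finset.range s, unitExp (-(l * (r / s : ℝ))) *
          unitExp ((l / s : ℝ) * sumOfDigits G k) := by
      intro k
      have h1 := sum_unitExp_mul_div s hs ((sumOfDigits G k : ℤ) - r)
      have h2 : ∑ l ∈ Finset.range s, unitExp (-(l * (r / s : ℝ))) *
          unitExp ((l / s : ℝ) * sumOfDigits G k) =
          if (s : ℤ) ∣ (sumOfDigits G k : ℤ) - r then (s : ℂ) else 0 := by
        rw [← h1]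
        apply Finset.sum_congr rfl
        intro l _
        rw [← unitExp_add]
        congr 1
        push_cast
        ring
      rw [h2]
      have h3 : sumOfDigits G k ≡ r [MOD s] ↔ (s : ℤ) ∣ (sumOfDigits G k : ℤ) - r := by
        rw [Nat.ModEq.comm, Nat.modEq_iff_dvd]
      by_cases hm : sumOfDigits G k ≡ r [MOD s]
      · rw [if_pos hm, if_pos (h3.mp hm)]
        field_simp
      · rw [if_neg hm, if_neg (fun hd => hm (h3.mpr hd))]
        ring
    have h4 : ((((Finset.range Z).filter
        (fun k => sumOfDigits G k ≡ r [MOD s] ∧ k ≡ h [MOD q])).card : ℝ) -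
      (1 / (q : ℝ)) *
        (((Finset.range Z).filter (fun k => sumOfDigits G k ≡ r [MOD s])).card : ℝ) : ℝ) =
        (∑ k ∈ Finset.range Z, (if sumOfDigits G k ≡ r [MOD s] then (1 : ℂ) else 0) *
        ((if k ≡ h [MOD q] then (1 : ℂ) else 0) - 1 / q) : ℂ) := by
      simp only [mul_sub, Finset.sum_sub_distrib, ← ite_and, ite_mul,
        one_mul, zero_mul, Finset.sum_boole]
      push_cast
      simp only [← Finset.sum_filter, Finset.sum_const, nsmul_eq_mul]
      simp [mul_comm]
    rw [h4]
    simp only [hind, hE, Finset.mul_sum, Finset.sum_mul]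
    rw [Finset.sum_comm]
    apply Finset.sum_congr rfl
    intro l _
    apply Finset.sum_congr rfl
    intro k _
    ring
  have hE0 : ‖E 0‖ ≤ 1 := by
    have h1 : E 0 = ((∑ k ∈ Finset.range Z,
        ((if k ≡ h [MOD q] then (1 : ℝ) else 0) - 1 / q) : ℝ) : ℂ) := by
      simp only [hE]
      rw [Complex.ofReal_sum]
      apply Finset.sum_congr rfl
      intro k _
      split_ifs <;> simp
    rw [h1, Complex.norm_real]
    exact abs_card_residue_sub_le q h Z hq
  have hEl : ∀ l, ‖E l‖ ≤ 1 / (q : ℝ) *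
      ∑ t ∈ Finset.range q, ‖expSum G (l / s) (t / q) Z‖ := by
    intro l
    simp only [hE]
    rw [sum_residue_sub_mean G _ q h Z hq, norm_mul]
    have h1 : ‖(1 / q : ℂ)‖ = 1 / (q : ℝ) := by simp
    rw [h1]
    gcongr
    refine (norm_sum_le _ _).trans ?_
    simp only [norm_mul, norm_unitExp, one_mul]
    apply Finset.sum_le_sum_of_subset_of_nonneg
    · intro t ht
      exact Finset.mem_range.mpr (Finset.mem_Ico.mp ht).2
    · exact fun _ _ _ => norm_nonneg _
  rw [discrepancy, ← Real.norm_eq_abs, ← Complex.norm_real, hD, norm_mul]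
  have h1 : ‖(1 / s : ℂ)‖ ≤ 1 := by
    rw [norm_div, norm_one, Complex.norm_natCast]
    rw [div_le_one (by linarith)]
    exact hsr
  calc _ ≤ 1 * ∑ l ∈ Finset.range s, ‖E l‖ := by
        gcongr
        refine (norm_sum_le _ _).trans (le_of_eq ?_)
        simp only [norm_mul, norm_unitExp, one_mul]
    _ = ‖E 0‖ + ∑ l ∈ Finset.Ico 1 s, ‖E l‖ := by
        rw [one_mul, Finset.range_eq_Ico, Finset.sum_eq_sum_Ico_succ_bot hs]
    _ ≤ _ := add_le_add hE0 (Finset.sum_le_sum fun l _ => hEl l)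

/-- Fractions `t / q` with `q < Y`, grouped by their reduced form. -/
theorem sum_fractions_le (F : ℝ → ℝ) (hF : ∀ x, 0 ≤ F x) (Y : ℕ) :
    ∑ q ∈ Finset.Ico 1 Y, 1 / (q : ℝ) * ∑ t ∈ Finset.range q, F (t / q) ≤
      (∑ g ∈ Finset.Ico 1 Y, 1 / (g : ℝ)) * ∑ c ∈ Finset.Ico 1 Y, 1 / (c : ℝ) *
        ∑ u ∈ (Finset.range c).filter (fun u => u.Coprime c), F (u / c) := by
  classical
  set f : (ℕ × (Σ _ : ℕ, ℕ)) → ℝ := fun p =>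
    1 / (p.1 : ℝ) * (1 / (p.2.1 : ℝ) * F (p.2.2 / p.2.1)) with hf
  set T := Finset.Ico 1 Y ×ˢ ((Finset.Ico 1 Y).sigma
    (fun c => (Finset.range c).filter (fun u => u.Coprime c))) with hT
  -- With g = gcd(q, t) and q = gc the weight splits as 1/q = 1/g · 1/c, and (q, t) is recovered
  -- from g and the reduced fraction; t = 0 becomes 0/1.
  set e : (Σ _ : ℕ, ℕ) → (ℕ × (Σ _ : ℕ, ℕ)) := fun p =>
    (Nat.gcd p.1 p.2, ⟨p.1 / Nat.gcd p.1 p.2, p.2 / Nat.gcd p.1 p.2⟩) with he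
  have hR : (∑ g ∈ Finset.Ico 1 Y, 1 / (g : ℝ)) * ∑ c ∈ Finset.Ico 1 Y, 1 / (c : ℝ) *
        ∑ u ∈ (Finset.range c).filter (fun u => u.Coprime c), F (u / c) = ∑ p ∈ T, f p := by
    rw [hT, Finset.sum_product, Finset.sum_mul]
    apply Finset.sum_congr rfl
    intro g _
    rw [Finset.sum_sigma, Finset.mul_sum]
    apply Finset.sum_congr rfl
    intro c _
    simp only [hf, Finset.mul_sum]
  have hL : ∑ q ∈ Finset.Ico 1 Y, 1 / (q : ℝ) * ∑ t ∈ Finset.range q, F (t / q) =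
      ∑ p ∈ (Finset.Ico 1 Y).sigma (fun q => Finset.range q), f (e p) := by
    rw [Finset.sum_sigma]
    apply Finset.sum_congr rfl
    intro q hq
    have hq1 := (Finset.mem_Ico.mp hq).1
    rw [Finset.mul_sum]
    apply Finset.sum_congr rfl
    intro t _
    have hg : 0 < Nat.gcd q t := Nat.gcd_pos_of_pos_left _ hq1
    have hg' : ((Nat.gcd q t : ℕ) : ℝ) ≠ 0 := by exact_mod_cast hg.ne'
    have hqr : (q : ℝ) ≠ 0 := by exact_mod_cast (by omega : q ≠ 0)
    simp only [hf, he]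
    rw [Nat.cast_div (Nat.gcd_dvd_left q t) hg', Nat.cast_div (Nat.gcd_dvd_right q t) hg',
      ← mul_assoc, div_div_div_cancel_right₀ hg']
    congr 1
    field_simp
  rw [hL, hR]
  have hinj : Set.InjOn e ((Finset.Ico 1 Y).sigma (fun q => Finset.range q)) := by
    rintro ⟨q, t⟩ h1 ⟨q', t'⟩ h2 heq
    simp only [he, Prod.mk.injEq, Sigma.mk.injEq, heq_eq_eq] at heq
    obtain ⟨e1, e2, e3⟩ := heq
    have a1 := Nat.div_mul_cancel (Nat.gcd_dvd_left q t)
    have a2 := Nat.div_mul_cancel (Nat.gcd_dvd_right q t)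
    have b1 := Nat.div_mul_cancel (Nat.gcd_dvd_left q' t')
    have b2 := Nat.div_mul_cancel (Nat.gcd_dvd_right q' t')
    rw [← e2, ← e1] at b1
    rw [← e3, ← e1] at b2
    have hqq : q = q' := a1.symm.trans b1
    have htt : t = t' := a2.symm.trans b2
    rw [hqq, htt]
  rw [← Finset.sum_image hinj]
  apply Finset.sum_le_sum_of_subset_of_nonneg
  · intro p hp
    obtain ⟨⟨q, t⟩, hqt, rfl⟩ := Finset.mem_image.mp hp
    simp only [Finset.mem_sigma, Finset.mem_Ico, Finset.mem_range] at hqt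
    obtain ⟨⟨hq1, hqY⟩, htq⟩ := hqt
    have hg : 0 < Nat.gcd q t := Nat.gcd_pos_of_pos_left _ hq1
    have hgq : Nat.gcd q t ≤ q := Nat.gcd_le_left _ hq1
    simp only [he, hT, Finset.mem_product, Finset.mem_sigma, Finset.mem_Ico, Finset.mem_filter,
      Finset.mem_range]
    refine ⟨⟨hg, by omega⟩, ⟨Nat.div_pos hgq hg, (Nat.div_le_self _ _).trans_lt hqY⟩, ?_, ?_⟩
    · exact Nat.div_lt_div_of_lt_of_dvd (Nat.gcd_dvd_left _ _) htq
    · exact (Nat.coprime_div_gcd_div_gcd hg).symm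
  · intro p _ _
    simp only [hf]
    have := hF ((p.2.2 : ℝ) / p.2.1)
    positivity

theorem sum_dyadic (f : ℕ → ℝ) (K : ℕ) :
    ∑ c ∈ Finset.Ico 1 (2 ^ K), f c =
      ∑ k ∈ Finset.range K, ∑ c ∈ Finset.Ico (2 ^ k) (2 ^ (k + 1)), f c := by
  induction K with
  | zero => simp
  | succ K ih =>
    rw [Finset.sum_range_succ, ← ih, Finset.sum_Ico_consecutive _ Nat.one_le_two_pow
      (Nat.pow_le_pow_right (by norm_num) (by omega))]

/-- Reduced fractions with denominators in `[Q, 2 Q)` are `1 / (4 Q²)`-separated. -/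
theorem exists_farey (Q : ℕ) (hQ : 0 < Q) : ∃ P : Finset ℝ,
    (∀ β ∈ P, 0 ≤ β ∧ β < 1) ∧
    (∀ β ∈ P, ∀ β' ∈ P, β ≠ β' → 1 / (4 * (Q : ℝ) ^ 2) ≤ |β - β'|) ∧
    ∀ F : ℝ → ℝ, ∑ c ∈ Finset.Ico Q (2 * Q),
      ∑ u ∈ (Finset.range c).filter (fun u => u.Coprime c), F (u / c) = ∑ β ∈ P, F β := by
  classical
  set S := (Finset.Ico Q (2 * Q)).sigma
    (fun c => (Finset.range c).filter (fun u => u.Coprime c)) with hS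
  set φ : (Σ _ : ℕ, ℕ) → ℝ := fun p => (p.2 : ℝ) / p.1 with hφ
  have hmem : ∀ p ∈ S, 0 < p.1 ∧ p.1 < 2 * Q ∧ p.2 < p.1 ∧ p.2.Coprime p.1 := by
    rintro ⟨c, u⟩ hp
    simp only [hS, Finset.mem_sigma, Finset.mem_Ico, Finset.mem_filter, Finset.mem_range] at hp
    exact ⟨by dsimp only; omega, hp.1.2, hp.2.1, hp.2.2⟩
  have hinj : Set.InjOn φ S := by
    rintro ⟨c, u⟩ h1 ⟨c', u'⟩ h2 heq
    obtain ⟨a1, -, -, a4⟩ := hmem _ h1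
    obtain ⟨b1, -, -, b4⟩ := hmem _ h2
    dsimp only at a1 a4 b1 b4
    have hc : (c : ℝ) ≠ 0 := by exact_mod_cast a1.ne'
    have hc' : (c' : ℝ) ≠ 0 := by exact_mod_cast b1.ne'
    simp only [hφ] at heq
    rw [div_eq_div_iff hc hc'] at heq
    have heq' : u * c' = u' * c := by exact_mod_cast heq
    have d1 : c ∣ c' := by
      have : c ∣ u * c' := heq' ▸ Dvd.intro_left _ rfl
      exact a4.symm.dvd_of_dvd_mul_left this
    have d2 : c' ∣ c := by
      have : c' ∣ u' * c := heq' ▸ Dvd.intro_left _ rfl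
      exact b4.symm.dvd_of_dvd_mul_left this
    have hcc := Nat.dvd_antisymm d1 d2
    subst hcc
    have := Nat.eq_of_mul_eq_mul_right a1 heq'
    subst this
    rfl
  refine ⟨S.image φ, ?_, ?_, ?_⟩
  · intro β hβ
    obtain ⟨p, hp, rfl⟩ := Finset.mem_image.mp hβ
    obtain ⟨h1, h2, h3, h4⟩ := hmem p hp
    have h1' : (0 : ℝ) < p.1 := by exact_mod_cast h1
    refine ⟨by positivity, ?_⟩
    simp only [hφ]
    rw [div_lt_one h1']
    exact_mod_cast h3
  · intro β hβ β' hβ' hne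
    obtain ⟨p, hp, rfl⟩ := Finset.mem_image.mp hβ
    obtain ⟨p', hp', rfl⟩ := Finset.mem_image.mp hβ'
    obtain ⟨h1, h2, h3, h4⟩ := hmem p hp
    obtain ⟨k1, k2, k3, k4⟩ := hmem p' hp'
    have h1' : (0 : ℝ) < p.1 := by exact_mod_cast h1
    have k1' : (0 : ℝ) < p'.1 := by exact_mod_cast k1
    have h2' : (p.1 : ℝ) ≤ 2 * Q := by exact_mod_cast h2.le
    have k2' : (p'.1 : ℝ) ≤ 2 * Q := by exact_mod_cast k2.le
    simp only [hφ] at hne ⊢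
    have hnum : (1 : ℝ) ≤ |(p.2 : ℝ) * p'.1 - p.1 * p'.2| := by
      have hz : ((p.2 : ℤ) * p'.1 - p.1 * p'.2 : ℤ) ≠ 0 := by
        intro h0
        apply hne
        rw [div_eq_div_iff h1'.ne' k1'.ne']
        have : (p.2 : ℤ) * p'.1 = p.1 * p'.2 := by linarith
        have : (p.2 : ℝ) * p'.1 = p.1 * p'.2 := by exact_mod_cast this
        linarith
      have := Int.one_le_abs hz
      exact_mod_cast this
    rw [div_sub_div _ _ h1'.ne' k1'.ne', abs_div, abs_of_pos (mul_pos h1' k1')]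
    have hden : (p.1 : ℝ) * p'.1 ≤ 4 * (Q : ℝ) ^ 2 := by
      calc (p.1 : ℝ) * p'.1 ≤ (2 * Q) * (2 * Q) := by gcongr
        _ = _ := by ring
    gcongr
  · intro F
    rw [Finset.sum_image hinj, hS, Finset.sum_sigma]


/-! ### Dyadic blocks of denominators -/

namespace IsLinearRecurrenceBase

variable {G : ℕ → ℕ} {d : ℕ} {a : ℕ → ℕ}

/-- Sum of `|T_i|` over `1 / (4 Q²)`-separated points: the spaced bound at the level comparable to
`Q²`, and power saving above that level. -/
theorem exists_block_bound (h : IsLinearRecurrenceBase G d a) (θ : ℝ)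
    (hθ : unitExp ((∑ i ∈ Finset.Icc 1 d, (a i : ℝ) - 1) * θ) ≠ 1) {κ : ℝ} (hκ : 0 ≤ κ)
    (hsp : SpacedBound G θ κ) :
    ∃ C η : ℝ, 0 < C ∧ 0 < η ∧ η ≤ 1 / 4 ∧ ∀ (Q i : ℕ) (P : Finset ℝ), 0 < Q →
      (∀ β ∈ P, 0 ≤ β ∧ β < 1) →
      (∀ β ∈ P, ∀ β' ∈ P, β ≠ β' → 1 / (4 * (Q : ℝ) ^ 2) ≤ |β - β'|) →
      ∑ β ∈ P, ‖expSum G θ β (G i)‖ ≤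
        C * ((Q : ℝ) ^ 2 * (G i : ℝ) ^ κ + (G i : ℝ) ^ (1 - η) * ((Q : ℝ) ^ 2) ^ (η + κ)) := by
  obtain ⟨C₁, hC₁, hspaced⟩ := hsp
  obtain ⟨C₂, η, hC₂, hη0, hη4, hsave⟩ := h.exists_power_saving θ hθ
  obtain ⟨c, C₃, hc, hC₃, hgrow⟩ := h.exists_growth
  have hα := h.isDominantRoot_dominantRoot.1
  set α := dominantRoot d a
  have hα0 : 0 < α := by linarith
  -- The 4 turns the Farey separation into 1/D-separation; G_d forces the critical level n below to
  -- satisfy n ≥ d.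
  set B : ℝ := max 4 (G d) with hB
  have hB4 : 4 ≤ B := le_max_left _ _
  have hB0 : 0 < B := by linarith
  set C₄ : ℝ := C₂ * c⁻¹ ^ (1 - η) * c⁻¹ ^ η * d * α ^ d * (C₃ * α) * C₁ * B ^ (η + κ) with hC₄
  have hC₄0 : 0 < C₄ := by
    have : (0 : ℝ) < d := by exact_mod_cast h.one_le_d
    positivity
  refine ⟨C₁ * B + C₄, η, by positivity, hη0, hη4, fun Q i P hQ hP hsep => ?_⟩
  have hQ1 : (1 : ℝ) ≤ Q := by exact_mod_cast hQ
  set D : ℝ := B * (Q : ℝ) ^ 2 with hD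
  have hQ2 : (1 : ℝ) ≤ (Q : ℝ) ^ 2 := one_le_pow₀ hQ1
  have hBD : B ≤ D := by rw [hD]; nlinarith
  have hD0 : 0 < D := by linarith
  have hsepD : ∀ β ∈ P, ∀ β' ∈ P, β ≠ β' → 1 / D ≤ |β - β'| := by
    intro β hβ β' hβ' hne
    refine le_trans ?_ (hsep β hβ β' hβ' hne)
    rw [hD]
    gcongr
  have hGi : (0 : ℝ) < G i := by exact_mod_cast h.pos i
  rcases le_or_gt (G i : ℝ) D with hle | hgt
  · calc _ ≤ C₁ * D * (G i : ℝ) ^ κ := hspaced i P D hle hP hsepD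
      _ = C₁ * B * ((Q : ℝ) ^ 2 * (G i : ℝ) ^ κ) := by rw [hD]; ring
      _ ≤ (C₁ * B + C₄) * ((Q : ℝ) ^ 2 * (G i : ℝ) ^ κ +
          (G i : ℝ) ^ (1 - η) * ((Q : ℝ) ^ 2) ^ (η + κ)) := by
        gcongr
        · linarith
        · have : 0 ≤ (G i : ℝ) ^ (1 - η) * ((Q : ℝ) ^ 2) ^ (η + κ) := by positivity
          linarith
  · classical
    have hex : ∃ n, D < G n := ⟨i, hgt⟩
    -- The critical level, the last one at which the spaced bound still applies with this D. The d
    -- levels ending there feed the power saving up to i.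
    obtain ⟨n, hn1, hn2, hni⟩ : ∃ n, (G n : ℝ) ≤ D ∧ D < G (n + 1) ∧ n + 1 ≤ i := by
      have h1 := Nat.find_spec hex
      have h2 : Nat.find hex ≠ 0 := by
        intro h0
        rw [h0, h.zero] at h1
        push_cast at h1
        linarith
      obtain ⟨n, hn⟩ := Nat.exists_eq_succ_of_ne_zero h2
      refine ⟨n, ?_, ?_, ?_⟩
      · exact not_lt.mp (Nat.find_min hex (by omega))
      · rw [hn] at h1
        exact h1
      · rw [← Nat.succ_eq_add_one, ← hn]
        exact Nat.find_min' hex hgt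
    have hdn : d ≤ n := by
      by_contra hlt
      have h1 : (G (n + 1) : ℝ) ≤ G d := by exact_mod_cast h.strictMono.monotone (by omega)
      have h2 : (G d : ℝ) ≤ B := le_max_right _ _
      linarith
    have hsum : ∀ j ∈ Finset.range d, ∑ β ∈ P, ‖expSum G θ β (G (n - j))‖ ≤ C₁ * D * D ^ κ := by
      intro j _
      have h1 : (G (n - j) : ℝ) ≤ G n := by exact_mod_cast h.strictMono.monotone (by omega)
      refine (hspaced (n - j) P D (h1.trans hn1) hP hsepD).trans ?_
      have := h1.trans hn1
      gcongr
    have hinv : ∀ j ∈ Finset.range d, (α ^ (n - j))⁻¹ ≤ α ^ d * (C₃ * α) / D := by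
      intro j hj
      have hj' := Finset.mem_range.mp hj
      have h1 : D ≤ C₃ * α ^ (n + 1) := hn2.le.trans (hgrow (n + 1)).2
      have h2 : α ^ n ≤ α ^ d * α ^ (n - j) := by
        rw [← pow_add]
        exact pow_le_pow_right₀ hα.le (by omega)
      rw [inv_eq_one_div, div_le_div_iff₀ (by positivity) hD0, one_mul]
      calc D ≤ C₃ * α ^ (n + 1) := h1
        _ = C₃ * α * α ^ n := by ring
        _ ≤ C₃ * α * (α ^ d * α ^ (n - j)) := by gcongr
        _ = _ := by ring
    have hαi : α ^ i * α ^ (-(η * (i - n : ℝ))) ≤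
        (c⁻¹ ^ (1 - η) * (G i : ℝ) ^ (1 - η)) * (c⁻¹ ^ η * D ^ η) := by
      have e : α ^ i * α ^ (-(η * (i - n : ℝ))) = (α ^ i) ^ (1 - η) * (α ^ n) ^ η := by
        rw [← Real.rpow_natCast α i, ← Real.rpow_natCast α n, ← Real.rpow_mul hα0.le,
          ← Real.rpow_mul hα0.le, ← Real.rpow_add hα0, ← Real.rpow_add hα0]
        congr 1
        ring
      have h1 : α ^ i ≤ c⁻¹ * G i := by
        rw [inv_mul_eq_div, le_div_iff₀ hc, mul_comm]
        exact (hgrow i).1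
      have h2 : α ^ n ≤ c⁻¹ * D := by
        rw [inv_mul_eq_div, le_div_iff₀ hc, mul_comm]
        exact (hgrow n).1.trans hn1
      have hη1 : 0 ≤ 1 - η := by linarith
      rw [e, ← Real.mul_rpow (by positivity) hGi.le, ← Real.mul_rpow (by positivity) hD0.le]
      gcongr
    have hDpow : D ^ κ * D ^ η = B ^ (η + κ) * ((Q : ℝ) ^ 2) ^ (η + κ) := by
      rw [← Real.rpow_add hD0, add_comm κ, hD, Real.mul_rpow hB0.le (by positivity)]
    calc ∑ β ∈ P, ‖expSum G θ β (G i)‖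
        ≤ ∑ β ∈ P, C₂ * α ^ i * α ^ (-(η * (i - n : ℝ))) *
          ∑ j ∈ Finset.range d, ‖expSum G θ β (G (n - j))‖ * (α ^ (n - j))⁻¹ :=
          Finset.sum_le_sum fun β _ => hsave β n i hdn (by omega)
      _ = C₂ * (α ^ i * α ^ (-(η * (i - n : ℝ)))) * ∑ j ∈ Finset.range d,
          (∑ β ∈ P, ‖expSum G θ β (G (n - j))‖) * (α ^ (n - j))⁻¹ := by
          rw [← Finset.mul_sum, Finset.sum_comm]
          simp only [Finset.sum_mul]
          ring
      _ ≤ C₂ * ((c⁻¹ ^ (1 - η) * (G i : ℝ) ^ (1 - η)) * (c⁻¹ ^ η * D ^ η)) *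
          ∑ j ∈ Finset.range d, (C₁ * D * D ^ κ) * (α ^ d * (C₃ * α) / D) := by
          have hnn : ∀ j ∈ Finset.range d,
              0 ≤ (∑ β ∈ P, ‖expSum G θ β (G (n - j))‖) * (α ^ (n - j))⁻¹ := fun j _ => by
            have : 0 ≤ ∑ β ∈ P, ‖expSum G θ β (G (n - j))‖ :=
              Finset.sum_nonneg fun _ _ => norm_nonneg _
            positivity
          have h1 : ∑ j ∈ Finset.range d,
              (∑ β ∈ P, ‖expSum G θ β (G (n - j))‖) * (α ^ (n - j))⁻¹ ≤
              ∑ j ∈ Finset.range d, (C₁ * D * D ^ κ) * (α ^ d * (C₃ * α) / D) :=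
            Finset.sum_le_sum fun j hj =>
              mul_le_mul (hsum j hj) (hinv j hj) (by positivity) (by positivity)
          exact mul_le_mul (mul_le_mul_of_nonneg_left hαi hC₂.le) h1
            (Finset.sum_nonneg hnn) (by positivity)
      _ = C₂ * c⁻¹ ^ (1 - η) * c⁻¹ ^ η * d * α ^ d * (C₃ * α) * C₁ *
          ((G i : ℝ) ^ (1 - η) * (D ^ κ * D ^ η)) := by
          rw [Finset.sum_const, Finset.card_range, nsmul_eq_mul]
          field_simp
      _ = C₄ * ((G i : ℝ) ^ (1 - η) * ((Q : ℝ) ^ 2) ^ (η + κ)) := by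
          rw [hDpow, hC₄]
          ring
      _ ≤ (C₁ * B + C₄) * ((Q : ℝ) ^ 2 * (G i : ℝ) ^ κ +
          (G i : ℝ) ^ (1 - η) * ((Q : ℝ) ^ 2) ^ (η + κ)) := by
        gcongr
        · have : 0 < C₁ * B := by positivity
          linarith
        · have : 0 ≤ (Q : ℝ) ^ 2 * (G i : ℝ) ^ κ := by positivity
          linarith

/-- The bound for one level and one dyadic range of denominators, in terms of `x`. -/
theorem block_arith {x y v ε η : ℝ} (hx : 1 ≤ x) (hv : 1 / 2 ≤ v) (hv1 : v ≤ 1)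
    (hε0 : 0 < ε) (hε : ε ≤ 1 / 4) (hη0 : 0 < η) (hη : η ≤ 1 / 4) {g : ℝ} (hg0 : 0 < g)
    (hg : g ≤ 2 * x) (hy1 : 1 ≤ y) (hy : y ≤ x ^ (v - ε)) :
    1 / y * (y ^ 2 * g ^ (1 - v) + g ^ (1 - η) * (y ^ 2) ^ (η + (1 - v))) ≤
      4 * x ^ (1 - 2 * ε * η) := by
  have hx0 : 0 < x := by linarith
  have hy0 : 0 < y := by linarith
  have htwo : ∀ p : ℝ, p ≤ 1 → (2 : ℝ) ^ p ≤ 2 := by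
    intro p hp
    calc (2 : ℝ) ^ p ≤ 2 ^ (1 : ℝ) := Real.rpow_le_rpow_of_exponent_le (by norm_num) hp
      _ = 2 := Real.rpow_one 2
  have hgp : ∀ p : ℝ, 0 ≤ p → p ≤ 1 → g ^ p ≤ 2 * x ^ p := by
    intro p hp0 hp1
    calc g ^ p ≤ (2 * x) ^ p := by gcongr
      _ = 2 ^ p * x ^ p := Real.mul_rpow (by norm_num) hx0.le
      _ ≤ 2 * x ^ p := by gcongr; exact htwo p hp1
  have h1 : y * g ^ (1 - v) ≤ 2 * x ^ (1 - 2 * ε * η) := by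
    calc y * g ^ (1 - v) ≤ x ^ (v - ε) * (2 * x ^ (1 - v)) := by
          gcongr
          exact hgp _ (by linarith) (by linarith)
      _ = 2 * x ^ (1 - ε) := by
          rw [mul_left_comm, ← Real.rpow_add hx0]
          ring_nf
      _ ≤ 2 * x ^ (1 - 2 * ε * η) := by
          gcongr
          nlinarith
  have h2 : g ^ (1 - η) * y ^ (2 * η + 1 - 2 * v) ≤ 2 * x ^ (1 - 2 * ε * η) := by
    have hyp : y ^ (2 * η + 1 - 2 * v) ≤ x ^ (η - 2 * ε * η) := by
      rcases le_total (2 * η + 1 - 2 * v) 0 with hneg | hpos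
      · calc y ^ (2 * η + 1 - 2 * v) ≤ 1 := Real.rpow_le_one_of_one_le_of_nonpos hy1 hneg
          _ ≤ _ := Real.one_le_rpow hx (by nlinarith)
      · calc y ^ (2 * η + 1 - 2 * v) ≤ (x ^ (v - ε)) ^ (2 * η + 1 - 2 * v) := by gcongr
          _ = x ^ ((v - ε) * (2 * η + 1 - 2 * v)) := (Real.rpow_mul hx0.le _ _).symm
          _ ≤ _ := by
            apply Real.rpow_le_rpow_of_exponent_le hx
            -- The exponent inequality becomes τ(1 - 2η - 2ε + 2τ) ≥ 0, which is why η and ε are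
            -- kept at most 1/4.
            obtain ⟨τ, rfl⟩ : ∃ τ, v = 1 / 2 + τ := ⟨v - 1 / 2, by ring⟩
            have hτ : 0 ≤ τ := by linarith
            nlinarith [mul_nonneg hτ hτ, mul_nonneg hτ hη0.le, mul_nonneg hτ hε0.le]
    calc g ^ (1 - η) * y ^ (2 * η + 1 - 2 * v)
        ≤ (2 * x ^ (1 - η)) * x ^ (η - 2 * ε * η) := by
          gcongr
          exact hgp _ (by linarith) (by linarith)
      _ = 2 * x ^ (1 - 2 * ε * η) := by
          rw [mul_assoc, ← Real.rpow_add hx0]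
          ring_nf
  have e1 : 1 / y * (y ^ 2 * g ^ (1 - v) + g ^ (1 - η) * (y ^ 2) ^ (η + (1 - v))) =
      y * g ^ (1 - v) + g ^ (1 - η) * y ^ (2 * η + 1 - 2 * v) := by
    have e2 : (y ^ 2) ^ (η + (1 - v)) = y * y ^ (2 * η + 1 - 2 * v) := by
      rw [← Real.rpow_natCast y 2, ← Real.rpow_mul hy0.le]
      nth_rewrite 2 [← Real.rpow_one y]
      rw [← Real.rpow_add hy0]
      congr 1
      push_cast
      ring
    rw [e2]
    field_simp
  rw [e1]
  linarith

end IsLinearRecurrenceBase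


/-! ### Summation over levels, denominators and characters -/

/-- A power saving absorbs all powers of logarithms. -/
theorem exists_rpow_mul_log_le (δ A : ℝ) (hδ : 0 < δ) (hA : 0 < A) :
    ∃ C : ℝ, 0 < C ∧ ∀ x : ℝ, 1 ≤ x →
      x ^ (1 - δ) * (1 + Real.log (2 * x)) ^ 3 ≤ C * (x * Real.log (2 * x) ^ (-A)) := by
  -- With log y ≤ y^e / e, the power 3 + A of the logarithm then costs exactly x^δ.
  set e : ℝ := δ / (3 + A) with he
  have he0 : 0 < e := by positivity
  set k := Real.exp 1 * 2 with hk
  have hk0 : 0 < k := by positivity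
  refine ⟨k ^ δ / e ^ (3 + A), by positivity, fun x hx => ?_⟩
  have hx0 : 0 < x := by linarith
  have hlog : 0 < Real.log (2 * x) := Real.log_pos (by linarith)
  have h1 : 1 + Real.log (2 * x) ≤ (k * x) ^ e / e := by
    have h2 : 1 + Real.log (2 * x) = Real.log (k * x) := by
      rw [hk, mul_assoc, Real.log_mul (Real.exp_pos 1).ne' (by positivity), Real.log_exp]
    rw [h2]
    exact Real.log_le_rpow_div (by positivity) he0
  have h3 : (1 + Real.log (2 * x)) ^ (3 + A) ≤ k ^ δ * x ^ δ / e ^ (3 + A) := by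
    calc (1 + Real.log (2 * x)) ^ (3 + A) ≤ ((k * x) ^ e / e) ^ (3 + A) := by gcongr
      _ = (k * x) ^ δ / e ^ (3 + A) := by
        rw [Real.div_rpow (by positivity) he0.le, ← Real.rpow_mul (by positivity), he,
          div_mul_cancel₀ _ (by positivity)]
      _ = _ := by rw [Real.mul_rpow hk0.le hx0.le]
  have h4 : (1 + Real.log (2 * x)) ^ 3 * Real.log (2 * x) ^ A ≤
      (1 + Real.log (2 * x)) ^ (3 + A) := by
    rw [Real.rpow_add (by positivity)]
    have : (1 + Real.log (2 * x)) ^ (3 : ℝ) = (1 + Real.log (2 * x)) ^ 3 := by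
      exact_mod_cast Real.rpow_natCast _ 3
    rw [this]
    gcongr
    linarith
  rw [Real.rpow_neg hlog.le, ← div_eq_mul_inv, mul_div_assoc', le_div_iff₀ (by positivity)]
  calc x ^ (1 - δ) * (1 + Real.log (2 * x)) ^ 3 * Real.log (2 * x) ^ A
      = x ^ (1 - δ) * ((1 + Real.log (2 * x)) ^ 3 * Real.log (2 * x) ^ A) := by ring
    _ ≤ x ^ (1 - δ) * (k ^ δ * x ^ δ / e ^ (3 + A)) := by gcongr; exact h4.trans h3
    _ = k ^ δ / e ^ (3 + A) * (x ^ (1 - δ) * x ^ δ) := by ring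
    _ = k ^ δ / e ^ (3 + A) * x := by
        rw [← Real.rpow_add hx0]
        simp

theorem natCast_clog_two_le {Y : ℕ} (hY : 1 ≤ Y) :
    (Nat.clog 2 Y : ℝ) ≤ 2 * (1 + Real.log Y) := by
  have hY0 : (1 : ℝ) ≤ Y := by exact_mod_cast hY
  have hlogY := Real.log_nonneg hY0
  rcases Nat.eq_zero_or_pos (Nat.clog 2 Y) with h0 | h0
  · rw [h0]
    push_cast
    linarith
  · obtain ⟨k, hk⟩ := Nat.exists_eq_succ_of_ne_zero h0.ne'
    have h1 : 2 ^ k < Y := (Nat.lt_clog_iff_pow_lt (by norm_num)).mp (by omega)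
    have h2 : (2 : ℝ) ^ k ≤ Y := by exact_mod_cast h1.le
    have h3 : (k : ℝ) * Real.log 2 ≤ Real.log Y := by
      rw [← Real.log_pow]
      exact Real.log_le_log (by positivity) h2
    have h4 := Real.log_two_gt_d9
    rw [hk]
    push_cast
    nlinarith [(Nat.cast_nonneg k : (0 : ℝ) ≤ k)]

namespace IsLinearRecurrenceBase

variable {G : ℕ → ℕ} {d : ℕ} {a : ℕ → ℕ}

theorem exists_length_le (h : IsLinearRecurrenceBase G d a) :
    ∃ C : ℝ, 0 < C ∧ ∀ (x : ℝ) (l : ℕ), 1 ≤ x → (∀ i < l, (G i : ℝ) ≤ 2 * x) →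
      (l : ℝ) ≤ C * (1 + Real.log (2 * x)) := by
  obtain ⟨c, C', hc, hC', hgrow⟩ := h.exists_growth
  have hα := h.isDominantRoot_dominantRoot.1
  set α := dominantRoot d a
  have hlogα := Real.log_pos hα
  refine ⟨1 + (1 + |Real.log c|) / Real.log α, by positivity, fun x l hx hl => ?_⟩
  have hlogx : 0 ≤ Real.log (2 * x) := Real.log_nonneg (by linarith)
  rcases Nat.eq_zero_or_pos l with h0 | h0
  · rw [h0]
    push_cast
    positivity
  · obtain ⟨k, rfl⟩ := Nat.exists_eq_succ_of_ne_zero h0.ne'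
    have h1 : c * α ^ k ≤ 2 * x := (hgrow k).1.trans (hl k (by omega))
    have h2 := Real.log_le_log (by positivity) h1
    rw [Real.log_mul hc.ne' (by positivity), Real.log_pow] at h2
    have h3 : (k : ℝ) ≤ (Real.log (2 * x) + |Real.log c|) / Real.log α := by
      rw [le_div_iff₀ hlogα]
      linarith [neg_abs_le (Real.log c)]
    have h4 : (Real.log (2 * x) + |Real.log c|) / Real.log α ≤
        (1 + |Real.log c|) / Real.log α * (1 + Real.log (2 * x)) := by
      rw [div_mul_eq_mul_div]
      gcongr
      nlinarith [abs_nonneg (Real.log c)]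
    push_cast
    linarith

/-- Each level and dyadic block contributes O(x^(1 - 2εη)). The three logarithms are the harmonic
sum over common factors, the number of dyadic blocks and the number of levels. -/
theorem exists_level_sum_le (h : IsLinearRecurrenceBase G d a) (θ : ℝ)
    (hθ : unitExp ((∑ i ∈ Finset.Icc 1 d, (a i : ℝ) - 1) * θ) ≠ 1) (A ε : ℝ) (hA : 0 < A)
    (hε0 : 0 < ε) (hε : ε ≤ 1 / 4) :
    ∃ C : ℝ, ∀ (x : ℝ) (l : ℕ), 1 ≤ x → (∀ i < l, (G i : ℝ) ≤ 2 * x) →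
      ∑ q ∈ Finset.Ico 1 ⌈x ^ (levelExponent d a - ε)⌉₊, 1 / (q : ℝ) *
        ∑ t ∈ Finset.range q, ∑ i ∈ Finset.range l, ‖expSum G θ (t / q) (G i)‖ ≤
      C * (x * Real.log (2 * x) ^ (-A)) := by
  have hv : 1 / 2 ≤ levelExponent d a := le_max_left _ _
  have hv1 := h.levelExponent_le_one
  set v := levelExponent d a
  obtain ⟨C₁, η, hC₁, hη0, hη, hblock⟩ := h.exists_block_bound θ hθ (κ := 1 - v) (by linarith)
    (h.spacedBound_levelExponent θ)
  obtain ⟨C₂, hC₂, hlen⟩ := h.exists_length_le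
  obtain ⟨C₃, hC₃, hlogs⟩ := exists_rpow_mul_log_le (2 * ε * η) A (by positivity) hA
  refine ⟨8 * C₁ * C₂ * C₃, fun x l hx hl => ?_⟩
  set X := x ^ (v - ε)
  set Y := ⌈X⌉₊ with hY
  set L := 1 + Real.log (2 * x) with hL
  have hlogx : 0 ≤ Real.log (2 * x) := Real.log_nonneg (by linarith)
  have hX1 : 1 ≤ X := Real.one_le_rpow hx (by linarith)
  have hXx : X ≤ x := by
    calc X ≤ x ^ (1 : ℝ) := Real.rpow_le_rpow_of_exponent_le hx (by linarith)
      _ = x := Real.rpow_one x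
  have hY1 : 1 ≤ Y := Nat.one_le_ceil_iff.mpr (by linarith)
  have hY2 : (Y : ℝ) ≤ 2 * x := by
    have := Nat.ceil_lt_add_one (show 0 ≤ X by linarith)
    linarith
  have hYpos : (0 : ℝ) < Y := by exact_mod_cast hY1
  have hlogY : Real.log Y ≤ Real.log (2 * x) := Real.log_le_log hYpos hY2
  have hharm : ∑ g ∈ Finset.Ico 1 Y, 1 / (g : ℝ) ≤ L := by
    have h1 := sum_one_div_le Y
    rw [Finset.sum_Ico_eq_sum_range]
    have h2 : ∑ k ∈ Finset.range (Y - 1), 1 / ((1 + k : ℕ) : ℝ) ≤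
        ∑ b ∈ Finset.range Y, 1 / ((b : ℝ) + 1) := by
      refine le_trans (le_of_eq ?_) (Finset.sum_le_sum_of_subset_of_nonneg
        (Finset.range_mono (show Y - 1 ≤ Y by omega)) fun i _ _ => by positivity)
      apply Finset.sum_congr rfl
      intro k _
      push_cast
      rw [add_comm]
    linarith
  have hclog : (Nat.clog 2 Y : ℝ) ≤ 2 * L := (natCast_clog_two_le hY1).trans (by linarith)
  have hlevel : ∀ i ∈ Finset.range l, ∑ q ∈ Finset.Ico 1 Y, 1 / (q : ℝ) *
      ∑ t ∈ Finset.range q, ‖expSum G θ (t / q) (G i)‖ ≤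
      L * (2 * L * (C₁ * (4 * x ^ (1 - 2 * ε * η)))) := by
    intro i hi
    have hGi : (0 : ℝ) < G i := by exact_mod_cast h.pos i
    have hGx := hl i (Finset.mem_range.mp hi)
    refine (sum_fractions_le (fun β => ‖expSum G θ β (G i)‖) (fun _ => norm_nonneg _) Y).trans ?_
    have hnn : ∀ c : ℕ, 0 ≤ 1 / (c : ℝ) * ∑ u ∈ (Finset.range c).filter (fun u => u.Coprime c),
        ‖expSum G θ (u / c) (G i)‖ := fun c =>
      mul_nonneg (by positivity) (Finset.sum_nonneg fun _ _ => norm_nonneg _)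
    refine mul_le_mul hharm ?_ (Finset.sum_nonneg fun c _ => hnn c) (by positivity)
    · calc ∑ c ∈ (Finset.Ico 1 Y : Finset ℕ), 1 / (c : ℝ) *
            ∑ u ∈ (Finset.range c).filter (fun u => u.Coprime c), ‖expSum G θ (u / c) (G i)‖
          ≤ ∑ c ∈ (Finset.Ico 1 (2 ^ Nat.clog 2 Y) : Finset ℕ), 1 / (c : ℝ) *
            ∑ u ∈ (Finset.range c).filter (fun u => u.Coprime c),
              ‖expSum G θ (u / c) (G i)‖ := by
            apply Finset.sum_le_sum_of_subset_of_nonneg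
            · exact Finset.Ico_subset_Ico_right (Nat.le_pow_clog (by norm_num) Y)
            · exact fun c _ _ => hnn c
        _ = ∑ k ∈ Finset.range (Nat.clog 2 Y), ∑ c ∈ (Finset.Ico (2 ^ k) (2 ^ (k + 1)) : Finset ℕ),
            1 / (c : ℝ) * ∑ u ∈ (Finset.range c).filter (fun u => u.Coprime c),
              ‖expSum G θ (u / c) (G i)‖ := sum_dyadic _ _
        _ ≤ ∑ k ∈ Finset.range (Nat.clog 2 Y), C₁ * (4 * x ^ (1 - 2 * ε * η)) := by
            apply Finset.sum_le_sum
            intro k hk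
            have hkY : 2 ^ k < Y :=
              (Nat.lt_clog_iff_pow_lt (by norm_num)).mp (Finset.mem_range.mp hk)
            have hkX : ((2 ^ k : ℕ) : ℝ) ≤ X := (Nat.lt_ceil.mp hkY).le
            have hk1 : (1 : ℝ) ≤ ((2 ^ k : ℕ) : ℝ) := by exact_mod_cast Nat.one_le_two_pow
            obtain ⟨P, hP1, hP2, hP3⟩ := exists_farey (2 ^ k) (by positivity)
            have hb := hblock (2 ^ k) i P (by positivity) hP1 hP2
            have harith := block_arith hx hv hv1 hε0 hε hη0 hη hGi hGx hk1 hkX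
            set y : ℝ := ((2 ^ k : ℕ) : ℝ)
            have hy0 : 0 < y := by linarith
            calc _ ≤ ∑ c ∈ Finset.Ico (2 ^ k) (2 ^ (k + 1)), 1 / y *
                  ∑ u ∈ (Finset.range c).filter (fun u => u.Coprime c),
                    ‖expSum G θ (u / c) (G i)‖ := by
                  apply Finset.sum_le_sum
                  intro c hc
                  have hc' : y ≤ (c : ℝ) := Nat.cast_le.mpr (Finset.mem_Ico.mp hc).1
                  gcongr
              _ = 1 / y * ∑ β ∈ P, ‖expSum G θ β (G i)‖ := by
                  rw [← Finset.mul_sum, pow_succ, mul_comm (2 ^ k) 2,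
                    hP3 (fun β => ‖expSum G θ β (G i)‖)]
              _ ≤ 1 / y * (C₁ * (y ^ 2 * (G i : ℝ) ^ (1 - v) +
                  (G i : ℝ) ^ (1 - η) * (y ^ 2) ^ (η + (1 - v)))) := by gcongr
              _ = C₁ * (1 / y * (y ^ 2 * (G i : ℝ) ^ (1 - v) +
                  (G i : ℝ) ^ (1 - η) * (y ^ 2) ^ (η + (1 - v)))) := by ring
              _ ≤ _ := by gcongr
        _ = Nat.clog 2 Y * (C₁ * (4 * x ^ (1 - 2 * ε * η))) := by simp
        _ ≤ 2 * L * (C₁ * (4 * x ^ (1 - 2 * ε * η))) := by gcongr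
  calc ∑ q ∈ Finset.Ico 1 Y, 1 / (q : ℝ) *
        ∑ t ∈ Finset.range q, ∑ i ∈ Finset.range l, ‖expSum G θ (t / q) (G i)‖
      = ∑ i ∈ Finset.range l, ∑ q ∈ Finset.Ico 1 Y, 1 / (q : ℝ) *
        ∑ t ∈ Finset.range q, ‖expSum G θ (t / q) (G i)‖ := by
        rw [Finset.sum_comm]
        apply Finset.sum_congr rfl
        intro q _
        rw [← Finset.mul_sum, Finset.sum_comm]
    _ ≤ ∑ i ∈ Finset.range l, L * (2 * L * (C₁ * (4 * x ^ (1 - 2 * ε * η)))) :=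
        Finset.sum_le_sum hlevel
    _ = l * (L * (2 * L * (C₁ * (4 * x ^ (1 - 2 * ε * η))))) := by simp
    _ ≤ (C₂ * L) * (L * (2 * L * (C₁ * (4 * x ^ (1 - 2 * ε * η))))) := by
        gcongr
        exact hlen x l hx hl
    _ = 8 * C₁ * C₂ * (x ^ (1 - 2 * ε * η) * L ^ 3) := by ring
    _ ≤ 8 * C₁ * C₂ * (C₃ * (x * Real.log (2 * x) ^ (-A))) := by
        exact mul_le_mul_of_nonneg_left (hlogs x hx) (by positivity)
    _ = _ := by ring

/-- Otherwise s would divide (a_1 + ⋯ + a_d - 1) l, hence l by coprimality, against 0 < l < s. -/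
theorem unitExp_ne_one (h : IsLinearRecurrenceBase G d a) {s l : ℕ}
    (hgcd : Nat.gcd ((∑ i ∈ Finset.Icc 1 d, a i) - 1) s = 1) (hl : 1 ≤ l) (hls : l < s) :
    unitExp ((∑ i ∈ Finset.Icc 1 d, (a i : ℝ) - 1) * (l / s)) ≠ 1 := by
  have hs : (s : ℝ) ≠ 0 := by exact_mod_cast (by omega : s ≠ 0)
  have h2 := h.two_le_sum
  have hcast : (∑ i ∈ Finset.Icc 1 d, (a i : ℝ) - 1) =
      (((∑ i ∈ Finset.Icc 1 d, a i) - 1 : ℕ) : ℝ) := by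
    rw [Nat.cast_sub (by omega)]
    push_cast
    rfl
  rw [hcast]
  set m := (∑ i ∈ Finset.Icc 1 d, a i) - 1
  rw [Ne, unitExp_eq_one_iff]
  rintro ⟨n, hn⟩
  rw [mul_div_assoc', div_eq_iff hs] at hn
  have hn' : (m : ℤ) * l = n * s := by exact_mod_cast hn
  have hdvd : s ∣ m * l := by
    have : (s : ℤ) ∣ ((m * l : ℕ) : ℤ) := ⟨n, by push_cast; linarith⟩
    exact_mod_cast this
  have hcop : Nat.Coprime s m := Nat.Coprime.symm hgcd
  have := Nat.le_of_dvd (by omega) (hcop.dvd_of_dvd_mul_left hdvd)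
  omega

theorem maxDiscrepancy_nonneg (G : ℕ → ℕ) (r s q : ℕ) (hq : 1 ≤ q) (x : ℝ) :
    0 ≤ maxDiscrepancy G r s q x := by
  obtain ⟨z, -, h, -, -, hD⟩ := (isGreatest_maxDiscrepancy G r s q hq x).1
  rw [hD]
  exact abs_nonneg _

theorem exists_sum_maxDiscrepancy_le (h : IsLinearRecurrenceBase G d a) (s : ℕ) (hs : 1 ≤ s)
    (hgcd : Nat.gcd ((∑ i ∈ Finset.Icc 1 d, a i) - 1) s = 1) (A ε : ℝ) (hA : 0 < A)
    (hε0 : 0 < ε) (hε : ε ≤ 1 / 4) :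
    ∃ C : ℝ, ∀ r : ℕ, ∀ x : ℝ, 1 ≤ x →
      ∑ q ∈ Finset.Ico 1 ⌈x ^ (levelExponent d a - ε)⌉₊, maxDiscrepancy G r s q x
        ≤ C * (x * Real.log (2 * x) ^ (-A)) := by
  have hv1 := h.levelExponent_le_one
  set v := levelExponent d a with hvdef
  obtain ⟨R, hR⟩ := h.exists_norm_expSum_le_sum
  -- The range of l is placed inside the existential so that constants can be chosen for all l;
  -- outside it the value 0 is irrelevant.
  have hlevel : ∀ l : ℕ, ∃ C : ℝ, 1 ≤ l → l < s → ∀ (x : ℝ) (n : ℕ), 1 ≤ x →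
      (∀ i < n, (G i : ℝ) ≤ 2 * x) →
      ∑ q ∈ Finset.Ico 1 ⌈x ^ (v - ε)⌉₊, 1 / (q : ℝ) *
        ∑ t ∈ Finset.range q, ∑ i ∈ Finset.range n, ‖expSum G (l / s) (t / q) (G i)‖ ≤
      C * (x * Real.log (2 * x) ^ (-A)) := by
    intro l
    by_cases hl : 1 ≤ l ∧ l < s
    · obtain ⟨C, hC⟩ := h.exists_level_sum_le (l / s) (h.unitExp_ne_one hgcd hl.1 hl.2) A ε hA
        hε0 hε
      exact ⟨C, fun _ _ => hC⟩
    · exact ⟨0, fun h1 h2 => absurd ⟨h1, h2⟩ hl⟩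
  choose Cl hCl using hlevel
  obtain ⟨C₀, hC₀, hlogs⟩ := exists_rpow_mul_log_le ε A hε0 hA
  refine ⟨C₀ + R * ∑ l ∈ Finset.Ico 1 s, Cl l, fun r x hx => ?_⟩
  have hx0 : 0 < x := by linarith
  set Y := ⌈x ^ (v - ε)⌉₊
  have hex : ∃ n, ⌈x⌉₊ < G n :=
    ⟨⌈x⌉₊, by have := succ_le_of_strictMono h.strictMono h.zero ⌈x⌉₊; omega⟩
  classical
  obtain ⟨n, hn, hmin⟩ : ∃ n, ⌈x⌉₊ < G n ∧ ∀ i < n, ¬ ⌈x⌉₊ < G i :=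
    ⟨Nat.find hex, Nat.find_spec hex, fun i => Nat.find_min hex⟩
  have hsmall : ∀ i < n, (G i : ℝ) ≤ 2 * x := by
    intro i hi
    have h1 : (G i : ℝ) ≤ (⌈x⌉₊ : ℝ) := by exact_mod_cast not_lt.mp (hmin i hi)
    have h2 := Nat.ceil_lt_add_one hx0.le
    linarith
  have hmax : ∀ q ∈ Finset.Ico 1 Y, maxDiscrepancy G r s q x ≤ 1 + ∑ l ∈ Finset.Ico 1 s,
      R * (1 / (q : ℝ) * ∑ t ∈ Finset.range q, ∑ i ∈ Finset.range n,
        ‖expSum G (l / s) (t / q) (G i)‖) := by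
    intro q hq
    have hq1 := (Finset.mem_Ico.mp hq).1
    obtain ⟨z, hz, b, -, -, hD⟩ := (isGreatest_maxDiscrepancy G r s q hq1 x).1
    rw [hD]
    refine (discrepancy_le G r s q b z hs hq1).trans ?_
    refine add_le_add le_rfl (Finset.sum_le_sum fun l _ => ?_)
    rw [mul_left_comm]
    refine mul_le_mul_of_nonneg_left ?_ (by positivity)
    rw [Finset.mul_sum]
    apply Finset.sum_le_sum
    intro t _
    exact hR _ _ n _ ((Nat.ceil_mono hz.le).trans_lt hn)
  -- The trivial character modulo s contributes 1 for each q, hence at most x^(ϑ-ε) ≤ x^(1-ε) in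
  -- total.
  have hcount : ((Y - 1 : ℕ) : ℝ) ≤ C₀ * (x * Real.log (2 * x) ^ (-A)) := by
    refine le_trans ?_ (hlogs x hx)
    have h1 : ((Y - 1 : ℕ) : ℝ) ≤ x ^ (v - ε) := by
      rcases Nat.eq_zero_or_pos Y with h0 | h0
      · rw [h0]
        simp
        positivity
      · exact (Nat.lt_ceil.mp (show Y - 1 < Y by omega)).le
    have h2 : x ^ (v - ε) ≤ x ^ (1 - ε) :=
      Real.rpow_le_rpow_of_exponent_le hx (by linarith)
    have h3 : 1 ≤ (1 + Real.log (2 * x)) ^ 3 := by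
      apply one_le_pow₀
      have := Real.log_nonneg (show 1 ≤ 2 * x by linarith)
      linarith
    have h4 : 0 ≤ x ^ (1 - ε) := by positivity
    nlinarith
  calc ∑ q ∈ Finset.Ico 1 Y, maxDiscrepancy G r s q x
      ≤ ∑ q ∈ Finset.Ico 1 Y, (1 + ∑ l ∈ Finset.Ico 1 s,
        R * (1 / (q : ℝ) * ∑ t ∈ Finset.range q, ∑ i ∈ Finset.range n,
          ‖expSum G (l / s) (t / q) (G i)‖)) := Finset.sum_le_sum hmax
    _ = ((Y - 1 : ℕ) : ℝ) + ∑ l ∈ Finset.Ico 1 s, R * ∑ q ∈ Finset.Ico 1 Y,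
        (1 / (q : ℝ) * ∑ t ∈ Finset.range q, ∑ i ∈ Finset.range n,
          ‖expSum G (l / s) (t / q) (G i)‖) := by
        rw [Finset.sum_add_distrib, Finset.sum_comm]
        simp only [← Finset.mul_sum]
        simp
    _ ≤ C₀ * (x * Real.log (2 * x) ^ (-A)) + ∑ l ∈ Finset.Ico 1 s,
        R * (Cl l * (x * Real.log (2 * x) ^ (-A))) := by
        refine add_le_add hcount (Finset.sum_le_sum fun l hl => ?_)
        have hl' := Finset.mem_Ico.mp hl
        exact mul_le_mul_of_nonneg_left (hCl l hl'.1 hl'.2 x n hx hsmall) (Nat.cast_nonneg R)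
    _ = _ := by
        rw [← Finset.mul_sum, ← Finset.sum_mul]
        ring

end IsLinearRecurrenceBase

theorem theorem1p1 :
    (∀ (G : ℕ → ℕ) (d : ℕ) (a : ℕ → ℕ), IsLinearRecurrenceBase G d a →
      (1 / 2 : ℝ) ≤ levelExponent d a ∧
      ∀ s : ℕ, 1 ≤ s → Nat.gcd ((∑ i ∈ Finset.Icc 1 d, a i) - 1) s = 1 →
        ∀ A ε : ℝ, 0 < A → 0 < ε → ∃ C : ℝ, ∀ r : ℕ, ∀ x : ℝ, 1 ≤ x →
          -- the sum runs over the integers `q ≥ 1` with `q < x ^ (ϑ - ε)`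
          ∑ q ∈ Finset.Ico 1 ⌈x ^ (levelExponent d a - ε)⌉₊, maxDiscrepancy G r s q x
            ≤ C * (x * Real.log (2 * x) ^ (-A))) ∧
    (∀ δ : ℝ, 0 < δ → ∃ K : ℕ, ∀ (G : ℕ → ℕ) (d : ℕ) (a : ℕ → ℕ),
      IsLinearRecurrenceBase G d a → K ≤ a 1 → |levelExponent d a - 1| < δ) := by
  refine ⟨fun G d a h => ⟨le_max_left _ _, fun s hs hgcd A ε hA hε => ?_⟩,
    levelExponent_tendsto⟩
  -- Decreasing ε only enlarges the range of q, and the summands are nonnegative.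
  obtain ⟨C, hC⟩ := h.exists_sum_maxDiscrepancy_le s hs hgcd A (min ε (1 / 4)) hA
    (lt_min hε (by norm_num)) (min_le_right _ _)
  refine ⟨C, fun r x hx => le_trans ?_ (hC r x hx)⟩
  apply Finset.sum_le_sum_of_subset_of_nonneg
  · apply Finset.Ico_subset_Ico_right
    apply Nat.ceil_mono
    apply Real.rpow_le_rpow_of_exponent_le hx
    linarith [min_le_left ε (1 / 4)]
  · intro q hq _
    exact IsLinearRecurrenceBase.maxDiscrepancy_nonneg G r s q (Finset.mem_Ico.mp hq).1 x
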